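/- Let $K$ be a smooth knot in $S^3$ and let $\mu_K$ be a meridian loop for $K$, i.e. a smooth knot which is the boundary $\varphi(\{x\}\times\partial D^2)$ of a fibre disc of some smooth tubular neighbourhood $\varphi\colon S^1\times D^2\to S^3$ of $K$. The exterior $X(J)$ of a knot $J$ is the complement in $S^3$ of an open tubular neighbourhood of $J$. Let $\nu_K\colon S^1\times D^2\to S^3$ be a smooth tubular neighbourhood of $K$ which is $0$-framed (the longitude $\nu_K(S^1\times\{1\})$ is null-homologous in $S^3\setminus\nu_K(S^1\times\mathrm{int}\,D^2)$), and let $\nu_\mu\colon S^1\times D^2\to S^3$ be a smooth tubular neighbourhood of $\mu_K$ whose closed image is disjoint from that of $\nu_K$. Put $X(\mu_K)=S^3\setminus\nu_\mu(S^1\times\mathrm{int}\,D^2)$, and let $N$ be the result of $0$-framed surgery on $K$ in $X(\mu_K)$: $$N=\bigl(X(\mu_K)\setminus\nu_K(S^1\times\mathrm{int}\,D^2)\bigr)\cup_{\partial}(D^2\times S^1),$$ where $(z,w)\in\partial D^2\times S^1$ is identified with $\nu_K(z,w)$. Then $X(\mu_K)$ is homeomorphic to $S^1\times D^2$; $N$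 is a topological $3$-manifold with boundary, whose boundary is the image of $T=\nu_\mu(S^1\times\partial D^2)$ and is a torus; and $N$ is homeomorphic to the exterior $X(K)$ formed with any smooth tubular neighbourhood of $K$. -/

import Mathlib

open scoped Manifold ContDiff Topology

noncomputable section

instance instFactFinrankEuclideanFour :
    Fact (Module.finrank ℝ (EuclideanSpace ℝ (Fin 4)) = 3 + 1) :=
  ⟨by simp⟩

/-- The 3-sphere, as a smooth manifold. -/
abbrev S3 : Type := Metric.sphere (0 : EuclideanSpace ℝ (Fin 4)) 1

/-- The closed unit disc. -/
abbrev D2 : Type := Metric.closedBall (0 : ℂ) 1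

/-- A (smooth) knot in the 3-sphere: a smooth embedding of the circle. -/
structure Knot where
  toFun : Circle → S3
  isSmoothEmbedding : Manifold.IsSmoothEmbedding (𝓡 1) (𝓡 3) ∞ toFun

/-- A smoothly embedded open solid torus in the 3-sphere, parametrized by `S¹ × ℝ²`
(an injective local diffeomorphism, i.e. a diffeomorphism onto an open subset). The restriction
to `S¹ × D²` is a smooth closed tube together with a parametrization; conversely every smooth
parametrized closed tube extends to such an open one. -/
structure Tube where
  toFun : Circle × ℂ → S3
  isLocalDiffeomorph : IsLocalDiffeomorph ((𝓡 1).prod 𝓘(ℝ, ℂ)) (𝓡 3) ∞ toFun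
  injective : Function.Injective toFun

namespace Tube

variable (T : Tube)

/-- `T` is a tubular neighbourhood of the knot `K`: its core is `K`. -/
def IsTubeOf (K : Knot) : Prop :=
  T.toFun '' (Set.univ ×ˢ {0}) = Set.range K.toFun

/-- The closed tube `T (S¹ × D²)`. -/
def closedSolid : Set S3 := T.toFun '' (Set.univ ×ˢ Metric.closedBall 0 1)

/-- The open tube `T (S¹ × int D²)`. -/
def openSolid : Set S3 := T.toFun '' (Set.univ ×ˢ Metric.ball 0 1)

/-- The torus `T (S¹ × ∂D²)`. -/
def torus : Set S3 := T.toFun '' (Set.univ ×ˢ Metric.sphere 0 1)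

/-- The exterior of the core of `T`: the complement of the open tube. If `T` is a tubular
neighbourhood of the knot `K`, this is the knot exterior `X(K)`. -/
def exterior : Set S3 := T.openSolidᶜ

/-- The longitude `T (S¹ × {1})` determined by the parametrization, as a loop in the exterior. -/
def longitude : C(Circle, T.exterior) where
  toFun z := ⟨T.toFun (z, 1), by
    rintro ⟨⟨a, b⟩, ⟨-, hb⟩, h⟩
    have h2 := congrArg Prod.snd (T.injective h)
    simp only at h2
    subst h2
    simp at hb⟩
  continuous_toFun := by
    refine Continuous.subtype_mk ?_ _
    exact T.isLocalDiffeomorph.contMDiff.continuous.comp (by fun_prop)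

/-- The framing of the core given by `T` is the `0`-framing: the longitude `T (S¹ × {1})` is
null-homologous in the exterior, i.e. it induces the zero map on `H₁(-; ℤ)`. -/
def IsZeroFramed : Prop :=
  ((AlgebraicTopology.singularHomologyFunctor (ModuleCat.{0} ℤ) 1).obj (ModuleCat.of ℤ ℤ)).map
    (TopCat.ofHom T.longitude) = 0

/-- The gluing for surgery along `T` inside a region `A`: a point `(z, w)` of the boundary of
`D² × S¹` is identified with the point `T (z, w)` of the boundary of the removed tube, where
the `D²` coordinate of the new solid torus runs along the core of `T`. So the discs
`D² × {w}` are attached along the parallels `T (S¹ × {w})` of the core. -/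
inductive SurgeryRel (A : Set S3) :
    (↥(A \ T.openSolid) ⊕ (D2 × Circle)) → (↥(A \ T.openSolid) ⊕ (D2 × Circle)) → Prop
  | glue (z w : Circle) (e : ↥(A \ T.openSolid)) (v : D2 × Circle)
      (he : (e : S3) = T.toFun (z, (w : ℂ))) (hz : (v.1 : ℂ) = z) (hw : v.2 = w) :
      SurgeryRel A (Sum.inl e) (Sum.inr v)

/-- Surgery inside `A` on the core of `T`, framed by `T`: remove the open tube from `A`, and glue
in `D² × S¹` along the boundary of the tube (with the quotient topology). -/
def Surgery (A : Set S3) : Type := Quot (T.SurgeryRel A)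

instance (A : Set S3) : TopologicalSpace (T.Surgery A) :=
  inferInstanceAs (TopologicalSpace (Quot (T.SurgeryRel A)))

/-- The image in `T.Surgery A` of the part of `B` that lies in `A` and off the open tube. -/
def surgeryImage (A B : Set S3) : Set (T.Surgery A) :=
  {p | ∃ e : ↥(A \ T.openSolid), (e : S3) ∈ B ∧ Quot.mk (T.SurgeryRel A) (Sum.inl e) = p}

end Tube

/-- `μ` is a meridian loop of `K`: the boundary `T ({x} × ∂D²)` of a fibre disc of a (not
necessarily thin) smooth tubular neighbourhood `T` of `K`. -/
def Knot.IsMeridianOf (μ K : Knot) : Prop :=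
  ∃ T : Tube, T.IsTubeOf K ∧
    ∃ x : Circle, Set.range μ.toFun = T.toFun '' ({x} ×ˢ Metric.sphere 0 1)

/-- `X` is a topological 3-manifold with boundary, whose boundary is the subset `B`. -/
def IsThreeManifoldWithBoundary (X : Type) [TopologicalSpace X] (B : Set X) : Prop :=
  T2Space X ∧ SecondCountableTopology X ∧
    ∃ _ : ChartedSpace (EuclideanHalfSpace 3) X, (𝓡∂ 3).boundary X = B

end

/-!
The meridian of `K` bounds a fibre disc of a tube `T` about `K`, so it can be contracted radially
towards the centre of that disc, together with its tubular neighbourhood and without moving a much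
thinner tube `k` about `K` (`Tube.exists_contract_meridian`). A small circle in the fibre disc is
mapped by any coordinate `b` of the disc that vanishes at the centre to a curve winding once around
the origin (`exists_isStarCurve`). Hence the contracted meridian is the graph of a section over the
direction `b / ‖b‖` (`IsStarCurve.exists_graph`). Both uses of the meridian come from this, with two
different choices of coordinates.

* *Exterior of the meridian.* The centre of the disc is a unit vector `p` of `ℝ⁴`, orthogonal to the
  tangent plane `U` of the disc. In the splitting `ℝ⁴ = U ⊕ Uᗮ` the small meridian is a graph over
  the great circle in `U`, so its exterior is that of the great circle: a solid torus
  (`Tube.nonempty_exterior_homeomorph_of_meridian`).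
* *Surgery.* In the coordinates of `k` the small meridian encircles the core, meeting every direction
  from it exactly once. Exchanging the angular coordinate with the position along the core
  (`dualCoord`) turns the punctured tube into `S¹ × (ℂ \ 0)`, and the solid torus glued in by the
  surgery fills in `S¹ × {0}`; the meridian is then a graph in `S¹ × ℂ`, that is, isotopic to the
  core of the new solid torus. Removing a tube about the meridian thus amounts to removing the new
  solid torus again, and what remains is the exterior of `k`
  (`Tube.exists_surgery_homeomorph_of_graph`, `Tube.exists_surgery_homeomorph`).

Isotopies and the uniqueness of tubular neighbourhoods are replaced by one explicit construction of
homeomorphisms. If the core of a tube `n` is the graph of a section in coordinates `S¹ × ℂ`, crossing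
the fibres transversally, then the distance to the core, measured in `n`, increases strictly along
the short rays issuing from the section (`exists_starOn_univ`). Rescaling these rays carries a thin tube of
`n` onto the unit disc bundle (`exists_straightening`). With the zero section this also gives
uniqueness of the exterior of a knot (`Tube.exists_homeomorph_of_core_eq`).

The surgered manifold is therefore homeomorphic to the exterior of `K`, with the boundary torus
corresponding to the boundary torus, and the manifold structure is transported from there
(`Tube.isThreeManifoldWithBoundary_exterior`).
-/

noncomputable section

open Set Metric Topology

attribute [local instance] finrank_real_complex_fact'

/-! ### Fibrewise homeomorphisms of `S¹ × ℂ` -/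

/-- A continuous bijection of `S¹ × ℂ` that is the identity at fibre radius at least `L`. Such a
map is a homeomorphism; only continuity and bijectivity are recorded, because the inverse becomes
continuous for free once the map is extended to a compact Hausdorff space. -/
structure IsSupportedHomeo (Φ : Circle × ℂ → Circle × ℂ) (L : ℝ) : Prop where
  continuous : Continuous Φ
  bijective : Function.Bijective Φ
  eq_self : ∀ p, L ≤ ‖p.2‖ → Φ p = p

namespace IsSupportedHomeo

variable {Φ Ψ : Circle × ℂ → Circle × ℂ} {L L' : ℝ}

theorem mono (h : IsSupportedHomeo Φ L) (hL : L ≤ L') : IsSupportedHomeo Φ L' :=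
  ⟨h.continuous, h.bijective, fun p hp => h.eq_self p (hL.trans hp)⟩

theorem comp (h : IsSupportedHomeo Φ L) (h' : IsSupportedHomeo Ψ L) :
    IsSupportedHomeo (Φ ∘ Ψ) L :=
  ⟨h.continuous.comp h'.continuous, h.bijective.comp h'.bijective, fun p hp => by
    simp only [Function.comp_apply]; rw [h'.eq_self p hp, h.eq_self p hp]⟩

end IsSupportedHomeo

/-- Rescale every ray of the fibres of `S¹ × ℂ`, so that the new radius of `p` is `M p`. -/
def rayMap (M : Circle × ℂ → ℝ) (p : Circle × ℂ) : Circle × ℂ :=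
  (p.1, (M p / ‖p.2‖) • p.2)

section rayMap

variable {M : Circle × ℂ → ℝ} {L : ℝ}

theorem rayMap_smul (M : Circle × ℂ → ℝ) {w : Circle} {e : ℂ} (he : ‖e‖ = 1) {ρ : ℝ}
    (hρ : 0 < ρ) : rayMap M (w, ρ • e) = (w, M (w, ρ • e) • e) := by
  simp only [rayMap, norm_smul, he, Real.norm_eq_abs, abs_of_pos hρ, mul_one, smul_smul]
  rw [div_mul_cancel₀ _ hρ.ne']

theorem exists_eq_smul_unit (v : ℂ) : ∃ e : ℂ, ‖e‖ = 1 ∧ v = ‖v‖ • e := by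
  by_cases hv : v = 0
  · exact ⟨1, by simp, by simp [hv]⟩
  · refine ⟨(‖v‖⁻¹ : ℝ) • v, ?_, ?_⟩
    · rw [norm_smul, norm_inv, norm_norm, inv_mul_cancel₀ (norm_ne_zero_iff.2 hv)]
    · rw [smul_smul, mul_inv_cancel₀ (norm_ne_zero_iff.2 hv), one_smul]

variable (h0 : ∀ w, M (w, 0) = 0)
  (hmono : ∀ w (e : ℂ), ‖e‖ = 1 → StrictMonoOn (fun ρ : ℝ => M (w, ρ • e)) (Ici 0))
include h0 hmono

theorem ray_pos {p : Circle × ℂ} (hp : p.2 ≠ 0) : 0 < M p := by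
  obtain ⟨w, v⟩ := p
  obtain ⟨e, he, hv⟩ := exists_eq_smul_unit v
  have h1 := hmono w e he (a := 0) (b := ‖v‖) (by simp) (by simp)
    (norm_pos_iff.2 hp)
  simp only [zero_smul, h0] at h1
  rwa [← hv] at h1

theorem ray_nonneg (p : Circle × ℂ) : 0 ≤ M p := by
  by_cases hp : p.2 = 0
  · obtain ⟨w, v⟩ := p
    simp only at hp
    rw [hp, h0]
  · exact (ray_pos h0 hmono hp).le

theorem norm_rayMap (p : Circle × ℂ) : ‖(rayMap M p).2‖ = M p := by
  by_cases hp : p.2 = 0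
  · obtain ⟨w, v⟩ := p
    simp only at hp
    simp [rayMap, hp, h0]
  · simp only [rayMap, norm_smul, Real.norm_eq_abs, abs_div, abs_norm]
    rw [div_mul_cancel₀ _ (norm_ne_zero_iff.2 hp), abs_of_nonneg (ray_nonneg h0 hmono p)]

theorem isSupportedHomeo_rayMap (hc : Continuous M) (hL : ∀ p, L ≤ ‖p.2‖ → M p = ‖p.2‖) :
    IsSupportedHomeo (rayMap M) L := by
  have hnorm := norm_rayMap h0 hmono
  refine ⟨?_, ⟨?_, ?_⟩, ?_⟩
  · refine Continuous.prodMk continuous_fst (continuous_iff_continuousAt.2 fun p => ?_)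
    by_cases hp : p.2 = 0
    · rw [ContinuousAt]
      have h1 : (M p / ‖p.2‖) • p.2 = 0 := by simp [hp]
      rw [h1, tendsto_zero_iff_norm_tendsto_zero]
      have h2 : (fun q : Circle × ℂ => ‖(M q / ‖q.2‖) • q.2‖) = M := by
        ext q; exact hnorm q
      rw [h2]
      have h3 : M p = 0 := by rw [← hnorm p]; simp [rayMap, hp]
      rw [← h3]
      exact hc.continuousAt
    · exact (hc.continuousAt.div continuous_snd.norm.continuousAt (norm_ne_zero_iff.2 hp)).smul
        continuous_snd.continuousAt
  · rintro ⟨w, v⟩ ⟨w', v'⟩ h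
    have hw : w = w' := congrArg Prod.fst h
    subst hw
    by_cases hv : v = 0
    · have h1 := hnorm (w, v')
      rw [← h, hnorm, hv, h0] at h1
      by_contra hne
      have : v' ≠ 0 := by rintro rfl; exact hne (by rw [hv])
      exact (ray_pos h0 hmono (p := (w, v')) this).ne h1
    · by_cases hv' : v' = 0
      · have h1 := hnorm (w, v)
        rw [h, hnorm, hv', h0] at h1
        exact absurd h1 (ray_pos h0 hmono (p := (w, v)) hv).ne
      obtain ⟨e, he, hve⟩ := exists_eq_smul_unit v
      obtain ⟨e', he', hve'⟩ := exists_eq_smul_unit v'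
      have hM : M (w, v) = M (w, v') := by rw [← hnorm, ← hnorm, h]
      have hpos := ray_pos h0 hmono (p := (w, v)) hv
      have h1 : rayMap M (w, v) = (w, M (w, v) • e) := by
        conv_lhs => rw [hve]
        rw [rayMap_smul M he (norm_pos_iff.2 hv), ← hve]
      have h2 : rayMap M (w, v') = (w, M (w, v') • e') := by
        conv_lhs => rw [hve']
        rw [rayMap_smul M he' (norm_pos_iff.2 hv'), ← hve']
      rw [h1, h2, ← hM] at h
      have hee : e = e' := smul_right_injective ℂ hpos.ne' (congrArg Prod.snd h)
      subst hee
      have h3 : M (w, ‖v‖ • e) = M (w, ‖v'‖ • e) := by rw [← hve, ← hve', hM]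
      have h4 := (hmono w e he).injOn (by simp) (by simp) h3
      rw [hve, hve', h4]
  · rintro ⟨w, v⟩
    by_cases hv : v = 0
    · exact ⟨(w, 0), by simp [rayMap, hv]⟩
    obtain ⟨e, he, hve⟩ := exists_eq_smul_unit v
    have hcont : Continuous fun ρ : ℝ => M (w, ρ • e) := by fun_prop
    have hb : ‖v‖ ≤ M (w, (max L ‖v‖) • e) := by
      have h5 : ‖(max L ‖v‖) • e‖ = max L ‖v‖ := by
        rw [norm_smul, he, mul_one, Real.norm_eq_abs, abs_of_nonneg]
        exact le_max_of_le_right (norm_nonneg _)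
      rw [hL (w, (max L ‖v‖) • e) (by simp only [h5]; exact le_max_left _ _)]
      simp only [h5]
      exact le_max_right _ _
    obtain ⟨ρ, ⟨hρ0, -⟩, hρ⟩ := intermediate_value_Icc (f := fun ρ : ℝ => M (w, ρ • e))
      (a := 0) (b := max L ‖v‖) (le_max_of_le_right (norm_nonneg _)) hcont.continuousOn
      (show ‖v‖ ∈ _ from ⟨by simp [h0], hb⟩)
    have hρpos : 0 < ρ := by
      rcases hρ0.lt_or_eq with h | h
      · exact h
      · subst h
        simp only [zero_smul, h0] at hρ
        exact absurd hρ.symm (norm_ne_zero_iff.2 hv)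
    refine ⟨(w, ρ • e), ?_⟩
    rw [rayMap_smul M he hρpos]
    simp only at hρ
    rw [hρ, ← hve]
  · rintro ⟨w, v⟩ hp
    by_cases hv : v = 0
    · simp [rayMap, hv]
    · simp only [rayMap]
      rw [hL _ hp, div_self (norm_ne_zero_iff.2 hv), one_smul]

end rayMap

/-- The fibrewise radial map of `S¹ × ℂ` with radius function `φ`. -/
theorem isSupportedHomeo_radial {φ : ℝ → ℝ} {L : ℝ} (hc : Continuous φ) (h0 : φ 0 = 0)
    (hmono : StrictMonoOn φ (Ici 0)) (hL : ∀ ρ, 0 ≤ ρ → L ≤ ρ → φ ρ = ρ) :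
    IsSupportedHomeo (rayMap fun p => φ ‖p.2‖) L ∧
      ∀ p, ‖(rayMap (fun p => φ ‖p.2‖) p).2‖ = φ ‖p.2‖ := by
  have h0' : ∀ w : Circle, (fun p : Circle × ℂ => φ ‖p.2‖) (w, 0) = 0 := fun w => by simp [h0]
  have hm : ∀ (w : Circle) (e : ℂ), ‖e‖ = 1 →
      StrictMonoOn (fun ρ : ℝ => (fun p : Circle × ℂ => φ ‖p.2‖) (w, ρ • e)) (Ici 0) := by
    intro w e he a ha b hb hab
    simp only [norm_smul, he, mul_one, Real.norm_eq_abs, abs_of_nonneg (mem_Ici.1 ha),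
      abs_of_nonneg (mem_Ici.1 hb)]
    exact hmono ha hb hab
  exact ⟨isSupportedHomeo_rayMap h0' hm (by fun_prop) fun p hp => hL _ (norm_nonneg _) hp,
    norm_rayMap h0' hm⟩

theorem rayMap_radial_of_eq {φ : ℝ → ℝ} {p : Circle × ℂ} {c : ℝ} (h : φ ‖p.2‖ = c * ‖p.2‖) :
    rayMap (fun p => φ ‖p.2‖) p = (p.1, c • p.2) := by
  by_cases hv : p.2 = 0
  · simp [rayMap, hv]
  · simp only [rayMap]
    rw [h, mul_div_assoc, div_self (norm_ne_zero_iff.2 hv), mul_one]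

/-- A supported homeomorphism that scales the fibre discs of radius `a` linearly onto those of
radius `b`. -/
theorem exists_radial_scaling {a b L : ℝ} (ha : 0 < a) (hb : 0 < b) (haL : a < L) (hbL : b < L) :
    ∃ Φ, IsSupportedHomeo Φ L ∧ (∀ p, ‖p.2‖ ≤ a → Φ p = (p.1, (b / a) • p.2)) ∧
      ∀ p, (‖(Φ p).2‖ < b ↔ ‖p.2‖ < a) ∧ (‖(Φ p).2‖ ≤ b ↔ ‖p.2‖ ≤ a) := by
  set φ : ℝ → ℝ := fun ρ =>
    if ρ ≤ a then b / a * ρ else if ρ ≤ L then b + (L - b) / (L - a) * (ρ - a) else ρ with hφ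
  have h1 : 0 < b / a := div_pos hb ha
  have h2 : 0 < (L - b) / (L - a) := div_pos (by linarith) (by linarith)
  have h3 : b / a * a = b := by field_simp
  have h4 : (L - b) / (L - a) * (L - a) = L - b := div_mul_cancel₀ _ (by linarith)
  have hc : Continuous φ := by
    refine Continuous.if_le (by fun_prop) (Continuous.if_le (by fun_prop) (by fun_prop)
      (by fun_prop) (by fun_prop) ?_) (by fun_prop) (by fun_prop) ?_
    · rintro x rfl; linarith
    · rintro x rfl; rw [if_pos haL.le]; linarith
  have hm : StrictMono φ := by
    intro x y hxy
    simp only [hφ]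
    have k1 : b / a * x < b / a * y := mul_lt_mul_of_pos_left hxy h1
    have k2 : (L - b) / (L - a) * x < (L - b) / (L - a) * y := mul_lt_mul_of_pos_left hxy h2
    split_ifs with q1 q2 q3 q4 q5 q6 q7
    all_goals try linarith
    · have := mul_le_mul_of_nonneg_left q1 h1.le
      have := mul_lt_mul_of_pos_left (not_le.1 q2) h2
      linarith
    · have := mul_le_mul_of_nonneg_left q1 h1.le
      linarith
    · have := mul_le_mul_of_nonneg_left q4 h2.le
      linarith
  obtain ⟨h5, h6⟩ := isSupportedHomeo_radial (L := L) hc (by simp [hφ, ha.le]) (hm.strictMonoOn _)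
    (fun ρ _ hρ => by
      rcases hρ.lt_or_eq with h | h
      · simp only [hφ]; rw [if_neg (by linarith), if_neg (by linarith)]
      · subst h; simp only [hφ]; rw [if_neg (by linarith), if_pos le_rfl]; linarith)
  have hφa : φ a = b := by simp only [hφ]; rw [if_pos le_rfl, h3]
  refine ⟨_, h5, fun p hp => rayMap_radial_of_eq (by simp only [hφ]; rw [if_pos hp]), fun p => ?_⟩
  rw [h6, ← hφa]
  exact ⟨hm.lt_iff_lt, hm.le_iff_le⟩

/-- A continuous section `s` of `S¹ × ℂ → S¹` can be moved to the zero section by a supported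
homeomorphism which is a fibrewise translation near `s`. -/
theorem exists_translation {s : Circle → ℂ} (hs : Continuous s) :
    ∃ Φ L, 0 < L ∧ IsSupportedHomeo Φ L ∧
      ∀ w v, ‖v‖ ≤ 1 → Φ (w, s w + v) = (w, v) := by
  obtain ⟨B0, hB0⟩ := isCompact_univ.exists_bound_of_continuousOn hs.continuousOn
  set B : ℝ := max B0 0 + 1 with hB
  have hB1 : 1 ≤ B := by simp [hB]
  have hsB : ∀ w, ‖s w‖ ≤ B - 1 := fun w => by
    have := hB0 w (mem_univ _)
    have := le_max_left B0 0
    simp only [hB]; linarith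
  -- a cutoff, `1` up to radius `2 B` and `0` beyond `4 B`, whose Lipschitz constant `1 / (2 B)`
  -- makes `id - χ s` a contractive perturbation of the identity
  set χ : ℝ → ℝ := fun ρ => max 0 (min 1 (2 - ρ / (2 * B))) with hχ
  have hχL : ∀ x y, |χ x - χ y| ≤ |x - y| / (2 * B) := by
    intro x y
    simp only [hχ]
    rw [max_comm 0, max_comm 0]
    refine (abs_max_sub_max_le_abs _ _ _).trans ?_
    refine (abs_min_sub_min_le_max _ _ _ _).trans ?_
    rw [sub_self, abs_zero, max_eq_right (abs_nonneg _)]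
    rw [show 2 - x / (2 * B) - (2 - y / (2 * B)) = -((x - y) / (2 * B)) by ring, abs_neg, abs_div,
      abs_of_pos (show 0 < 2 * B by linarith)]
  have hlip : ∀ w (v v' : ℂ), ‖χ ‖v‖ • s w - χ ‖v'‖ • s w‖ ≤ 1 / 2 * ‖v - v'‖ := by
    intro w v v'
    rw [← sub_smul, norm_smul, Real.norm_eq_abs]
    have h1 : |χ ‖v‖ - χ ‖v'‖| ≤ ‖v - v'‖ / (2 * B) :=
      (hχL _ _).trans (by gcongr; exact abs_norm_sub_norm_le v v')
    calc _ ≤ ‖v - v'‖ / (2 * B) * B := by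
          gcongr; linarith [hsB w]
      _ = 1 / 2 * ‖v - v'‖ := by field_simp
  refine ⟨fun p => (p.1, p.2 - χ ‖p.2‖ • s p.1), 4 * B, by linarith,
    ⟨?_, ⟨?_, ?_⟩, ?_⟩, ?_⟩
  · simp only [hχ]; fun_prop
  · rintro ⟨w, v⟩ ⟨w', v'⟩ h
    have hw : w = w' := congrArg Prod.fst h
    subst hw
    have h1 : v - χ ‖v‖ • s w = v' - χ ‖v'‖ • s w := congrArg Prod.snd h
    have h2 : v - v' = χ ‖v‖ • s w - χ ‖v'‖ • s w := by linear_combination (exp := 1) h1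
    have h3 := hlip w v v'
    rw [← h2] at h3
    have : ‖v - v'‖ = 0 := le_antisymm (by linarith [norm_nonneg (v - v')]) (norm_nonneg _)
    rw [sub_eq_zero.1 (norm_eq_zero.1 this)]
  · rintro ⟨w, y⟩
    have hcon : ContractingWith (1 / 2) fun v : ℂ => y + χ ‖v‖ • s w := by
      refine ⟨by norm_num, LipschitzWith.of_dist_le_mul fun v v' => ?_⟩
      rw [dist_add_left, dist_eq_norm, dist_eq_norm]
      exact (hlip w v v').trans (by norm_num)
    refine ⟨(w, hcon.fixedPoint), ?_⟩
    have h1 := hcon.fixedPoint_isFixedPt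
    simp only [Function.IsFixedPt] at h1
    ext1
    · rfl
    · simp only
      nth_rewrite 1 [← h1]
      ring
  · rintro ⟨w, v⟩ hp
    simp only at hp
    have : χ ‖v‖ = 0 := by
      simp only [hχ]
      apply max_eq_left
      apply min_le_of_right_le
      rw [sub_nonpos, le_div_iff₀ (by linarith)]; linarith
    simp [this]
  · intro w v hv
    have h1 : ‖s w + v‖ ≤ B := (norm_add_le _ _).trans (by linarith [hsB w])
    have : χ ‖s w + v‖ = 1 := by
      simp only [hχ]
      rw [min_eq_left, max_eq_right zero_le_one]
      have : ‖s w + v‖ / (2 * B) ≤ 1 := by rw [div_le_one (by linarith)]; linarith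
      linarith
    simp [this]

namespace Tube

variable (T : Tube)

theorem isOpenEmbedding : IsOpenEmbedding T.toFun :=
  .of_continuous_injective_isOpenMap T.isLocalDiffeomorph.contMDiff.continuous T.injective
    T.isLocalDiffeomorph.isOpenMap

theorem continuous : Continuous T.toFun := T.isOpenEmbedding.continuous

theorem isCompact_image_closedBall (L : ℝ) :
    IsCompact (T.toFun '' (univ ×ˢ closedBall 0 L)) :=
  (isCompact_univ.prod (isCompact_closedBall _ _)).image T.continuous

theorem isOpen_image_ball (L : ℝ) : IsOpen (T.toFun '' (univ ×ˢ ball 0 L)) :=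
  T.isOpenEmbedding.isOpenMap _ (isOpen_univ.prod isOpen_ball)

/-- A supported homeomorphism of `S¹ × ℂ`, transplanted along a tube, extends by the identity to
a homeomorphism of the 3-sphere. -/
theorem exists_homeomorph {Φ : Circle × ℂ → Circle × ℂ} {L : ℝ} (hΦ : IsSupportedHomeo Φ L) :
    ∃ H : S3 ≃ₜ S3, (∀ p, H (T.toFun p) = T.toFun (Φ p)) ∧
      ∀ y, y ∉ T.toFun '' (univ ×ˢ ball 0 L) → H y = y := by
  set f : S3 → S3 := Function.extend T.toFun (T.toFun ∘ Φ) id with hf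
  have h1 : ∀ p, f (T.toFun p) = T.toFun (Φ p) := fun p => T.injective.extend_apply _ _ p
  have h2 : ∀ y, y ∉ T.toFun '' (univ ×ˢ ball 0 L) → f y = y := by
    intro y hy
    by_cases hr : ∃ p, T.toFun p = y
    · obtain ⟨p, rfl⟩ := hr
      rw [h1, hΦ.eq_self]
      by_contra! h3
      exact hy ⟨p, by simpa using h3, rfl⟩
    · exact Function.extend_apply' _ _ _ hr
  have hc : Continuous f := by
    rw [continuous_iff_continuousAt]
    intro y
    by_cases hr : ∃ p, T.toFun p = y
    · obtain ⟨p, rfl⟩ := hr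
      rw [← T.isOpenEmbedding.continuousAt_iff]
      have : f ∘ T.toFun = T.toFun ∘ Φ := funext h1
      rw [this]
      exact (T.continuous.comp hΦ.continuous).continuousAt
    · have h3 : y ∈ (T.toFun '' (univ ×ˢ closedBall 0 L))ᶜ := fun ⟨p, _, hp⟩ => hr ⟨p, hp⟩
      refine continuousAt_id.congr ?_
      filter_upwards [(T.isCompact_image_closedBall L).isClosed.isOpen_compl.mem_nhds h3] with z hz
      exact (h2 z fun h => hz (image_mono (prod_mono_right ball_subset_closedBall) h)).symm
  have hb : Function.Bijective f := by
    constructor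
    · intro y y' h
      by_cases hr : ∃ p, T.toFun p = y <;> by_cases hr' : ∃ p, T.toFun p = y'
      · obtain ⟨p, rfl⟩ := hr
        obtain ⟨p', rfl⟩ := hr'
        rw [h1, h1] at h
        rw [hΦ.bijective.1 (T.injective h)]
      · obtain ⟨p, rfl⟩ := hr
        rw [h1, h2 y' fun ⟨p, _, hp⟩ => hr' ⟨p, hp⟩] at h
        exact absurd ⟨_, h⟩ hr'
      · obtain ⟨p, rfl⟩ := hr'
        rw [h1, h2 y fun ⟨p, _, hp⟩ => hr ⟨p, hp⟩] at h
        exact absurd ⟨_, h.symm⟩ hr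
      · rwa [h2 y fun ⟨p, _, hp⟩ => hr ⟨p, hp⟩, h2 y' fun ⟨p, _, hp⟩ => hr' ⟨p, hp⟩] at h
    · intro y
      by_cases hr : ∃ p, T.toFun p = y
      · obtain ⟨p, rfl⟩ := hr
        obtain ⟨q, rfl⟩ := hΦ.bijective.2 p
        exact ⟨_, h1 q⟩
      · exact ⟨y, h2 y fun ⟨p, _, hp⟩ => hr ⟨p, hp⟩⟩
  exact ⟨Continuous.homeoOfEquivCompactToT2 (f := Equiv.ofBijective f hb) hc, h1, h2⟩

end Tube

/-! ### The star lemma: radial straightening -/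

/-- `h` is strictly differentiable along the fibres of `S¹ × ℂ → S¹` at `p`, locally uniformly in
the base point, with fibre derivative `L`. -/
def HasStrictFibreDerivAt (h : Circle × ℂ → ℂ) (L : ℂ →L[ℝ] ℂ) (p : Circle × ℂ) : Prop :=
  ∀ κ : ℝ, 0 < κ → ∀ᶠ q : (Circle × ℂ) × ℂ in 𝓝 (p, p.2),
    ‖h q.1 - h (q.1.1, q.2) - L (q.1.2 - q.2)‖ ≤ κ * ‖q.1.2 - q.2‖

theorem exists_norm_lower_bound {L : ℂ →L[ℝ] ℂ} (hL : Function.Injective L) :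
    ∃ m : ℝ, 0 < m ∧ ∀ v, m * ‖v‖ ≤ ‖L v‖ := by
  obtain ⟨K, hK, h⟩ := L.toLinearMap.exists_antilipschitzWith (LinearMap.ker_eq_bot.2 hL)
  refine ⟨(K : ℝ)⁻¹, inv_pos.2 hK, fun v => ?_⟩
  have h1 := h.le_mul_dist v 0
  simp only [dist_zero_right, map_zero, ContinuousLinearMap.coe_coe] at h1
  rw [inv_mul_le_iff₀ (NNReal.coe_pos.2 hK)]
  exact h1

/-- A vector function of the radius that is close to a nonzero linear function has strictly
increasing norm. -/
theorem norm_lt_norm_of_approx {a F F' : ℂ} {κ ρ ρ' : ℝ} (hρ' : 0 ≤ ρ') (h : ρ' < ρ)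
    (hκ : 0 < κ) (ha : 4 * κ ≤ ‖a‖) (h1 : ‖F - ρ • a‖ ≤ κ * ρ) (h2 : ‖F' - ρ' • a‖ ≤ κ * ρ')
    (h3 : ‖F - F' - (ρ - ρ') • a‖ ≤ κ * (ρ - ρ')) : ‖F'‖ < ‖F‖ := by
  set x := F - ρ • a
  set y := F' - ρ' • a
  set z := F - F' - (ρ - ρ') • a
  have hF : ‖F‖ ^ 2 - ‖F'‖ ^ 2 = inner ℝ (F - F') (F + F') := by
    rw [inner_sub_left, inner_add_right, inner_add_right, real_inner_self_eq_norm_sq,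
      real_inner_self_eq_norm_sq, real_inner_comm F F']
    ring
  have e1 : F - F' = (ρ - ρ') • a + z := by simp [z]
  have e2 : F + F' = (ρ + ρ') • a + (x + y) := by simp only [x, y, add_smul]; ring
  have hxy : ‖x + y‖ ≤ κ * (ρ + ρ') := (norm_add_le _ _).trans (by linarith)
  have hs : 0 < ρ - ρ' := by linarith
  have ht : 0 < ρ + ρ' := by linarith
  have i1 : -(‖a‖ * (κ * (ρ + ρ'))) ≤ inner ℝ a (x + y) :=
    (neg_le_neg (mul_le_mul_of_nonneg_left hxy (norm_nonneg _))).trans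
      (neg_le_of_abs_le (abs_real_inner_le_norm _ _))
  have i2 : -(κ * (ρ - ρ') * ‖a‖) ≤ inner ℝ z a :=
    (neg_le_neg (mul_le_mul_of_nonneg_right h3 (norm_nonneg _))).trans
      (neg_le_of_abs_le (abs_real_inner_le_norm _ _))
  have i3 : -(κ * (ρ - ρ') * (κ * (ρ + ρ'))) ≤ inner ℝ z (x + y) :=
    (neg_le_neg (mul_le_mul h3 hxy (norm_nonneg _) (by positivity))).trans
      (neg_le_of_abs_le (abs_real_inner_le_norm _ _))
  -- the increment of the squared norm is an inner product, dominated by its linear part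
  have key : (ρ - ρ') * (ρ + ρ') * (‖a‖ ^ 2 - 2 * κ * ‖a‖ - κ ^ 2) ≤ ‖F‖ ^ 2 - ‖F'‖ ^ 2 := by
    rw [hF, e1, e2, inner_add_left, inner_add_right, inner_add_right z, real_inner_smul_left,
      real_inner_smul_right, real_inner_smul_left, real_inner_smul_right,
      real_inner_self_eq_norm_sq]
    nlinarith [mul_le_mul_of_nonneg_left i1 hs.le, mul_le_mul_of_nonneg_left i2 ht.le]
  have hpos : 0 < ‖a‖ ^ 2 - 2 * κ * ‖a‖ - κ ^ 2 := by nlinarith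
  have : 0 < (ρ - ρ') * (ρ + ρ') * (‖a‖ ^ 2 - 2 * κ * ‖a‖ - κ ^ 2) := by positivity
  exact lt_of_pow_lt_pow_left₀ 2 (norm_nonneg _) (by linarith)

/-- The conclusion of the star lemma over a set `S` of base points: up to radius `δ`, the norm of
`h` grows strictly along rays issuing from the section `s`, at most linearly. -/
def StarOn (h : Circle × ℂ → ℂ) (s : Circle → ℂ) (δ C : ℝ) (S : Set Circle) : Prop :=
  ∀ w ∈ S, (∀ e : ℂ, ‖e‖ = 1 → StrictMonoOn (fun ρ : ℝ => ‖h (w, s w + ρ • e)‖) (Icc 0 δ)) ∧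
    ∀ u : ℂ, ‖u‖ ≤ δ → ‖h (w, s w + u)‖ ≤ C * ‖u‖

theorem StarOn.mono {h : Circle × ℂ → ℂ} {s : Circle → ℂ} {δ δ' C C' : ℝ} {S S' : Set Circle}
    (H : StarOn h s δ C S) (hδ : δ' ≤ δ) (hC : C ≤ C') (hS : S' ⊆ S) : StarOn h s δ' C' S' :=
  fun w hw => ⟨fun e he => ((H w (hS hw)).1 e he).mono (Icc_subset_Icc_right hδ),
    fun u hu => ((H w (hS hw)).2 u (hu.trans hδ)).trans (by gcongr)⟩

/-- The star lemma at one base point: near a zero with injective fibre derivative, `h` is so close to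
a linear isomorphism that its norm grows along rays. -/
theorem HasStrictFibreDerivAt.exists_starOn {h : Circle × ℂ → ℂ} {s : Circle → ℂ}
    {L : ℂ →L[ℝ] ℂ} {w₀ : Circle} (hs : Continuous s) (h0 : ∀ w, h (w, s w) = 0)
    (hL : Function.Injective L) (hd : HasStrictFibreDerivAt h L (w₀, s w₀)) :
    ∃ S ∈ 𝓝 w₀, ∃ δ C, 0 < δ ∧ 0 < C ∧ StarOn h s δ C S := by
  obtain ⟨m, hm, hLm⟩ := exists_norm_lower_bound hL
  have hcont : Filter.Tendsto (fun q : Circle × ℂ × ℂ => ((q.1, s q.1 + q.2.1), s q.1 + q.2.2))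
      (𝓝 (w₀, 0, 0)) (𝓝 ((w₀, s w₀), s w₀)) := by
    have : Continuous (fun q : Circle × ℂ × ℂ => ((q.1, s q.1 + q.2.1), s q.1 + q.2.2)) := by
      fun_prop
    simpa using this.tendsto (w₀, 0, 0)
  have h1 := hcont.eventually (hd (m / 4) (by positivity))
  rw [nhds_prod_eq, Filter.eventually_prod_iff] at h1
  obtain ⟨pa, hpa, pb, hpb, hab⟩ := h1
  obtain ⟨δ, hδ, hball⟩ := Metric.nhds_basis_closedBall.eventually_iff.1 hpb
  have key : ∀ w, pa w → ∀ u u' : ℂ, ‖u‖ ≤ δ → ‖u'‖ ≤ δ →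
      ‖h (w, s w + u) - h (w, s w + u') - L (u - u')‖ ≤ m / 4 * ‖u - u'‖ := by
    intro w hw u u' hu hu'
    have := hab hw (hball (x := (u, u')) (by
      rw [mem_closedBall, Prod.dist_eq]; simp [hu, hu']))
    simpa using this
  refine ⟨{w | pa w}, hpa, δ, m / 4 + ‖L‖, hδ, by positivity, fun w hw => ⟨?_, ?_⟩⟩
  · intro e he ρ' hρ' ρ hρ hlt
    have n1 : ∀ r ∈ Icc 0 δ, ‖r • e‖ ≤ δ := fun r hr => by
      rw [norm_smul, he, mul_one, Real.norm_eq_abs, abs_of_nonneg hr.1]; exact hr.2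
    have n2 : ∀ r : ℝ, 0 ≤ r → ‖r • e‖ = r := fun r hr => by
      rw [norm_smul, he, mul_one, Real.norm_eq_abs, abs_of_nonneg hr]
    refine norm_lt_norm_of_approx (a := L e) (κ := m / 4) hρ'.1 hlt (by positivity) ?_ ?_ ?_ ?_
    · have := hLm e; rw [he] at this; linarith
    · have := key w hw (ρ • e) 0 (n1 _ hρ) (by simpa using hδ.le)
      rw [add_zero, h0, sub_zero, sub_zero, n2 _ hρ.1, map_smul] at this
      exact this
    · have := key w hw (ρ' • e) 0 (n1 _ hρ') (by simpa using hδ.le)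
      rw [add_zero, h0, sub_zero, sub_zero, n2 _ hρ'.1, map_smul] at this
      exact this
    · have := key w hw (ρ • e) (ρ' • e) (n1 _ hρ) (n1 _ hρ')
      rwa [← sub_smul, n2 _ (by linarith), map_smul] at this
  · intro u hu
    have := key w hw u 0 hu (by simpa using hδ.le)
    rw [add_zero, h0, sub_zero, sub_zero] at this
    have h2 := norm_le_insert' (h (w, s w + u)) (L u)
    have h3 := L.le_opNorm u
    linarith

theorem exists_starOn_univ {h : Circle × ℂ → ℂ} {s : Circle → ℂ} (hs : Continuous s)
    (h0 : ∀ w, h (w, s w) = 0)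
    (hd : ∀ w, ∃ L : ℂ →L[ℝ] ℂ, Function.Injective L ∧ HasStrictFibreDerivAt h L (w, s w)) :
    ∃ δ C, 0 < δ ∧ 0 < C ∧ StarOn h s δ C univ := by
  refine isCompact_univ.induction_on (p := fun S => ∃ δ C, 0 < δ ∧ 0 < C ∧ StarOn h s δ C S)
    ?_ ?_ ?_ ?_
  · exact ⟨1, 1, one_pos, one_pos, fun w hw => absurd hw (notMem_empty w)⟩
  · rintro S S' hS ⟨δ, C, hδ, hC, H⟩
    exact ⟨δ, C, hδ, hC, H.mono le_rfl le_rfl hS⟩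
  · rintro S S' ⟨δ, C, hδ, hC, H⟩ ⟨δ', C', hδ', hC', H'⟩
    refine ⟨min δ δ', max C C', lt_min hδ hδ', lt_max_of_lt_left hC, ?_⟩
    rintro w (hw | hw)
    · exact H.mono (min_le_left _ _) (le_max_left _ _) subset_rfl w hw
    · exact H'.mono (min_le_right _ _) (le_max_right _ _) subset_rfl w hw
  · intro w _
    obtain ⟨L, hL, hd⟩ := hd w
    obtain ⟨S, hS, H⟩ := hd.exists_starOn hs h0 hL
    exact ⟨S, mem_nhdsWithin_of_mem_nhds hS, H⟩

/-- Radial straightening: a function that vanishes on the zero section and increases strictly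
along rays up to radius `δ` becomes, near the zero section, a multiple of the fibre radius after
a supported homeomorphism. -/
theorem exists_radial_straightening {N : Circle × ℂ → ℝ} {δ C : ℝ} (hδ : 0 < δ) (hC : 0 < C)
    (hc : ContinuousOn N {p | ‖p.2‖ ≤ δ}) (h0 : ∀ w, N (w, 0) = 0)
    (hmono : ∀ w (e : ℂ), ‖e‖ = 1 → StrictMonoOn (fun ρ : ℝ => N (w, ρ • e)) (Icc 0 δ))
    (hN : ∀ p : Circle × ℂ, ‖p.2‖ ≤ δ → N p ≤ C * ‖p.2‖) :
    ∃ c₀ > 0, c₀ < δ ∧ ∃ Φ, IsSupportedHomeo Φ δ ∧ ∀ c < c₀, ∀ p,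
      (‖(Φ p).2‖ < c ↔ ‖p.2‖ ≤ δ ∧ N p < C * c) ∧ (‖(Φ p).2‖ ≤ c ↔ ‖p.2‖ ≤ δ ∧ N p ≤ C * c) := by
  set χ : ℝ → ℝ := fun ρ => max 0 (min 1 ((2 * ρ - δ) / δ)) with hχ
  have hχc : Continuous χ := by simp only [hχ]; fun_prop
  have hχ0 : ∀ ρ, 0 ≤ χ ρ := fun ρ => le_max_left _ _
  have hχ1 : ∀ ρ, χ ρ ≤ 1 := fun ρ => max_le zero_le_one (min_le_left _ _)
  have hχm : Monotone χ := fun x y hxy => by simp only [hχ]; gcongr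
  have hχhalf : ∀ ρ, ρ ≤ δ / 2 → χ ρ = 0 := fun ρ hρ => by
    apply max_eq_left
    exact min_le_of_right_le (div_nonpos_of_nonpos_of_nonneg (by linarith) hδ.le)
  have hχδ : χ δ = 1 := by
    simp only [hχ]
    rw [show (2 * δ - δ) / δ = 1 by field_simp; ring]; simp
  -- the new radius: `N / C` near the zero section, cut off to the old radius beyond `δ`; since
  -- `N / C` is at most the radius, the interpolation stays strictly increasing along rays
  set M : Circle × ℂ → ℝ := fun p =>
    if ‖p.2‖ ≤ δ then (1 - χ ‖p.2‖) * (N p / C) + χ ‖p.2‖ * ‖p.2‖ else ‖p.2‖ with hM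
  have hMc : Continuous M := by
    refine continuous_if_le (by fun_prop) (by fun_prop) ?_ (by fun_prop) ?_
    · have h1 : ContinuousOn (fun p : Circle × ℂ => χ ‖p.2‖) {p | ‖p.2‖ ≤ δ} := by fun_prop
      exact ((continuousOn_const.sub h1).mul (hc.div_const C)).add (h1.mul (by fun_prop))
    · intro p hp
      rw [hp, hχδ]; ring
  have hM0 : ∀ w, M (w, 0) = 0 := fun w => by simp [hM, hδ.le, h0]
  have nrm : ∀ {e : ℂ} {ρ : ℝ}, ‖e‖ = 1 → 0 ≤ ρ → ‖ρ • e‖ = ρ := fun he hρ => by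
    rw [norm_smul, he, mul_one, Real.norm_eq_abs, abs_of_nonneg hρ]
  have hMm : ∀ w (e : ℂ), ‖e‖ = 1 → StrictMonoOn (fun ρ : ℝ => M (w, ρ • e)) (Ici 0) := by
    intro w e he a ha b hb hab
    simp only [hM, nrm he (mem_Ici.1 ha), nrm he (mem_Ici.1 hb)]
    rw [mem_Ici] at ha hb
    have hNle : ∀ r, 0 ≤ r → r ≤ δ → N (w, r • e) / C ≤ r := fun r hr hr' => by
      have := hN (w, r • e) (by rw [nrm he hr]; exact hr')
      rw [nrm he hr] at this
      rw [div_le_iff₀ hC]; linarith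
    by_cases hbδ : b ≤ δ
    · rw [if_pos (by linarith), if_pos hbδ]
      have k1 : N (w, a • e) / C < N (w, b • e) / C :=
        div_lt_div_of_pos_right (hmono w e he ⟨ha, by linarith⟩ ⟨hb, hbδ⟩ hab) hC
      have k2 := hNle a ha (by linarith)
      have k3 := hχm hab.le
      have e1 : (1 - χ b) * (N (w, b • e) / C) + χ b * b -
          ((1 - χ a) * (N (w, a • e) / C) + χ a * a) =
          (1 - χ b) * (N (w, b • e) / C - N (w, a • e) / C) + χ b * (b - a) +
          (χ b - χ a) * (a - N (w, a • e) / C) := by ring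
      have k4 : 0 ≤ (χ b - χ a) * (a - N (w, a • e) / C) :=
        mul_nonneg (by linarith) (by linarith)
      have k5 : 0 < (1 - χ b) * (N (w, b • e) / C - N (w, a • e) / C) + χ b * (b - a) := by
        rcases (hχ0 b).eq_or_lt with h | h
        · rw [← h]; simpa using k1
        · exact add_pos_of_nonneg_of_pos (mul_nonneg (by linarith [hχ1 b]) (by linarith))
            (mul_pos h (by linarith))
      linarith
    · rw [if_neg hbδ]
      split_ifs with haδ
      · have k2 := hNle a ha haδ
        have := mul_le_mul_of_nonneg_left k2 (sub_nonneg.2 (hχ1 a))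
        linarith
      · exact hab
  have hML : ∀ p : Circle × ℂ, δ ≤ ‖p.2‖ → M p = ‖p.2‖ := by
    intro p hp
    rcases hp.lt_or_eq with h | h
    · simp only [hM]; rw [if_neg (by linarith)]
    · simp only [hM]; rw [if_pos h.symm.le, ← h, hχδ]; ring
  have hnorm := norm_rayMap hM0 hMm
  have hMN : ∀ p : Circle × ℂ, ‖p.2‖ ≤ δ / 2 → M p = N p / C := fun p hp => by
    simp only [hM]; rw [if_pos (by linarith), hχhalf _ hp]; ring
  -- `c₀` is the minimum of `M` on the sphere bundle of radius `δ / 2`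
  obtain ⟨p₀, hp₀, hmin⟩ := (isCompact_univ.prod (isCompact_sphere (0 : ℂ) (δ / 2))).exists_isMinOn
    ⟨((1 : Circle), ((δ / 2 : ℝ) : ℂ)), by simp [abs_of_pos hδ]⟩ hMc.continuousOn
  have hp₀' : ‖p₀.2‖ = δ / 2 := by simpa using hp₀.2
  have hc₀ : 0 < M p₀ := ray_pos hM0 hMm (by rw [← norm_pos_iff, hp₀']; linarith)
  have hlow : ∀ p : Circle × ℂ, δ / 2 ≤ ‖p.2‖ → ‖p.2‖ ≤ δ → M p₀ ≤ M p ∧ C * M p₀ ≤ N p := by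
    rintro ⟨w, v⟩ h1 h2
    obtain ⟨e, he, hv⟩ := exists_eq_smul_unit v
    simp only at h1 h2
    have h3 : M p₀ ≤ M (w, (δ / 2) • e) := hmin ⟨mem_univ _, by
      simp [nrm he (show 0 ≤ δ / 2 by linarith), -Complex.real_smul]⟩
    constructor
    · refine h3.trans ?_
      rw [hv]
      exact (hMm w e he).monotoneOn (mem_Ici.2 (by linarith)) (mem_Ici.2 (norm_nonneg v)) h1
    · have hhalf : ‖(δ / 2) • e‖ = δ / 2 := nrm he (by linarith)
      rw [hMN (w, (δ / 2) • e) hhalf.le, le_div_iff₀ hC, mul_comm] at h3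
      refine h3.trans ?_
      rw [hv]
      exact (hmono w e he).monotoneOn ⟨by linarith, by linarith⟩ ⟨norm_nonneg _, h2⟩ h1
  refine ⟨M p₀, hc₀, ?_, rayMap M, isSupportedHomeo_rayMap hM0 hMm hMc hML, fun c hcc p => ?_⟩
  · have := hN p₀ (by rw [hp₀']; linarith)
    rw [hMN p₀ hp₀'.le, div_lt_iff₀ hC]
    rw [hp₀'] at this
    nlinarith
  rw [hnorm]
  by_cases h1 : ‖p.2‖ ≤ δ / 2
  · rw [hMN p h1, div_lt_iff₀ hC, div_le_iff₀ hC, mul_comm c]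
    have : ‖p.2‖ ≤ δ := by linarith
    simp [this]
  · push Not at h1
    by_cases h2 : ‖p.2‖ ≤ δ
    · obtain ⟨h3, h4⟩ := hlow p h1.le h2
      have h5 : C * c < C * M p₀ := mul_lt_mul_of_pos_left hcc hC
      exact ⟨⟨fun h => by linarith, fun h => by linarith⟩, ⟨fun h => by linarith, fun h => by linarith⟩⟩
    · have h6 : M p₀ < δ := by
        have := hN p₀ (by rw [hp₀']; linarith)
        rw [hMN p₀ hp₀'.le, div_lt_iff₀ hC]
        rw [hp₀'] at this
        nlinarith
      rw [hML p (by linarith)]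
      exact ⟨⟨fun h => by linarith, fun h => absurd h.1 h2⟩,
        ⟨fun h => by linarith, fun h => absurd h.1 h2⟩⟩

/-! ### Straightening a tube around a graph -/

/-- `E : S¹ × ℂ → S³` is a smooth local diffeomorphism at `p`. -/
abbrev LocDiff (E : Circle × ℂ → S3) (p : Circle × ℂ) : Prop :=
  IsLocalDiffeomorphAt ((𝓡 1).prod 𝓘(ℝ, ℂ)) (𝓡 3) ∞ E p

theorem contMDiff_coe_circle {m : WithTop ℕ∞} :
    ContMDiff (𝓡 1) 𝓘(ℝ, ℂ) m (fun z : Circle => (z : ℂ)) :=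
  contMDiff_coe_sphere (E := ℂ) (n := 1)

theorem contDiffAt_arg {z : ℂ} (hz : z ∈ Complex.slitPlane) {m : WithTop ℕ∞} :
    ContDiffAt ℝ m Complex.arg z := by
  have h1 : ContDiffAt ℝ m Complex.log z := (Complex.contDiffAt_log hz).restrict_scalars ℝ
  have h2 : Complex.arg = fun z => Complex.imCLM (Complex.log z) := by
    ext z; simp [Complex.log_im]
  rw [h2]
  exact Complex.imCLM.contDiff.contDiffAt.comp z h1

/-- A section of `Circle.exp` through `t₀`, smooth near `exp t₀`. -/
def circleLift (t₀ : ℝ) (w : Circle) : ℝ := t₀ + Complex.arg ((w / Circle.exp t₀ : Circle) : ℂ)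

theorem exp_circleLift (t₀ : ℝ) (w : Circle) : Circle.exp (circleLift t₀ w) = w := by
  rw [circleLift, Circle.exp_add, Circle.exp_arg, mul_div_cancel]

theorem circleLift_exp (t₀ : ℝ) : circleLift t₀ (Circle.exp t₀) = t₀ := by
  simp [circleLift]

theorem contMDiffAt_circleLift (t₀ : ℝ) :
    ContMDiffAt (𝓡 1) 𝓘(ℝ, ℝ) ∞ (circleLift t₀) (Circle.exp t₀) := by
  have h1 : ContMDiff (𝓡 1) 𝓘(ℝ, ℂ) ∞ (fun w : Circle => ((w / Circle.exp t₀ : Circle) : ℂ)) :=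
    contMDiff_coe_circle.comp (contMDiff_id.div contMDiff_const)
  have h2 : ContDiffAt ℝ ∞ (fun z : ℂ => t₀ + Complex.arg z)
      ((Circle.exp t₀ / Circle.exp t₀ : Circle) : ℂ) :=
    contDiffAt_const.add (contDiffAt_arg (by simp))
  exact ContMDiffAt.comp (I' := 𝓘(ℝ, ℂ)) (g := fun z : ℂ => t₀ + Complex.arg z)
    (f := fun w : Circle => ((w / Circle.exp t₀ : Circle) : ℂ)) (Circle.exp t₀)
    h2.contMDiffAt h1.contMDiffAt

/-- Linear algebra behind transversality: a submersion `f : ℝ × ℂ → ℂ` that vanishes along a curve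
with nonzero velocity in the `ℝ`-direction has invertible derivative along `ℂ`. -/
theorem injective_comp_inr {f : ℝ × ℂ → ℂ} {f' : ℝ × ℂ →L[ℝ] ℂ} {p₀ : ℝ × ℂ}
    {r : ℂ → ℝ × ℂ} {y₀ : ℂ} {c : ℝ → ℝ × ℂ} {c' : ℝ × ℂ}
    (hf : HasFDerivAt f f' p₀) (hr : DifferentiableAt ℝ r y₀) (hr0 : r y₀ = p₀)
    (hfr : ∀ᶠ y in 𝓝 y₀, f (r y) = y) (hc : HasDerivAt c c' 0) (hc0 : c 0 = p₀)
    (hfc : ∀ᶠ t in 𝓝 0, f (c t) = 0) (hc' : c'.1 ≠ 0) :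
    Function.Injective (f'.comp (ContinuousLinearMap.inr ℝ ℝ ℂ)) := by
  subst hr0
  have h1 : f'.comp (fderiv ℝ r y₀) = ContinuousLinearMap.id ℝ ℂ := by
    have := hf.comp y₀ hr.hasFDerivAt
    exact this.unique ((hasFDerivAt_id y₀).congr_of_eventuallyEq hfr)
  have h2 : f' c' = 0 := by
    rw [← hc0] at hf
    exact (hf.comp_hasDerivAt 0 hc).unique
      ((hasDerivAt_const (0 : ℝ) (0 : ℂ)).congr_of_eventuallyEq hfc)
  have hsurj : Function.Surjective f'.toLinearMap := fun y =>
    ⟨fderiv ℝ r y₀ y, by simpa using congrArg (fun A : ℂ →L[ℝ] ℂ => A y) h1⟩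
  have h3 := LinearMap.finrank_range_add_finrank_ker f'.toLinearMap
  rw [LinearMap.range_eq_top.2 hsurj, finrank_top, Module.finrank_prod,
    Complex.finrank_real_complex, Module.finrank_self] at h3
  have h4 : Module.finrank ℝ (LinearMap.ker f'.toLinearMap) = 1 := by omega
  rw [injective_iff_map_eq_zero]
  intro u hu
  have hc'0 : (⟨c', h2⟩ : LinearMap.ker f'.toLinearMap) ≠ 0 := fun h =>
    hc' (by rw [show c' = 0 from congrArg Subtype.val h]; rfl)
  obtain ⟨a, ha⟩ := (finrank_eq_one_iff_of_nonzero' _ hc'0).1 h4 ⟨(0, u), by simpa using hu⟩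
  have ha' : a • c' = (0, u) := congrArg Subtype.val ha
  have ha0 : a * c'.1 = 0 := congrArg Prod.fst ha'
  rcases mul_eq_zero.1 ha0 with h | h
  · rw [h, zero_smul] at ha'
    exact (congrArg Prod.snd ha').symm
  · exact absurd h hc'

namespace Tube

variable (T : Tube)

/-- The core circle of a tube. -/
def core : Set S3 := T.toFun '' (univ ×ˢ {0})

/-- The coordinates in `S¹ × ℂ` of a point of the tube (junk off the tube). -/
def inv : S3 → Circle × ℂ :=
  haveI : Nonempty (Circle × ℂ) := ⟨(1, 0)⟩
  Function.invFun T.toFun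

theorem inv_apply (p : Circle × ℂ) : T.inv (T.toFun p) = p :=
  Function.leftInverse_invFun T.injective p

theorem apply_inv {y : S3} (hy : y ∈ range T.toFun) : T.toFun (T.inv y) = y := by
  obtain ⟨p, rfl⟩ := hy
  rw [inv_apply]

theorem isLocalDiffeomorphAt_inv (p : Circle × ℂ) :
    IsLocalDiffeomorphAt (𝓡 3) ((𝓡 1).prod 𝓘(ℝ, ℂ)) ∞ T.inv (T.toFun p) := by
  have h := T.isLocalDiffeomorph p
  refine ⟨h.localInverse, h.localInverse_mem_source, fun y hy => ?_⟩
  conv_lhs => rw [← h.localInverse_right_inv hy]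
  exact T.inv_apply _

end Tube

/-- The curve `E⁻¹(core n)` crosses the fibre of `S¹ × ℂ → S¹` transversally at `(w, v)`: it
contains a curve through `(w, v)` whose angular velocity is nonzero. -/
def CrossesFibre (E : Circle × ℂ → S3) (n : Tube) (w : Circle) (v : ℂ) : Prop :=
  ∃ (φ : ℝ → ℝ) (β : ℝ → ℂ) (φ' : ℝ) (β' : ℂ), HasDerivAt φ φ' 0 ∧ HasDerivAt β β' 0 ∧ φ' ≠ 0 ∧
    Circle.exp (φ 0) = w ∧ β 0 = v ∧ ∀ᶠ t in 𝓝 0, E (Circle.exp (φ t), β t) ∈ n.core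

/-- The fibre coordinate of `n`, read in the coordinates `E`, is a submersion that vanishes on the
core; where the core crosses a fibre of `E`, its derivative along that fibre is invertible. -/
theorem CrossesFibre.exists_hasStrictFibreDerivAt {E : Circle × ℂ → S3} {n : Tube} {w : Circle}
    {v : ℂ} (h : CrossesFibre E n w v) (hE : LocDiff E (w, v)) :
    ∃ L : ℂ →L[ℝ] ℂ, Function.Injective L ∧
      HasStrictFibreDerivAt (fun q => (n.inv (E q)).2) L (w, v) := by
  obtain ⟨φ, β, φ', β', hφ, hβ, hφ', rfl, rfl, hcore⟩ := h
  obtain ⟨⟨z₀, y₀⟩, ⟨-, hy₀⟩, hz₀⟩ := hcore.self_of_nhds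
  obtain rfl : y₀ = 0 := hy₀
  set P : ℝ × ℂ → Circle × ℂ := fun q => (Circle.exp q.1, q.2) with hP
  have hPs : ContMDiff 𝓘(ℝ, ℝ × ℂ) ((𝓡 1).prod 𝓘(ℝ, ℂ)) ∞ P :=
    (contMDiff_circleExp.comp contDiff_fst.contMDiff).prodMk contDiff_snd.contMDiff
  set f : ℝ × ℂ → ℂ := fun q => (n.inv (E (P q))).2 with hf
  have hn := n.isLocalDiffeomorphAt_inv (z₀, 0)
  have hfs : ContDiffAt ℝ ∞ f (φ 0, β 0) := by
    rw [← contMDiffAt_iff_contDiffAt]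
    have h1 : ContMDiffAt (𝓡 3) ((𝓡 1).prod 𝓘(ℝ, ℂ)) ∞ n.inv (E (P (φ 0, β 0))) := by
      have := hn.contMDiffAt
      rwa [hz₀] at this
    have h2 : ContMDiffAt ((𝓡 1).prod 𝓘(ℝ, ℂ)) (𝓡 3) ∞ E (P (φ 0, β 0)) := hE.contMDiffAt
    have h3 : ContMDiffAt 𝓘(ℝ, ℝ × ℂ) (𝓡 3) ∞ (E ∘ P) (φ 0, β 0) := h2.comp _ hPs.contMDiffAt
    have h4 : ContMDiffAt 𝓘(ℝ, ℝ × ℂ) ((𝓡 1).prod 𝓘(ℝ, ℂ)) ∞ (n.inv ∘ (E ∘ P)) (φ 0, β 0) :=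
      ContMDiffAt.comp (φ 0, β 0) h1 h3
    exact contMDiffAt_snd.comp (φ 0, β 0) h4
  have hfd := hfs.hasStrictFDerivAt (by simp)
  set f' := fderiv ℝ f (φ 0, β 0)
  -- a right inverse of `f`, through the local inverse of `E`
  set r : ℂ → ℝ × ℂ := fun y =>
    (circleLift (φ 0) (hE.localInverse (n.toFun (z₀, y))).1, (hE.localInverse (n.toFun (z₀, y))).2)
    with hr
  have hEinv : hE.localInverse (E (Circle.exp (φ 0), β 0)) = (Circle.exp (φ 0), β 0) :=
    hE.localInverse_left_inv hE.localInverse_mem_target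
  have hrs : ContDiffAt ℝ ∞ r 0 := by
    have h1 : ContMDiffAt 𝓘(ℝ, ℂ) ((𝓡 1).prod 𝓘(ℝ, ℂ)) ∞ (fun y : ℂ => (z₀, y)) 0 :=
      contMDiffAt_const.prodMk contMDiffAt_id
    have h2 : ContMDiffAt 𝓘(ℝ, ℂ) ((𝓡 1).prod 𝓘(ℝ, ℂ)) ∞
        (fun y : ℂ => hE.localInverse (n.toFun (z₀, y))) 0 := by
      have h3 := hE.localInverse_contMDiffAt
      rw [← hz₀] at h3
      exact h3.comp (0 : ℂ) (((n.isLocalDiffeomorph (z₀, 0)).contMDiffAt).comp (0 : ℂ) h1)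
    have h4 : ContMDiffAt 𝓘(ℝ, ℂ) 𝓘(ℝ, ℝ) ∞
        (fun y : ℂ => circleLift (φ 0) (hE.localInverse (n.toFun (z₀, y))).1) 0 := by
      refine ContMDiffAt.comp (I' := 𝓡 1) (g := circleLift (φ 0))
        (f := fun y : ℂ => (hE.localInverse (n.toFun (z₀, y))).1) (0 : ℂ) ?_
        (contMDiffAt_fst.comp (0 : ℂ) h2)
      have h5 := contMDiffAt_circleLift (φ 0)
      rw [hz₀, hEinv]
      exact h5
    exact (contMDiffAt_iff_contDiffAt.1 h4).prodMk
      (contMDiffAt_iff_contDiffAt.1 (contMDiffAt_snd.comp (0 : ℂ) h2))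
  have hPr : ∀ y, P (r y) = hE.localInverse (n.toFun (z₀, y)) := fun y => by
    simp only [hP, hr, exp_circleLift]
  have hfr : ∀ᶠ y in 𝓝 (0 : ℂ), f (r y) = y := by
    have h1 : Filter.Tendsto (fun y : ℂ => n.toFun (z₀, y)) (𝓝 0)
        (𝓝 (E (Circle.exp (φ 0), β 0))) := by
      rw [← hz₀]
      exact (n.continuous.comp (by fun_prop : Continuous fun y : ℂ => (z₀, y))).tendsto 0
    filter_upwards [h1.eventually (hE.localInverse_open_source.mem_nhds
      hE.localInverse_mem_source)] with y hy
    simp only [hf, hPr]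
    rw [hE.localInverse_right_inv hy, n.inv_apply]
  refine ⟨f'.comp (ContinuousLinearMap.inr ℝ ℝ ℂ),
    injective_comp_inr hfd.hasFDerivAt (hrs.differentiableAt (by simp)) ?_ hfr
      (hφ.prodMk hβ) rfl ?_ hφ', ?_⟩
  · simp only [hr, hz₀, hEinv, circleLift_exp]
  · filter_upwards [hcore] with t ht
    obtain ⟨⟨z, y⟩, ⟨-, hy⟩, hzy⟩ := ht
    simp only [hf, hP, ← hzy, n.inv_apply]
    exact hy
  · intro κ hκ
    have h1 := hfd.isLittleO.def hκ
    have h2 : Filter.Tendsto (fun q : (Circle × ℂ) × ℂ =>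
        ((circleLift (φ 0) q.1.1, q.1.2), (circleLift (φ 0) q.1.1, q.2)))
        (𝓝 ((Circle.exp (φ 0), β 0), β 0)) (𝓝 ((φ 0, β 0), (φ 0, β 0))) := by
      have h3 : ContinuousAt (fun q : (Circle × ℂ) × ℂ => circleLift (φ 0) q.1.1)
          ((Circle.exp (φ 0), β 0), β 0) :=
        ContinuousAt.comp (g := circleLift (φ 0)) (f := fun q : (Circle × ℂ) × ℂ => q.1.1)
          (contMDiffAt_circleLift (φ 0)).continuousAt (continuous_fst.comp continuous_fst).continuousAt
      have h4 : ContinuousAt (fun q : (Circle × ℂ) × ℂ =>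
        ((circleLift (φ 0) q.1.1, q.1.2), (circleLift (φ 0) q.1.1, q.2)))
        ((Circle.exp (φ 0), β 0), β 0) :=
        (h3.prodMk (by fun_prop)).prodMk (h3.prodMk (by fun_prop))
      have h5 := h4.tendsto
      simp only [circleLift_exp] at h5
      exact h5
    filter_upwards [h2.eventually h1] with q hq
    simpa [hf, hP, exp_circleLift] using hq

theorem exists_ball_of_isOpen {U : Set (Circle × ℂ)} (hU : IsOpen U) (h0 : ∀ w, (w, 0) ∈ U) :
    ∃ r > 0, ∀ p : Circle × ℂ, ‖p.2‖ < r → p ∈ U := by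
  obtain ⟨A, B, hA, hB, hA', hB', hAB⟩ := generalized_tube_lemma (isCompact_univ (X := Circle))
    (isCompact_singleton (x := (0 : ℂ))) hU (by rintro ⟨w, v⟩ ⟨-, rfl⟩; exact h0 w)
  obtain ⟨r, hr, hball⟩ := Metric.isOpen_iff.1 hB 0 (hB' rfl)
  exact ⟨r, hr, fun p hp => hAB ⟨hA' (mem_univ _), hball (by simpa using hp)⟩⟩

theorem isOpen_image_of_locDiff {E : Circle × ℂ → S3} {O : Set (Circle × ℂ)} (hO : IsOpen O)
    (hE : ∀ p ∈ O, LocDiff E p) : IsOpen (E '' O) := by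
  have h1 : IsLocalHomeomorphOn E O :=
    IsLocalDiffeomorphOn.isLocalHomeomorphOn (fun p => hE p p.2)
  rw [isOpen_iff_mem_nhds]
  rintro _ ⟨p, hp, rfl⟩
  rw [← h1.map_nhds_eq hp]
  exact Filter.image_mem_map (hO.mem_nhds hp)

/-- Straightening a tube in the coordinates `E`: if the core of `n` is the graph of a section `s`
in these coordinates, then a thin tube about the core is carried to the unit disc bundle by a
supported homeomorphism. -/
theorem exists_straightening {E : Circle × ℂ → S3} {O : Set (Circle × ℂ)} (hO : IsOpen O)
    (hE : ∀ p ∈ O, LocDiff E p) (hinj : InjOn E O) {n : Tube} {s : Circle → ℂ}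
    (hs : Continuous s) (hsO : ∀ w, (w, s w) ∈ O) (hcore : ∀ w, E (w, s w) ∈ n.core)
    (hcore' : n.core ⊆ range fun w => E (w, s w)) (hT : ∀ w, CrossesFibre E n w (s w)) :
    ∃ η, 0 < η ∧ η < 1 ∧ ∃ Φ L, IsSupportedHomeo Φ L ∧
      (∀ p, ‖(Φ p).2‖ < 1 ↔ p ∈ O ∧ E p ∈ n.toFun '' (univ ×ˢ ball 0 η)) ∧
      (∀ p, ‖(Φ p).2‖ ≤ 1 ↔ p ∈ O ∧ E p ∈ n.toFun '' (univ ×ˢ closedBall 0 η)) ∧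
      n.toFun '' (univ ×ˢ closedBall 0 η) ⊆ E '' O := by
  have hEc : ContinuousOn E O := fun p hp =>
    (hE p hp).contMDiffAt.continuousAt.continuousWithinAt
  set h : Circle × ℂ → ℂ := fun q => (n.inv (E q)).2 with hh
  have h0 : ∀ w, h (w, s w) = 0 := by
    intro w
    obtain ⟨⟨z, y⟩, ⟨-, hy⟩, hzy⟩ := hcore w
    simp only [hh, ← hzy, n.inv_apply]
    exact hy
  obtain ⟨δ₁, C, hδ₁, hC, hstar⟩ := exists_starOn_univ hs h0 fun w =>
    (hT w).exists_hasStrictFibreDerivAt (hE _ (hsO w))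
  set O' : Set (Circle × ℂ) := O ∩ E ⁻¹' range n.toFun with hO'
  have hO'o : IsOpen O' := hEc.isOpen_inter_preimage hO n.isLocalDiffeomorph.isOpen_range
  have hhc : ContinuousOn h O' := by
    intro p hp
    obtain ⟨q, hq⟩ := hp.2
    have h1 := (n.isLocalDiffeomorphAt_inv q).contMDiffAt.continuousAt
    rw [hq] at h1
    exact (continuousAt_snd.comp
      (h1.comp (hE p hp.1).contMDiffAt.continuousAt)).continuousWithinAt
  have hτ : Continuous fun p : Circle × ℂ => (p.1, s p.1 + p.2) := by fun_prop
  obtain ⟨δ₂, hδ₂, hsub⟩ := exists_ball_of_isOpen (hO'o.preimage hτ) (fun w => by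
    refine ⟨by simpa using hsO w, ?_⟩
    obtain ⟨q, -, hq⟩ := hcore w
    exact ⟨q, by simpa using hq⟩)
  set δ := min (min δ₁ (δ₂ / 2)) 1 with hδdef
  have hδ : 0 < δ := by positivity
  have hδ1 : δ ≤ 1 := min_le_right _ _
  have hδδ₁ : δ ≤ δ₁ := (min_le_left _ _).trans (min_le_left _ _)
  have hδδ₂ : δ < δ₂ := ((min_le_left _ _).trans (min_le_right _ _)).trans_lt (by linarith)
  have hstar' := hstar.mono hδδ₁ le_rfl (subset_univ univ)
  set N : Circle × ℂ → ℝ := fun p => ‖h (p.1, s p.1 + p.2)‖ with hN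
  obtain ⟨c₀, hc₀, hc₀δ, Φ₁, hΦ₁, hΦ₁c⟩ := exists_radial_straightening (N := N) hδ hC
    ((hhc.comp hτ.continuousOn fun p (hp : ‖p.2‖ ≤ δ) => hsub p (hp.trans_lt hδδ₂)).norm)
    (fun w => by simp [hN, h0]) (fun w e he => (hstar' w (mem_univ w)).1 e he)
    (fun p hp => (hstar' p.1 (mem_univ _)).2 p.2 hp)
  obtain ⟨Φ₀, L₀, hL₀, hΦ₀, hΦ₀s⟩ := exists_translation hs
  -- the image of the `δ`-neighbourhood of the graph contains a tube about the core
  set W : Set (Circle × ℂ) := (fun p : Circle × ℂ => (p.1, s p.1 + p.2)) '' {p | ‖p.2‖ < δ} with hW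
  have hWmem : ∀ p, p ∈ W ↔ ‖p.2 - s p.1‖ < δ := by
    intro p
    constructor
    · rintro ⟨q, hq, rfl⟩; simpa using hq
    · intro hp; exact ⟨(p.1, p.2 - s p.1), hp, by simp⟩
  have hWo : IsOpen W := by
    have : W = {p : Circle × ℂ | ‖p.2 - s p.1‖ < δ} := by ext p; exact hWmem p
    rw [this]
    exact isOpen_lt (by fun_prop) continuous_const
  have hWO : W ⊆ O' := by
    rintro _ ⟨q, hq, rfl⟩
    exact hsub q (lt_trans hq hδδ₂)
  have hEWo : IsOpen (E '' W) := isOpen_image_of_locDiff hWo fun p hp => hE p (hWO hp).1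
  obtain ⟨r, hr, hrsub⟩ := exists_ball_of_isOpen (hEWo.preimage n.continuous) (fun z => by
    obtain ⟨w, hw⟩ := hcore' ⟨(z, 0), ⟨mem_univ _, rfl⟩, rfl⟩
    exact ⟨(w, s w), (hWmem _).2 (by simpa using hδ), hw⟩)
  set c := min c₀ (min (r / C) (1 / C)) / 2 with hc
  have hcpos : 0 < c := by positivity
  have hcm : c < min c₀ (min (r / C) (1 / C)) := half_lt_self (by positivity)
  have hcc₀ : c < c₀ := hcm.trans_le (min_le_left _ _)
  have hcr : C * c < r := by
    have := hcm.trans_le ((min_le_right _ _).trans (min_le_left _ _))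
    rwa [lt_div_iff₀ hC, mul_comm] at this
  have hc1 : C * c < 1 := by
    have := hcm.trans_le ((min_le_right _ _).trans (min_le_right _ _))
    rwa [lt_div_iff₀ hC, mul_comm] at this
  obtain ⟨Φ₂, hΦ₂, -, hΦ₂c⟩ := exists_radial_scaling (a := c) (b := 1) (L := 2) hcpos one_pos
    (by linarith) (by norm_num)
  have hη : 0 < C * c := by positivity
  set L := max (max δ L₀) 2
  refine ⟨C * c, hη, hc1, Φ₂ ∘ Φ₁ ∘ Φ₀, L,
    (hΦ₂.mono (le_max_right _ _)).comp ((hΦ₁.mono ((le_max_left _ _).trans (le_max_left _ _))).comp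
      (hΦ₀.mono ((le_max_right _ _).trans (le_max_left _ _)))), ?_⟩
  -- points of `S¹ × ℂ` where the tube is thin are exactly the points close to the graph
  have key : ∀ p, (‖(Φ₀ p).2‖ ≤ δ → p ∈ O' ∧ N (Φ₀ p) = ‖(n.inv (E p)).2‖) ∧
      (p ∈ O → ∀ q : Circle × ℂ, ‖q.2‖ < r → E p = n.toFun q →
        ‖(Φ₀ p).2‖ ≤ δ ∧ N (Φ₀ p) = ‖q.2‖) := by
    intro p
    have h1 : ‖(Φ₀ p).2‖ ≤ δ → p ∈ O' ∧ N (Φ₀ p) = ‖(n.inv (E p)).2‖ := by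
      intro hp
      have h2 : p = ((Φ₀ p).1, s (Φ₀ p).1 + (Φ₀ p).2) :=
        hΦ₀.bijective.1 (hΦ₀s _ _ (hp.trans hδ1)).symm
      have h3 : p ∈ O' := by
        rw [h2]; exact hsub (Φ₀ p) (hp.trans_lt hδδ₂)
      refine ⟨h3, ?_⟩
      simp only [hN, hh]
      rw [← h2]
    refine ⟨h1, fun hpO q hq hEq => ?_⟩
    obtain ⟨p', hp', hEp'⟩ := hrsub q hq
    have h4 : p' = p := hinj (hWO hp').1 hpO (hEp'.trans hEq.symm)
    subst h4
    have h5 := (hWmem p').1 hp'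
    have h6 : Φ₀ p' = (p'.1, p'.2 - s p'.1) := by
      rw [← hΦ₀s p'.1 (p'.2 - s p'.1) (h5.le.trans hδ1)]; simp
    have h7 : ‖(Φ₀ p').2‖ ≤ δ := by rw [h6]; exact h5.le
    exact ⟨h7, by rw [(h1 h7).2, hEq, n.inv_apply]⟩
  refine ⟨fun p => ?_, fun p => ?_, ?_⟩
  · simp only [Function.comp_apply]
    rw [(hΦ₂c _).1, (hΦ₁c c hcc₀ _).1]
    constructor
    · rintro ⟨h1, h2⟩
      obtain ⟨h3, h4⟩ := (key p).1 h1
      exact ⟨h3.1, n.inv (E p), ⟨mem_univ _, by simpa [← h4] using h2⟩, n.apply_inv h3.2⟩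
    · rintro ⟨h1, q, ⟨-, hq⟩, hqE⟩
      rw [mem_ball_zero_iff] at hq
      obtain ⟨h3, h4⟩ := (key p).2 h1 q (hq.trans hcr) hqE.symm
      exact ⟨h3, by rwa [h4]⟩
  · simp only [Function.comp_apply]
    rw [(hΦ₂c _).2, (hΦ₁c c hcc₀ _).2]
    constructor
    · rintro ⟨h1, h2⟩
      obtain ⟨h3, h4⟩ := (key p).1 h1
      exact ⟨h3.1, n.inv (E p), ⟨mem_univ _, by simpa [← h4] using h2⟩, n.apply_inv h3.2⟩
    · rintro ⟨h1, q, ⟨-, hq⟩, hqE⟩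
      rw [mem_closedBall_zero_iff] at hq
      obtain ⟨h3, h4⟩ := (key p).2 h1 q (hq.trans_lt hcr) hqE.symm
      exact ⟨h3, by rwa [h4]⟩
  · rintro _ ⟨q, ⟨-, hq⟩, rfl⟩
    rw [mem_closedBall_zero_iff] at hq
    obtain ⟨p, hp, hpE⟩ := hrsub q (hq.trans_lt hcr)
    exact ⟨p, (hWO hp).1, hpE⟩

/-! ### Uniqueness of tubes and contraction of meridians -/

theorem locDiff_prodMk_id {e : OpenPartialHomeomorph ℂ ℂ} (h1 : ContDiffOn ℝ ∞ e e.source)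
    (h2 : ContDiffOn ℝ ∞ e.symm e.target) {p : Circle × ℂ} (hp : p.2 ∈ e.source) :
    IsLocalDiffeomorphAt ((𝓡 1).prod 𝓘(ℝ, ℂ)) ((𝓡 1).prod 𝓘(ℝ, ℂ)) ∞
      (fun q : Circle × ℂ => (q.1, e q.2)) p := by
  refine ⟨⟨((OpenPartialHomeomorph.refl Circle).prod e).toPartialEquiv,
    ((OpenPartialHomeomorph.refl Circle).prod e).open_source,
    ((OpenPartialHomeomorph.refl Circle).prod e).open_target, ?_, ?_⟩, ⟨mem_univ _, hp⟩,
    fun q _ => rfl⟩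
  · exact contMDiffOn_fst.prodMk
      (h1.contMDiffOn.comp contMDiffOn_snd fun q hq => hq.2)
  · exact contMDiffOn_fst.prodMk
      (h2.contMDiffOn.comp contMDiffOn_snd fun q hq => hq.2)

theorem locDiff_smul {a : ℝ} (ha : a ≠ 0) (p : Circle × ℂ) :
    IsLocalDiffeomorphAt ((𝓡 1).prod 𝓘(ℝ, ℂ)) ((𝓡 1).prod 𝓘(ℝ, ℂ)) ∞
      (fun q : Circle × ℂ => (q.1, a • q.2)) p := by
  have h : ∀ c : ℝ, ContDiff ℝ ∞ fun v : ℂ => c • v := fun c => by fun_prop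
  exact locDiff_prodMk_id (e := (Homeomorph.smulOfNeZero a ha).toOpenPartialHomeomorph)
    (h a).contDiffOn (h a⁻¹).contDiffOn (mem_univ _)

theorem exists_ball_of_isOpen_of_closedBall {U : Set (Circle × ℂ)} (hU : IsOpen U)
    (h0 : ∀ p : Circle × ℂ, ‖p.2‖ ≤ 1 → p ∈ U) :
    ∃ L > 1, ∀ p : Circle × ℂ, ‖p.2‖ < L → p ∈ U := by
  obtain ⟨A, B, hA, hB, hA', hB', hAB⟩ := generalized_tube_lemma (isCompact_univ (X := Circle))
    (isCompact_closedBall (0 : ℂ) 1) hU (fun p hp => h0 p (by simpa using hp.2))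
  obtain ⟨r, hr, hball⟩ := (isCompact_closedBall (0 : ℂ) 1).exists_thickening_subset_open hB hB'
  rw [thickening_closedBall hr zero_le_one] at hball
  exact ⟨r + 1, by linarith, fun p hp => hAB ⟨hA' (mem_univ _), hball (by simpa using hp)⟩⟩

namespace Tube

variable (T : Tube)

/-- The thinner tube `(z, w) ↦ T (z, ε w)`. -/
def shrink (ε : ℝ) (hε : 0 < ε) : Tube where
  toFun p := T.toFun (p.1, ε • p.2)
  isLocalDiffeomorph p := (locDiff_smul hε.ne' p).comp _ _ (T.isLocalDiffeomorph _)
  injective := by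
    rintro ⟨z, w⟩ ⟨z', w'⟩ h
    have h1 := T.injective h
    rw [Prod.ext_iff] at h1
    exact Prod.ext h1.1 (smul_right_injective ℂ hε.ne' h1.2)

variable {T}

theorem mem_image_iff {A : Set ℂ} {p : Circle × ℂ} :
    T.toFun p ∈ T.toFun '' (univ ×ˢ A) ↔ p.2 ∈ A := by
  rw [T.injective.mem_set_image]; simp

theorem image_shrink {ε : ℝ} (hε : 0 < ε) (A : Set ℂ) :
    (T.shrink ε hε).toFun '' (univ ×ˢ A) = T.toFun '' (univ ×ˢ ((fun v => ε • v) '' A)) := by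
  ext y
  constructor
  · rintro ⟨p, ⟨-, hp⟩, rfl⟩
    exact ⟨(p.1, ε • p.2), ⟨mem_univ _, p.2, hp, rfl⟩, rfl⟩
  · rintro ⟨⟨z, _⟩, ⟨-, v, hv, rfl⟩, rfl⟩
    exact ⟨(z, v), ⟨mem_univ _, hv⟩, rfl⟩

open scoped Pointwise in
theorem openSolid_shrink {ε : ℝ} (hε : 0 < ε) :
    (T.shrink ε hε).openSolid = T.toFun '' (univ ×ˢ ball 0 ε) := by
  rw [openSolid, image_shrink]
  congr 2
  change ε • ball (0 : ℂ) 1 = _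
  rw [smul_unitBall_of_pos hε]

open scoped Pointwise in
theorem closedSolid_shrink {ε : ℝ} (hε : 0 < ε) :
    (T.shrink ε hε).closedSolid = T.toFun '' (univ ×ˢ closedBall 0 ε) := by
  rw [closedSolid, image_shrink]
  congr 2
  change ε • closedBall (0 : ℂ) 1 = _
  rw [smul_unitClosedBall, Real.norm_of_nonneg hε.le]

theorem isClosed_closedSolid : IsClosed T.closedSolid := (T.isCompact_image_closedBall 1).isClosed

theorem isOpen_openSolid : IsOpen T.openSolid := T.isOpen_image_ball 1

theorem openSolid_subset_closedSolid : T.openSolid ⊆ T.closedSolid :=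
  image_mono (prod_mono_right ball_subset_closedBall)

theorem torus_eq : T.torus = T.closedSolid \ T.openSolid := by
  rw [torus, closedSolid, openSolid, ← image_sdiff T.injective, prod_sdiff_prod]
  simp [closedBall_sdiff_ball]

/-- The homeomorphism type of the exterior, and of the embedding of the tube, does not change when
the tube is made thinner. -/
theorem exists_homeomorph_shrink {η : ℝ} (hη : 0 < η) (hη1 : η < 1) {C : Set S3}
    (hC : IsClosed C) (hd : Disjoint C T.closedSolid) :
    ∃ H : S3 ≃ₜ S3, (∀ p, ‖p.2‖ ≤ 1 → H (T.toFun p) = (T.shrink η hη).toFun p) ∧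
      (∀ y ∈ C, H y = y) ∧
      (∀ y, H y ∈ T.toFun '' (univ ×ˢ ball 0 η) ↔ y ∈ T.openSolid) ∧
      ∀ y, H y ∈ T.toFun '' (univ ×ˢ closedBall 0 η) ↔ y ∈ T.closedSolid := by
  obtain ⟨L, hL1, hL⟩ := exists_ball_of_isOpen_of_closedBall
    (hC.isOpen_compl.preimage T.continuous) (fun p hp hpC =>
      hd.le_bot ⟨hpC, ⟨p, ⟨mem_univ _, by simpa using hp⟩, rfl⟩⟩)
  obtain ⟨Φ, hΦ, hΦ1, hΦ2⟩ := exists_radial_scaling (a := 1) (b := η) (L := L) one_pos hη hL1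
    (by linarith)
  obtain ⟨H, hH, hH'⟩ := T.exists_homeomorph hΦ
  have hsub : ∀ (A : Set ℂ) (B : Set ℂ), A ⊆ ball 0 L → B ⊆ ball 0 L →
      (∀ p, (Φ p).2 ∈ A ↔ p.2 ∈ B) →
      ∀ y, H y ∈ T.toFun '' (univ ×ˢ A) ↔ y ∈ T.toFun '' (univ ×ˢ B) := by
    intro A B hA hB hAB y
    by_cases hy : y ∈ T.toFun '' (univ ×ˢ ball 0 L)
    · obtain ⟨p, -, rfl⟩ := hy
      rw [hH, mem_image_iff, mem_image_iff, hAB]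
    · rw [hH' y hy]
      exact ⟨fun h => absurd (image_mono (prod_mono_right hA) h) hy,
        fun h => absurd (image_mono (prod_mono_right hB) h) hy⟩
  refine ⟨H, fun p hp => ?_, fun y hy => hH' y ?_, ?_, ?_⟩
  · rw [hH, hΦ1 p hp, div_one]; rfl
  · rintro ⟨p, ⟨-, hp⟩, rfl⟩
    exact hL p (by simpa using hp) hy
  · exact hsub _ _ (ball_subset_ball (by linarith)) (ball_subset_ball hL1.le)
      fun p => by simpa using (hΦ2 p).1
  · exact hsub _ _ (closedBall_subset_ball (by linarith)) (closedBall_subset_ball hL1)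
      fun p => by simpa using (hΦ2 p).2

/-- If the core of `n` is the graph of a section in the coordinates of the tube `E`, then some
homeomorphism of the 3-sphere carries `n` to `E`. -/
theorem exists_homeomorph_of_graph {E n : Tube} {s : Circle → ℂ} (hs : Continuous s)
    (hcore : ∀ w, E.toFun (w, s w) ∈ n.core)
    (hcore' : n.core ⊆ range fun w => E.toFun (w, s w))
    (hT : ∀ w, CrossesFibre E.toFun n w (s w)) :
    ∃ H : S3 ≃ₜ S3, (∀ y, H y ∈ E.openSolid ↔ y ∈ n.openSolid) ∧
      ∀ y, H y ∈ E.closedSolid ↔ y ∈ n.closedSolid := by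
  obtain ⟨η, hη, hη1, Φ, L, hΦ, h1, h2, h3⟩ := exists_straightening isOpen_univ
    (fun p _ => E.isLocalDiffeomorph p) E.injective.injOn hs (fun w => mem_univ _) hcore hcore' hT
  obtain ⟨H₁, -, -, hH₁, hH₁'⟩ := n.exists_homeomorph_shrink hη hη1 isClosed_empty
    (disjoint_bot_left)
  obtain ⟨H₂, hH₂, hH₂'⟩ := E.exists_homeomorph hΦ
  have key : ∀ y, (H₂ y ∈ E.openSolid ↔ y ∈ n.toFun '' (univ ×ˢ ball 0 η)) ∧
      (H₂ y ∈ E.closedSolid ↔ y ∈ n.toFun '' (univ ×ˢ closedBall 0 η)) := by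
    intro y
    by_cases hy : y ∈ range E.toFun
    · obtain ⟨p, rfl⟩ := hy
      rw [hH₂, openSolid, closedSolid, mem_image_iff, mem_image_iff, mem_ball_zero_iff,
        mem_closedBall_zero_iff, h1, h2]
      simp
    · rw [hH₂' y fun ⟨p, _, hp⟩ => hy ⟨p, hp⟩]
      have a1 : y ∉ E.closedSolid := fun ⟨p, _, hp⟩ => hy ⟨p, hp⟩
      have a2 : y ∉ n.toFun '' (univ ×ˢ closedBall 0 η) := fun h => by
        obtain ⟨p, -, hp⟩ := h3 h
        exact hy ⟨p, hp⟩
      exact ⟨⟨fun h => absurd (openSolid_subset_closedSolid h) a1,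
        fun h => absurd (image_mono (prod_mono_right ball_subset_closedBall) h) a2⟩,
        ⟨fun h => absurd h a1, fun h => absurd h a2⟩⟩
  refine ⟨H₁.trans H₂, fun y => ?_, fun y => ?_⟩
  · rw [Homeomorph.trans_apply, (key _).1, hH₁]
  · rw [Homeomorph.trans_apply, (key _).2, hH₁']

/-- Uniqueness of tubular neighbourhoods, up to homeomorphism of the 3-sphere. -/
theorem exists_homeomorph_of_core_eq {E n : Tube} (h : E.core = n.core) :
    ∃ H : S3 ≃ₜ S3, (∀ y, H y ∈ E.openSolid ↔ y ∈ n.openSolid) ∧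
      ∀ y, H y ∈ E.closedSolid ↔ y ∈ n.closedSolid := by
  have h0 : ∀ w, E.toFun (w, 0) ∈ n.core := fun w => by
    rw [← h]; exact ⟨(w, 0), ⟨mem_univ _, rfl⟩, rfl⟩
  refine exists_homeomorph_of_graph (s := fun _ => 0) continuous_const h0 ?_ fun w => ?_
  · rw [← h]
    rintro _ ⟨⟨w, v⟩, ⟨-, hv⟩, rfl⟩
    obtain rfl : v = 0 := hv
    exact ⟨w, rfl⟩
  · refine ⟨fun t => Complex.arg w + t, fun _ => 0, 1, 0, ?_, hasDerivAt_const _ _, one_ne_zero,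
      by simp, rfl, Filter.Eventually.of_forall fun t => h0 _⟩
    simpa using (hasDerivAt_id (0 : ℝ)).const_add (Complex.arg w)

/-- The exterior of a tube is carried to the exterior of another by a homeomorphism of the
3-sphere that respects the open tubes. -/
def exteriorHomeomorph {E n : Tube} (H : S3 ≃ₜ S3) (hH : ∀ y, H y ∈ E.openSolid ↔ y ∈ n.openSolid) :
    n.exterior ≃ₜ E.exterior :=
  H.subtype fun y => (not_congr (hH y)).symm

end Tube

/-- The reparametrization `univBall` of the plane by a disc of radius `η` maps the unit disc onto the
disc of radius `η / √2`. -/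
theorem norm_univBall_lt_iff {η : ℝ} (hη : 0 < η) (w : ℂ) :
    (‖OpenPartialHomeomorph.univBall (0 : ℂ) η w‖ < η / √2 ↔ ‖w‖ < 1) ∧
      (‖OpenPartialHomeomorph.univBall (0 : ℂ) η w‖ ≤ η / √2 ↔ ‖w‖ ≤ 1) := by
  have h1 : ‖OpenPartialHomeomorph.univBall (0 : ℂ) η w‖ = η * (√(1 + ‖w‖ ^ 2))⁻¹ * ‖w‖ := by
    rw [OpenPartialHomeomorph.univBall, dif_pos hη]
    simp [OpenPartialHomeomorph.unitBallBall, OpenPartialHomeomorph.univUnitBall, abs_of_pos hη,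
      abs_of_nonneg (Real.sqrt_nonneg _), mul_assoc]
  have h2 : 0 < 1 + ‖w‖ ^ 2 := by positivity
  have h3 : (η * (√(1 + ‖w‖ ^ 2))⁻¹ * ‖w‖) ^ 2 = η ^ 2 * ‖w‖ ^ 2 / (1 + ‖w‖ ^ 2) := by
    rw [mul_pow, mul_pow, inv_pow, Real.sq_sqrt h2.le]; field_simp
  have h4 : (η / √2) ^ 2 = η ^ 2 / 2 := by rw [div_pow, Real.sq_sqrt zero_le_two]
  have hη2 : 0 < η ^ 2 := by positivity
  rw [h1, ← sq_lt_sq₀ (by positivity) (by positivity), ← sq_le_sq₀ (by positivity) (by positivity),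
    h3, h4, div_lt_div_iff₀ h2 two_pos, div_le_div_iff₀ h2 two_pos,
    ← sq_lt_one_iff₀ (norm_nonneg w), ← sq_le_one_iff₀ (norm_nonneg w)]
  constructor <;> constructor <;> intro h <;> nlinarith

/-- The radius function that contracts by the factor `R` near radius `1`, and is the identity up
to radius `R / 4` and beyond radius `2`. -/
def contractRadius (R ρ : ℝ) : ℝ :=
  min ρ (max (3 * ρ - 4) (max (R * ρ) (min ρ ((R / 2 + R * ρ) / 2))))

section contractRadius

variable {R : ℝ} (hR : 0 < R) (hR1 : R < 1)
include hR

theorem strictMono_contractRadius : StrictMono (contractRadius R) := by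
  have h1 : StrictMono fun ρ : ℝ => ρ := strictMono_id
  have h2 : StrictMono fun ρ : ℝ => 3 * ρ - 4 := fun a b h => by simp only; linarith
  have h3 : StrictMono fun ρ : ℝ => R * ρ := fun a b h => mul_lt_mul_of_pos_left h hR
  have h4 : StrictMono fun ρ : ℝ => (R / 2 + R * ρ) / 2 := fun a b h => by
    have := h3 h; simp only at this ⊢; linarith
  have hmin : ∀ {f g : ℝ → ℝ}, StrictMono f → StrictMono g → StrictMono fun ρ => min (f ρ) (g ρ) :=
    fun hf hg _ _ hab => min_lt_min (hf hab) (hg hab)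
  have hmax : ∀ {f g : ℝ → ℝ}, StrictMono f → StrictMono g → StrictMono fun ρ => max (f ρ) (g ρ) :=
    fun hf hg _ _ hab => max_lt_max (hf hab) (hg hab)
  exact hmin h1 (hmax h2 (hmax h3 (hmin h1 h4)))

include hR1

theorem contractRadius_of_le {ρ : ℝ} (h0 : 0 ≤ ρ) (h : ρ ≤ R / 4) : contractRadius R ρ = ρ := by
  rw [contractRadius, min_eq_left (b := (R / 2 + R * ρ) / 2) (by nlinarith),
    max_eq_right (a := R * ρ) (by nlinarith), max_eq_right (by linarith), min_self]

theorem contractRadius_of_mem {ρ : ℝ} (h0 : 1 / 2 ≤ ρ) (h : ρ ≤ 4 / 3) :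
    contractRadius R ρ = R * ρ := by
  rw [contractRadius, max_eq_left (a := R * ρ) (min_le_of_right_le (by nlinarith)),
    max_eq_right (by nlinarith), min_eq_right (by nlinarith)]

end contractRadius

theorem contractRadius_of_ge {R ρ : ℝ} (h : 2 ≤ ρ) : contractRadius R ρ = ρ := by
  rw [contractRadius, min_eq_left]
  exact le_max_of_le_left (by linarith)

/-- A meridian can be contracted radially into a small neighbourhood of the core, with its tubular
neighbourhood, fixing a set `C` that lies even closer to the core. -/
theorem Tube.exists_contract_meridian {T m : Tube} {x : Circle}
    (hm : m.core = T.toFun '' ({x} ×ˢ sphere 0 1)) {R : ℝ} (hR : 0 < R) (hR1 : R < 1)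
    {C : Set S3} (hC : IsClosed C) (hCT : C ⊆ T.toFun '' (univ ×ˢ closedBall 0 (R / 4)))
    (hd : Disjoint C m.closedSolid) :
    ∃ n : Tube, n.core = T.toFun '' ({x} ×ˢ sphere 0 R) ∧ ∃ H : S3 ≃ₜ S3,
      (∀ y, H y ∈ n.openSolid ↔ y ∈ m.openSolid) ∧
      (∀ y, H y ∈ n.closedSolid ↔ y ∈ m.closedSolid) ∧ ∀ y ∈ C, H y = y := by
  obtain ⟨hΦ, -⟩ := isSupportedHomeo_radial (φ := contractRadius R) (L := 2)
    (by unfold contractRadius; fun_prop)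
    (by rw [contractRadius_of_le hR hR1 le_rfl (by positivity)])
    ((strictMono_contractRadius hR).strictMonoOn _) fun ρ _ h => contractRadius_of_ge h
  obtain ⟨D, hD, -⟩ := T.exists_homeomorph hΦ
  have hDm : ∀ p : Circle × ℂ, 1 / 2 ≤ ‖p.2‖ → ‖p.2‖ ≤ 4 / 3 →
      D (T.toFun p) = T.toFun (p.1, R • p.2) := fun p h1 h2 => by
    rw [hD, rayMap_radial_of_eq (contractRadius_of_mem hR hR1 h1 h2)]
  -- the annular region of `T` where the contraction is linear contains a thin tube about `m`
  set A : Set (Circle × ℂ) := {p | 1 / 2 < ‖p.2‖ ∧ ‖p.2‖ < 4 / 3} with hA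
  have hAo : IsOpen A :=
    (isOpen_lt continuous_const continuous_snd.norm).inter
      (isOpen_lt continuous_snd.norm continuous_const)
  obtain ⟨r, hr, hrA⟩ := exists_ball_of_isOpen
    ((T.isOpenEmbedding.isOpenMap A hAo).preimage m.continuous) (fun z => by
      have : m.toFun (z, 0) ∈ m.core := ⟨(z, 0), ⟨mem_univ _, rfl⟩, rfl⟩
      rw [hm] at this
      obtain ⟨p, ⟨-, hp⟩, hpz⟩ := this
      rw [mem_sphere_zero_iff_norm] at hp
      exact ⟨p, by simp only [hA, mem_ofPred_eq, hp]; norm_num, hpz⟩)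
  -- squeeze the fibres of `m` to radius `η`, so that the contracted tube is defined on all of
  -- `S¹ × ℂ`; the contraction is smooth there, being linear
  set η := min r 1 with hη
  have hη0 : 0 < η := by positivity
  set u := OpenPartialHomeomorph.univBall (0 : ℂ) η with hu
  have hu_lt : ∀ w, ‖u w‖ < η := fun w => by
    have := u.map_source (x := w) (by simp [hu])
    rw [hu, OpenPartialHomeomorph.univBall_target _ hη0] at this
    simpa using this
  have humA : ∀ p : Circle × ℂ, ∃ q ∈ A, T.toFun q = m.toFun (p.1, u p.2) := fun p =>
    hrA (p.1, u p.2) ((hu_lt _).trans_le (min_le_left _ _))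
  set f : Circle × ℂ → S3 := fun p =>
    T.toFun ((T.inv (m.toFun (p.1, u p.2))).1, R • (T.inv (m.toFun (p.1, u p.2))).2) with hf
  have hfD : ∀ p, f p = D (m.toFun (p.1, u p.2)) := by
    intro p
    obtain ⟨q, hq, hqp⟩ := humA p
    simp only [hf, ← hqp, T.inv_apply]
    rw [hDm q hq.1.le hq.2.le]
  have hu_inj : Function.Injective u := by
    have := u.injOn
    rw [hu, OpenPartialHomeomorph.univBall_source, injOn_univ] at this
    exact this
  have hfl : ∀ p, LocDiff f p := by
    intro p
    have l1 := locDiff_prodMk_id (e := u)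
      (OpenPartialHomeomorph.contDiff_univBall.contDiffOn) (by
        rw [hu, OpenPartialHomeomorph.univBall_target _ hη0]
        exact OpenPartialHomeomorph.contDiffOn_univBall_symm) (p := p) (by simp [hu])
    have l2 := l1.comp _ _ (m.isLocalDiffeomorph (p.1, u p.2))
    obtain ⟨q, hq, hqp⟩ := humA p
    have l3 := T.isLocalDiffeomorphAt_inv q
    rw [hqp] at l3
    have l4 := l2.comp _ _ (g := T.inv) l3
    have l5 := l4.comp _ _ (locDiff_smul hR.ne' _)
    exact l5.comp _ _ (T.isLocalDiffeomorph _)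
  let n : Tube := ⟨f, hfl, fun p p' h => by
    rw [hfD, hfD] at h
    have h1 := m.injective (D.injective h)
    rw [Prod.ext_iff] at h1
    exact Prod.ext h1.1 (hu_inj h1.2)⟩
  have hη' : 0 < η / √2 := by positivity
  have hη'η : η / √2 < η := div_lt_self hη0 (by
    rw [Real.lt_sqrt zero_le_one]; norm_num)
  have hη1 : η / √2 < 1 := hη'η.trans_le (min_le_right _ _)
  have himage : ∀ S S' : Set ℂ, S' ⊆ ball 0 η → (∀ w, u w ∈ S' ↔ w ∈ S) → ∀ y,
      D y ∈ n.toFun '' (univ ×ˢ S) ↔ y ∈ m.toFun '' (univ ×ˢ S') := by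
    intro S S' hS' hSS' y
    constructor
    · rintro ⟨p, ⟨-, hp⟩, hpy⟩
      have : D (m.toFun (p.1, u p.2)) = D y := by rw [← hfD]; exact hpy
      exact ⟨(p.1, u p.2), ⟨mem_univ _, (hSS' _).2 hp⟩, D.injective this⟩
    · rintro ⟨⟨z, v⟩, ⟨-, hv⟩, rfl⟩
      have h1 : u (u.symm v) = v := u.right_inv (by
        rw [hu, OpenPartialHomeomorph.univBall_target _ hη0]; exact hS' hv)
      refine ⟨(z, u.symm v), ⟨mem_univ _, (hSS' _).1 (by rw [h1]; exact hv)⟩, ?_⟩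
      change f _ = _
      rw [hfD]
      simp only [h1]
  obtain ⟨H₁, -, hH₁C, hH₁, hH₁'⟩ := m.exists_homeomorph_shrink hη' hη1 hC hd
  refine ⟨n, ?_, H₁.trans D, fun y => ?_, fun y => ?_, fun y hy => ?_⟩
  · ext y
    have hu0 : u 0 = 0 := by simp [hu]
    constructor
    · rintro ⟨⟨z, v⟩, ⟨-, hv⟩, rfl⟩
      obtain rfl : v = 0 := hv
      have : m.toFun (z, 0) ∈ m.core := ⟨(z, 0), ⟨mem_univ _, rfl⟩, rfl⟩
      rw [hm] at this
      obtain ⟨p, ⟨hp1, hp⟩, hpz⟩ := this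
      rw [mem_sphere_zero_iff_norm] at hp
      change f (z, 0) ∈ _
      rw [hfD, hu0, ← hpz, hDm p (by rw [hp]; norm_num) (by rw [hp]; norm_num)]
      exact ⟨(p.1, R • p.2), ⟨hp1, by
        rw [mem_sphere_zero_iff_norm, norm_smul, hp, mul_one, Real.norm_of_nonneg hR.le]⟩, rfl⟩
    · rintro ⟨⟨z, v⟩, ⟨hz, hv⟩, rfl⟩
      rw [mem_sphere_zero_iff_norm] at hv
      have hv1 : ‖R⁻¹ • v‖ = 1 := by
        rw [norm_smul, hv, Real.norm_of_nonneg (inv_pos.2 hR).le, inv_mul_cancel₀ hR.ne']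
      have : T.toFun (z, R⁻¹ • v) ∈ m.core := by
        rw [hm]; exact ⟨(z, R⁻¹ • v), ⟨hz, mem_sphere_zero_iff_norm.2 hv1⟩, rfl⟩
      obtain ⟨⟨z', v'⟩, ⟨-, hv'⟩, hz'⟩ := this
      obtain rfl : v' = 0 := hv'
      refine ⟨(z', 0), ⟨mem_univ _, rfl⟩, ?_⟩
      change f (z', 0) = _
      rw [hfD, hu0, hz', hDm _ (by simp only [hv1]; norm_num) (by simp only [hv1]; norm_num),
        smul_inv_smul₀ hR.ne']
  · rw [Homeomorph.trans_apply, openSolid, himage (ball 0 1) (ball 0 (η / √2))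
      (ball_subset_ball hη'η.le) (fun w => by simpa using (norm_univBall_lt_iff hη0 w).1), hH₁]
  · rw [Homeomorph.trans_apply, closedSolid, himage (closedBall 0 1) (closedBall 0 (η / √2))
      (closedBall_subset_ball hη'η) (fun w => by simpa using (norm_univBall_lt_iff hη0 w).2), hH₁']
  · rw [Homeomorph.trans_apply, hH₁C y hy]
    obtain ⟨p, ⟨-, hp⟩, rfl⟩ := hCT hy
    rw [mem_closedBall_zero_iff] at hp
    rw [hD, rayMap_radial_of_eq (c := 1)
      (by rw [one_mul, contractRadius_of_le hR hR1 (norm_nonneg _) hp]), one_smul]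

/-! ### Small meridians as graphs -/

/-- The direction `v / ‖v‖` of a nonzero complex number, as a point of the circle (and `1` at
`0`). -/
def unitDir (v : ℂ) : Circle := Circle.exp (Complex.arg v)

theorem coe_unitDir {v : ℂ} (hv : v ≠ 0) : (unitDir v : ℂ) = v / ‖v‖ := by
  rw [eq_div_iff (by simpa using hv), unitDir, Circle.coe_exp, mul_comm,
    Complex.norm_mul_exp_arg_mul_I]

theorem norm_smul_unitDir (v : ℂ) : ‖v‖ • (unitDir v : ℂ) = v := by
  rw [unitDir, Circle.coe_exp, Complex.real_smul, Complex.norm_mul_exp_arg_mul_I]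

theorem unitDir_smul {ρ : ℝ} (hρ : 0 < ρ) (v : ℂ) : unitDir (ρ • v) = unitDir v := by
  rw [unitDir, unitDir, Complex.real_smul, Complex.arg_real_mul _ hρ]

theorem unitDir_coe (z : Circle) : unitDir z = z := Circle.exp_arg z

theorem unitDir_eq_mul {v v₀ : ℂ} (hv : v ≠ 0) (hv₀ : v₀ ≠ 0) :
    unitDir v = unitDir v₀ * Circle.exp (Complex.arg (v / v₀)) := by
  have h : (unitDir (v / v₀) : ℂ) = (v / v₀) / ‖v / v₀‖ := coe_unitDir (div_ne_zero hv hv₀)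
  apply Circle.ext
  rw [Circle.coe_mul, ← unitDir, h, coe_unitDir hv, coe_unitDir hv₀, norm_div]
  have h1 : (‖v‖ : ℂ) ≠ 0 := Complex.ofReal_ne_zero.2 (norm_ne_zero_iff.2 hv)
  have h2 : (‖v₀‖ : ℂ) ≠ 0 := Complex.ofReal_ne_zero.2 (norm_ne_zero_iff.2 hv₀)
  push_cast
  field_simp

theorem contMDiffAt_unitDir {v₀ : ℂ} (hv₀ : v₀ ≠ 0) :
    ContMDiffAt 𝓘(ℝ, ℂ) (𝓡 1) ∞ unitDir v₀ := by
  have h1 : ContDiffAt ℝ ∞ (fun v : ℂ => Complex.arg (v / v₀)) v₀ := by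
    refine ContDiffAt.comp (g := Complex.arg) (f := fun v : ℂ => v / v₀) v₀
      (contDiffAt_arg (by simp [hv₀])) ?_
    fun_prop
  have h2 : ContMDiffAt 𝓘(ℝ, ℂ) (𝓡 1) ∞
      (fun v : ℂ => unitDir v₀ * Circle.exp (Complex.arg (v / v₀))) v₀ :=
    contMDiffAt_const.mul (contMDiff_circleExp.contMDiffAt.comp v₀ h1.contMDiffAt)
  refine h2.congr_of_eventuallyEq ?_
  filter_upwards [isOpen_ne.mem_nhds hv₀] with v hv
  exact unitDir_eq_mul hv hv₀

theorem continuousAt_unitDir {v₀ : ℂ} (hv₀ : v₀ ≠ 0) : ContinuousAt unitDir v₀ :=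
  (contMDiffAt_unitDir hv₀).continuousAt

/-- The curve `b (‖w‖ = R)` winds once around the origin: it meets every ray from the origin
exactly once, and is transverse to it. -/
structure IsStarCurve (b : ℂ → ℂ) (R : ℝ) : Prop where
  ne_zero : ∀ w, ‖w‖ = R → b w ≠ 0
  differentiableAt : ∀ w, ‖w‖ = R → DifferentiableAt ℝ b w
  transverse : ∀ w, ‖w‖ = R → ∀ t : ℝ, fderiv ℝ b w (Complex.I * w) ≠ t • b w
  injective : ∀ w w', ‖w‖ = R → ‖w'‖ = R → unitDir (b w) = unitDir (b w') → w = w'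
  surjective : ∀ e : Circle, ∃ w, ‖w‖ = R ∧ unitDir (b w) = e

theorem norm_sub_add_le {v v' : ℂ} {l : ℝ} (hl : 1 ≤ l) (h : ‖v‖ = ‖v'‖) :
    ‖v - v'‖ + (l - 1) * ‖v'‖ ≤ 3 * ‖v - l • v'‖ := by
  have h1 : (l - 1) * ‖v'‖ ≤ ‖v - l • v'‖ := by
    have := norm_sub_norm_le (l • v') v
    rw [norm_smul, Real.norm_of_nonneg (by linarith), h, norm_sub_rev] at this
    linarith
  have h2 : ‖v - v'‖ ≤ ‖v - l • v'‖ + (l - 1) * ‖v'‖ := by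
    have := norm_add_le (v - l • v') ((l - 1) • v')
    rw [norm_smul, Real.norm_of_nonneg (by linarith)] at this
    refine le_trans (le_of_eq ?_) this
    congr 1
    rw [sub_smul, one_smul]; ring
  linarith

/-- Small circles are mapped by a local diffeomorphism of the plane to curves that wind once
around the image of the centre. -/
theorem exists_isStarCurve {b : ℂ → ℂ} (hb0 : b 0 = 0) (hb : ContDiffAt ℝ ∞ b 0)
    (hL : Function.Injective (fderiv ℝ b 0)) :
    ∃ R₀ > 0, ∀ R, 0 < R → R < R₀ → IsStarCurve b R := by
  set L := fderiv ℝ b 0 with hLdef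
  obtain ⟨m, hm, hLm⟩ := exists_norm_lower_bound hL
  have hstrict : HasStrictFDerivAt b L 0 := hb.hasStrictFDerivAt (by simp)
  have hκ : 0 < m / 4 := by positivity
  have h1 := hstrict.isLittleO.def hκ
  rw [show ((0 : ℂ), (0 : ℂ)) = 0 from rfl] at h1
  obtain ⟨r₁, hr₁, h1⟩ := Metric.eventually_nhds_iff_ball.1 h1
  have hdiff : ∀ᶠ v in 𝓝 (0 : ℂ), DifferentiableAt ℝ b v ∧ ‖fderiv ℝ b v - L‖ ≤ m / 4 := by
    have e1 : ∀ᶠ v in 𝓝 (0 : ℂ), ContDiffAt ℝ 1 b v :=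
      (hb.of_le (by exact_mod_cast le_top)).eventually (by simp)
    have e2 : ContinuousAt (fderiv ℝ b) 0 :=
      (hb.fderiv_right (m := 0) (by exact_mod_cast le_top)).continuousAt
    have e3 : ∀ᶠ v in 𝓝 (0 : ℂ), fderiv ℝ b v ∈ closedBall L (m / 4) :=
      e2.eventually_mem (closedBall_mem_nhds _ hκ)
    filter_upwards [e1, e3] with v hv hv'
    exact ⟨hv.differentiableAt (by simp), by simpa [dist_eq_norm] using hv'⟩
  obtain ⟨r₂, hr₂, h2⟩ := Metric.eventually_nhds_iff_ball.1 hdiff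
  have hlip : ∀ v v' : ℂ, ‖v‖ < r₁ → ‖v'‖ < r₁ →
      ‖b v - b v' - L (v - v')‖ ≤ m / 4 * ‖v - v'‖ := by
    intro v v' hv hv'
    simpa using h1 (v, v') (by rw [mem_ball_zero_iff, Prod.norm_def]; exact max_lt hv hv')
  have hb_lin : ∀ v : ℂ, ‖v‖ < r₁ → ‖b v - L v‖ ≤ m / 4 * ‖v‖ := fun v hv => by
    simpa [hb0] using hlip v 0 hv (by simpa using hr₁)
  have hb_ne : ∀ v : ℂ, ‖v‖ < r₁ → v ≠ 0 → b v ≠ 0 := by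
    intro v hv hv0 h
    have e1 := hb_lin v hv
    rw [h, zero_sub, norm_neg] at e1
    have e2 := hLm v
    have e3 := norm_pos_iff.2 hv0
    nlinarith
  -- a local inverse, to reach every direction
  let Le : ℂ ≃L[ℝ] ℂ := (LinearEquiv.ofInjectiveEndo L.toLinearMap hL).toContinuousLinearEquiv
  have hLe : (Le : ℂ →L[ℝ] ℂ) = L := rfl
  have hstrict' : HasStrictFDerivAt b (Le : ℂ →L[ℝ] ℂ) 0 := by rwa [hLe]
  set c := hstrict'.toOpenPartialHomeomorph b with hc
  have hc0 : (0 : ℂ) ∈ c.source := hstrict'.mem_toOpenPartialHomeomorph_source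
  have hcb : ∀ v, c v = b v := fun v => rfl
  have h0t : (0 : ℂ) ∈ c.target := by have := c.map_source hc0; rwa [hcb, hb0] at this
  obtain ⟨r₃, hr₃, hball⟩ := Metric.isOpen_iff.1 c.open_target 0 h0t
  have hcs0 : c.symm 0 = 0 := by have := c.left_inv hc0; rwa [hcb, hb0] at this
  set K : ℝ := m / 4 + ‖L‖ with hK
  have hKpos : 0 < K := by positivity
  refine ⟨min (min r₁ r₂) (r₃ / 2 / K), by positivity, fun R hR hRR => ?_⟩
  have hRr₁ : R < r₁ := hRR.trans_le ((min_le_left _ _).trans (min_le_left _ _))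
  have hRr₂ : R < r₂ := hRR.trans_le ((min_le_left _ _).trans (min_le_right _ _))
  have hRK : R < r₃ / 2 / K := hRR.trans_le (min_le_right _ _)
  have hne : ∀ w, ‖w‖ = R → b w ≠ 0 := fun w hw =>
    hb_ne w (by rwa [hw]) (by rw [← norm_pos_iff, hw]; exact hR)
  have hinj : ∀ w w' : ℂ, ‖w‖ = R → ‖w'‖ = R → ∀ l : ℝ, 1 ≤ l → b w = l • b w' → w = w' := by
    intro w w' hw hw' l hl h
    have e1 := hlip w w' (by rwa [hw]) (by rwa [hw'])
    have e2 := hb_lin w' (by rwa [hw'])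
    have e3 := hLm (w - l • w')
    have e4 := norm_sub_add_le hl (hw.trans hw'.symm)
    have e5 : L (w - l • w') = -(b w - b w' - L (w - w')) + (l - 1) • (b w' - L w') := by
      rw [h, map_sub, map_sub, map_smul, smul_sub, sub_smul, sub_smul, one_smul, one_smul]; ring
    have e6 : ‖L (w - l • w')‖ ≤ m / 4 * ‖w - w'‖ + (l - 1) * (m / 4 * ‖w'‖) := by
      rw [e5]
      refine (norm_add_le _ _).trans (add_le_add (by rwa [norm_neg]) ?_)
      rw [norm_smul, Real.norm_of_nonneg (by linarith)]
      exact mul_le_mul_of_nonneg_left e2 (by linarith)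
    have e7 : ‖w - l • w'‖ ≤ 0 := by nlinarith [norm_nonneg (w - l • w')]
    have e8 : w = l • w' := sub_eq_zero.1 (norm_le_zero_iff.1 e7)
    have e9 : l = 1 := by
      have := congrArg norm e8
      rw [norm_smul, hw, hw', Real.norm_of_nonneg (by linarith)] at this
      nlinarith
    rw [e8, e9, one_smul]
  refine ⟨hne, fun w hw => (h2 w (by simpa [hw] using hRr₂)).1, fun w hw t ht => ?_,
    fun w w' hw hw' h => ?_, fun e => ?_⟩
  · have e1 := hb_lin w (by rwa [hw])
    have e2 := (h2 w (by simpa [hw] using hRr₂)).2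
    have e3 : ‖fderiv ℝ b w (Complex.I * w) - L (Complex.I * w)‖ ≤ m / 4 * ‖w‖ := by
      have := (fderiv ℝ b w - L).le_of_opNorm_le e2 (Complex.I * w)
      simpa using this
    have e4 := hLm (Complex.I * w - t • w)
    have e5 : ‖Complex.I * w - t • w‖ = √(1 + t ^ 2) * ‖w‖ := by
      rw [Complex.real_smul, ← sub_mul, norm_mul, Complex.norm_eq_sqrt_sq_add_sq]
      congr 2
      simp; ring
    have e6 : L (Complex.I * w - t • w) = -(fderiv ℝ b w (Complex.I * w) - L (Complex.I * w)) +
        t • (b w - L w) := by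
      rw [ht, map_sub, map_smul, smul_sub]; ring
    have e7 : ‖L (Complex.I * w - t • w)‖ ≤ m / 4 * ‖w‖ + |t| * (m / 4 * ‖w‖) := by
      rw [e6]
      refine (norm_add_le _ _).trans (add_le_add (by rwa [norm_neg]) ?_)
      rw [norm_smul, Real.norm_eq_abs]
      exact mul_le_mul_of_nonneg_left e1 (abs_nonneg _)
    have e8 : |t| ≤ √(1 + t ^ 2) := Real.le_sqrt_of_sq_le (by rw [sq_abs]; linarith)
    have e9 : 1 ≤ √(1 + t ^ 2) := Real.le_sqrt_of_sq_le (by nlinarith)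
    rw [hw] at e5 e7
    rw [e5] at e4
    have : 0 < m * R := by positivity
    nlinarith
  · have e1 := norm_smul_unitDir (b w)
    have e2 := norm_smul_unitDir (b w')
    have n1 := norm_pos_iff.2 (hne w hw)
    have n2 := norm_pos_iff.2 (hne w' hw')
    rcases le_total ‖b w'‖ ‖b w‖ with h' | h'
    · refine hinj w w' hw hw' (‖b w‖ / ‖b w'‖) ((one_le_div n2).2 h') ?_
      calc b w = (‖b w‖ / ‖b w'‖) • (‖b w'‖ • (unitDir (b w') : ℂ)) := by
            rw [← h, smul_smul, div_mul_cancel₀ _ n2.ne', e1]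
        _ = _ := by rw [e2]
    · refine (hinj w' w hw' hw (‖b w'‖ / ‖b w‖) ((one_le_div n1).2 h') ?_).symm
      calc b w' = (‖b w'‖ / ‖b w‖) • (‖b w‖ • (unitDir (b w) : ℂ)) := by
            rw [h, smul_smul, div_mul_cancel₀ _ n1.ne', e2]
        _ = _ := by rw [e1]
  · have hcont : ContinuousOn (fun ρ : ℝ => ‖c.symm (ρ • (e : ℂ))‖) (Icc 0 (r₃ / 2)) := by
      refine (c.continuousOn_symm.comp (by fun_prop) fun ρ hρ => hball ?_).norm
      rw [mem_ball_zero_iff, norm_smul, Circle.norm_coe, mul_one, Real.norm_of_nonneg hρ.1]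
      linarith [hρ.2]
    have hend : R ≤ ‖c.symm ((r₃ / 2) • (e : ℂ))‖ := by
      by_contra! hlt
      set y : ℂ := (r₃ / 2) • (e : ℂ) with hy
      have hyn : ‖y‖ = r₃ / 2 := by
        rw [hy, norm_smul, Circle.norm_coe, mul_one, Real.norm_of_nonneg (by linarith)]
      have hyt : y ∈ c.target := hball (by rw [mem_ball_zero_iff, hyn]; linarith)
      have e1 := hb_lin (c.symm y) (hlt.trans hRr₁)
      have e2 : b (c.symm y) = y := c.right_inv hyt
      rw [e2] at e1
      have e3 := norm_le_insert' y (L (c.symm y))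
      have e4 := L.le_opNorm (c.symm y)
      have e5 : r₃ / 2 ≤ K * ‖c.symm y‖ := by rw [← hyn, hK]; linarith
      rw [lt_div_iff₀ hKpos] at hRK
      nlinarith
    obtain ⟨ρ, hρ, hρR⟩ := intermediate_value_Icc (by positivity) hcont
      (show R ∈ _ from ⟨by simp [hcs0, hR.le], hend⟩)
    simp only at hρR
    have hρ0 : 0 < ρ := by
      rcases hρ.1.lt_or_eq with h | h
      · exact h
      · rw [← h, zero_smul, hcs0, norm_zero] at hρR
        exact absurd hρR hR.ne
    refine ⟨c.symm (ρ • (e : ℂ)), hρR, ?_⟩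
    have e2 : b (c.symm (ρ • (e : ℂ))) = ρ • (e : ℂ) := c.right_inv (hball (by
      rw [mem_ball_zero_iff, norm_smul, Circle.norm_coe, mul_one, Real.norm_of_nonneg hρ.1]
      linarith [hρ.2]))
    rw [e2, unitDir_smul hρ0, unitDir_coe]

/-- A meridian whose fibre coordinate `b` winds once around the origin is the graph of a section,
with the direction of `b` as base coordinate, and crosses the fibres transversally. -/
theorem IsStarCurve.exists_graph {b β : ℂ → ℂ} {R : ℝ} (hR : 0 < R) (hb : IsStarCurve b R)
    (hβ : ∀ w, ‖w‖ = R → DifferentiableAt ℝ β w) {E : Circle × ℂ → S3} {T n : Tube} {x : Circle}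
    (hn : n.core = T.toFun '' ({x} ×ˢ sphere 0 R))
    (hE : ∀ w, ‖w‖ = R → E (unitDir (b w), β w) = T.toFun (x, w)) :
    ∃ s : Circle → ℂ, Continuous s ∧ (∀ e, ∃ w, ‖w‖ = R ∧ unitDir (b w) = e ∧ s e = β w) ∧
      (∀ e, E (e, s e) ∈ n.core) ∧ (n.core ⊆ range fun e => E (e, s e)) ∧
      ∀ e, CrossesFibre E n e (s e) := by
  have hnorm : ∀ w' : Circle, ‖R • (w' : ℂ)‖ = R := fun w' => by
    rw [norm_smul, Circle.norm_coe, mul_one, Real.norm_of_nonneg hR.le]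
  set A : Circle → Circle := fun w' => unitDir (b (R • (w' : ℂ))) with hA
  have hAc : Continuous A := by
    rw [continuous_iff_continuousAt]
    intro w'
    have h1 : ContinuousAt (fun w' : Circle => R • (w' : ℂ)) w' := by fun_prop
    have h2 : ContinuousAt (fun w' : Circle => b (R • (w' : ℂ))) w' :=
      ContinuousAt.comp (g := b) (hb.differentiableAt _ (hnorm w')).continuousAt h1
    exact ContinuousAt.comp (g := unitDir) (continuousAt_unitDir (hb.ne_zero _ (hnorm w'))) h2
  have hAb : Function.Bijective A := by
    constructor
    · intro w w' h
      have := hb.injective _ _ (hnorm w) (hnorm w') h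
      exact Circle.ext (smul_right_injective ℂ hR.ne' this)
    · intro e
      obtain ⟨w, hw, hwe⟩ := hb.surjective e
      refine ⟨unitDir w, ?_⟩
      simp only [hA]
      rw [← hw, norm_smul_unitDir, hwe]
  let Ah : Circle ≃ₜ Circle :=
    Continuous.homeoOfEquivCompactToT2 (f := Equiv.ofBijective A hAb) hAc
  have hAA : ∀ e, A (Ah.symm e) = e := fun e => Ah.apply_symm_apply e
  have hEs : ∀ e, E (e, β (R • (Ah.symm e : ℂ))) = T.toFun (x, R • (Ah.symm e : ℂ)) := fun e => by
    have := hE _ (hnorm (Ah.symm e))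
    rwa [show unitDir (b (R • (Ah.symm e : ℂ))) = e from hAA e] at this
  refine ⟨fun e => β (R • (Ah.symm e : ℂ)), ?_, fun e => ⟨_, hnorm _, hAA e, rfl⟩, fun e => ?_, ?_,
    fun e => ?_⟩
  · rw [continuous_iff_continuousAt]
    intro e
    have h1 : Continuous fun e => R • (Ah.symm e : ℂ) := by fun_prop
    exact ContinuousAt.comp (g := β) (f := fun e => R • (Ah.symm e : ℂ))
      (hβ _ (hnorm _)).continuousAt h1.continuousAt
  · rw [hEs, hn]
    exact ⟨(x, _), ⟨mem_singleton x, mem_sphere_zero_iff_norm.2 (hnorm _)⟩, rfl⟩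
  · rw [hn]
    rintro _ ⟨⟨z, w⟩, ⟨hz, hw⟩, rfl⟩
    rw [mem_sphere_zero_iff_norm] at hw
    simp only [mem_singleton_iff] at hz
    refine ⟨Ah (unitDir w), ?_⟩
    simp only
    rw [hEs, Homeomorph.symm_apply_apply, hz]
    simp only at hw
    rw [← hw, norm_smul_unitDir]
  · set w : ℂ := R • (Ah.symm e : ℂ) with hw
    have hwR : ‖w‖ = R := hnorm _
    have hbw := hb.ne_zero w hwR
    -- the meridian, traversed at unit angular speed from `w`
    set γ : ℝ → ℂ := fun t => Complex.exp (t * Complex.I) * w with hγ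
    have hγR : ∀ t, ‖γ t‖ = R := fun t => by
      rw [hγ]; simp only [norm_mul, Complex.norm_exp_ofReal_mul_I, hwR, one_mul]
    have hγ0 : γ 0 = w := by simp [hγ]
    have hγ' : HasDerivAt γ (Complex.I * w) 0 := by
      have h1 : HasDerivAt (fun t : ℝ => (t : ℂ) * Complex.I) (1 * Complex.I) 0 :=
        (Complex.ofRealCLM.hasDerivAt (x := (0 : ℝ))).mul_const Complex.I
      have h2 := (h1.cexp).mul_const w
      simpa using h2
    have hbγ : HasDerivAt (fun t => b (γ t)) (fderiv ℝ b w (Complex.I * w)) 0 := by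
      have := (hb.differentiableAt w hwR).hasFDerivAt
      rw [← hγ0] at this
      have := this.comp_hasDerivAt 0 hγ'
      rwa [hγ0] at this
    have hβγ : HasDerivAt (fun t => β (γ t)) (fderiv ℝ β w (Complex.I * w)) 0 := by
      have := (hβ w hwR).hasFDerivAt
      rw [← hγ0] at this
      have := this.comp_hasDerivAt 0 hγ'
      rwa [hγ0] at this
    have harg : HasDerivAt (fun t => Complex.arg (b (γ t) / b w))
        (fderiv ℝ b w (Complex.I * w) / b w).im 0 := by
      have h1 := (hbγ.div_const (b w)).clog_real (by simp [hγ0, hbw])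
      have h2 := Complex.imCLM.hasFDerivAt.comp_hasDerivAt (0 : ℝ) h1
      simp only [hγ0, div_self hbw, div_one] at h2
      refine h2.congr_of_eventuallyEq (Filter.Eventually.of_forall fun t => ?_)
      simp [Complex.log_im]
    have hexp : ∀ t, Circle.exp (Complex.arg (b w) + Complex.arg (b (γ t) / b w)) =
        unitDir (b (γ t)) := fun t => by
      rw [unitDir_eq_mul (hb.ne_zero _ (hγR t)) hbw, Circle.exp_add]; rfl
    refine ⟨fun t => Complex.arg (b w) + Complex.arg (b (γ t) / b w), fun t => β (γ t), _, _,
      harg.const_add _, hβγ, fun h => ?_, ?_, by simp only [hγ0, hw],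
      Filter.Eventually.of_forall fun t => ?_⟩
    · refine hb.transverse w hwR (fderiv ℝ b w (Complex.I * w) / b w).re ?_
      rw [Complex.real_smul]
      have h1 : ((fderiv ℝ b w (Complex.I * w) / b w).re : ℂ) =
          fderiv ℝ b w (Complex.I * w) / b w := Complex.ext (by simp) (by simp [h])
      rw [h1, div_mul_cancel₀ _ hbw]
    · rw [hexp, hγ0]; exact hAA e
    · rw [hexp, hE _ (hγR t), hn]
      exact ⟨(x, _), ⟨mem_singleton x, mem_sphere_zero_iff_norm.2 (hγR t)⟩, rfl⟩

/-! ### Surgery in dual coordinates -/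

/-- The involution `(w, v) ↦ (v / ‖v‖, ‖v‖ w)` of `S¹ × (ℂ \ 0)`. It exchanges the two ways of
seeing the complement of the core of a solid torus as a union of parallel tori. -/
def dualCoord (p : Circle × ℂ) : Circle × ℂ := (unitDir p.2, ‖p.2‖ • (p.1 : ℂ))

theorem norm_dualCoord (p : Circle × ℂ) : ‖(dualCoord p).2‖ = ‖p.2‖ := by
  simp only [dualCoord, norm_smul, Circle.norm_coe, mul_one, norm_norm]

theorem dualCoord_ne_zero {p : Circle × ℂ} (hp : p.2 ≠ 0) : (dualCoord p).2 ≠ 0 := by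
  rwa [← norm_ne_zero_iff, norm_dualCoord, norm_ne_zero_iff]

theorem dualCoord_dualCoord {p : Circle × ℂ} (hp : p.2 ≠ 0) : dualCoord (dualCoord p) = p := by
  ext1
  · simp only [dualCoord]
    rw [unitDir_smul (norm_pos_iff.2 hp), unitDir_coe]
  · change ‖(dualCoord p).2‖ • (unitDir p.2 : ℂ) = p.2
    rw [norm_dualCoord, norm_smul_unitDir]

theorem dualCoord_injOn : InjOn dualCoord {p | p.2 ≠ 0} := fun p hp q hq h => by
  rw [← dualCoord_dualCoord hp, h, dualCoord_dualCoord hq]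

theorem dualCoord_coe (z w : Circle) : dualCoord (z, (w : ℂ)) = (w, (z : ℂ)) := by
  simp [dualCoord, unitDir_coe, Circle.norm_coe]

theorem contMDiffAt_dualCoord {p : Circle × ℂ} (hp : p.2 ≠ 0) :
    ContMDiffAt ((𝓡 1).prod 𝓘(ℝ, ℂ)) ((𝓡 1).prod 𝓘(ℝ, ℂ)) ∞ dualCoord p := by
  have h1 : ContMDiffAt ((𝓡 1).prod 𝓘(ℝ, ℂ)) (𝓡 1) ∞ (fun q : Circle × ℂ => unitDir q.2) p :=
    ContMDiffAt.comp (g := unitDir) (f := fun q : Circle × ℂ => q.2) p (contMDiffAt_unitDir hp)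
      contMDiffAt_snd
  have h2 : ContMDiffAt ((𝓡 1).prod 𝓘(ℝ, ℂ)) 𝓘(ℝ, ℝ) ∞ (fun q : Circle × ℂ => ‖q.2‖) p :=
    ContMDiffAt.comp (g := fun v : ℂ => ‖v‖) (f := fun q : Circle × ℂ => q.2) p
      ((contDiffAt_norm ℝ hp).contMDiffAt) contMDiffAt_snd
  have h3 : ContMDiffAt ((𝓡 1).prod 𝓘(ℝ, ℂ)) 𝓘(ℝ, ℂ) ∞ (fun q : Circle × ℂ => (q.1 : ℂ)) p :=
    ContMDiffAt.comp (g := fun z : Circle => (z : ℂ)) (f := fun q : Circle × ℂ => q.1) p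
      contMDiff_coe_circle.contMDiffAt contMDiffAt_fst
  exact h1.prodMk (h2.smul h3)

theorem continuousAt_dualCoord {p : Circle × ℂ} (hp : p.2 ≠ 0) : ContinuousAt dualCoord p :=
  (contMDiffAt_dualCoord hp).continuousAt

theorem isOpen_snd_ne_zero : IsOpen {p : Circle × ℂ | p.2 ≠ 0} :=
  isOpen_ne.preimage continuous_snd

theorem locDiff_dualCoord {p : Circle × ℂ} (hp : p.2 ≠ 0) :
    IsLocalDiffeomorphAt ((𝓡 1).prod 𝓘(ℝ, ℂ)) ((𝓡 1).prod 𝓘(ℝ, ℂ)) ∞ dualCoord p :=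
  ⟨⟨⟨dualCoord, dualCoord, {p | p.2 ≠ 0}, {p | p.2 ≠ 0}, fun _ h => dualCoord_ne_zero h,
      fun _ h => dualCoord_ne_zero h, fun _ h => dualCoord_dualCoord h,
      fun _ h => dualCoord_dualCoord h⟩,
    isOpen_snd_ne_zero, isOpen_snd_ne_zero,
    fun _ h => (contMDiffAt_dualCoord h).contMDiffWithinAt,
    fun _ h => (contMDiffAt_dualCoord h).contMDiffWithinAt⟩, hp, fun _ _ => rfl⟩

theorem homeomorph_mem_iff_of_fixes {H : S3 ≃ₜ S3} {C B : Set S3} (hH : ∀ y ∈ C, H y = y)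
    (hB : B ⊆ C) (y : S3) : H y ∈ B ↔ y ∈ B := by
  constructor
  · intro h
    have := H.injective (hH _ (hB h))
    rwa [this] at h
  · intro h
    rwa [hH y (hB h)]

namespace Tube

theorem mem_torus_iff_of_solids {T n : Tube} {H : S3 ≃ₜ S3}
    (h1 : ∀ y, H y ∈ T.openSolid ↔ y ∈ n.openSolid)
    (h2 : ∀ y, H y ∈ T.closedSolid ↔ y ∈ n.closedSolid) (y : S3) :
    H y ∈ T.torus ↔ y ∈ n.torus := by
  rw [torus_eq, torus_eq, mem_sdiff, mem_sdiff, h1, h2]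

theorem surgeryRel_inl_inr {T : Tube} {A : Set S3} {e : ↥(A \ T.openSolid)} {v : D2 × Circle} :
    T.SurgeryRel A (Sum.inl e) (Sum.inr v) ↔
      ∃ z w : Circle, (e : S3) = T.toFun (z, (w : ℂ)) ∧ (v.1 : ℂ) = z ∧ v.2 = w :=
  ⟨fun ⟨z, w, _, _, he, hz, hw⟩ => ⟨z, w, he, hz, hw⟩,
    fun ⟨z, w, he, hz, hw⟩ => .glue z w e v he hz hw⟩

/-- Surgery depends only on the parametrized closed tube and the region, up to homeomorphism of
the 3-sphere. -/
theorem exists_surgery_congr {k k' : Tube} {A A' : Set S3} (H : S3 ≃ₜ S3)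
    (hk : ∀ p : Circle × ℂ, ‖p.2‖ ≤ 1 → H (k.toFun p) = k'.toFun p)
    (hA : ∀ y, H y ∈ A' ↔ y ∈ A) :
    ∃ F : k.Surgery A ≃ₜ k'.Surgery A', ∀ B B' : Set S3, (∀ y, H y ∈ B' ↔ y ∈ B) →
      ∀ p, F p ∈ k'.surgeryImage A' B' ↔ p ∈ k.surgeryImage A B := by
  have hopen : ∀ y, H y ∈ k'.openSolid ↔ y ∈ k.openSolid := by
    intro y
    constructor
    · rintro ⟨p, hp, hpy⟩
      rw [← hk p (by simpa using (ball_subset_closedBall hp.2))] at hpy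
      exact ⟨p, hp, H.injective hpy⟩
    · rintro ⟨p, hp, rfl⟩
      rw [hk p (by simpa using (ball_subset_closedBall hp.2))]
      exact ⟨p, hp, rfl⟩
  let e₁ : ↥(A \ k.openSolid) ≃ₜ ↥(A' \ k'.openSolid) :=
    H.subtype fun y => by
      rw [mem_sdiff, mem_sdiff, hA, hopen]
  have he₁ : ∀ e, (e₁ e : S3) = H e := fun e => rfl
  let e := e₁.sumCongr (Homeomorph.refl (D2 × Circle))
  have hrel : ∀ a b, k.SurgeryRel A a b ↔ k'.SurgeryRel A' (e a) (e b) := by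
    rintro (a | a) (b | b)
    · exact ⟨nofun, nofun⟩
    · change _ ↔ k'.SurgeryRel A' (Sum.inl (e₁ a)) (Sum.inr b)
      rw [surgeryRel_inl_inr, surgeryRel_inl_inr]
      refine exists_congr fun z => exists_congr fun w => and_congr_left' ?_
      rw [he₁, ← hk _ (Circle.norm_coe w).le, H.injective.eq_iff]
    · exact ⟨nofun, nofun⟩
    · exact ⟨nofun, nofun⟩
  let F₀ : k.Surgery A ≃ k'.Surgery A' := Quot.congr e.toEquiv hrel
  have hc : Continuous F₀ :=
    continuous_quot_lift _ (continuous_quot_mk.comp e.continuous)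
  have hc' : Continuous F₀.symm :=
    continuous_quot_lift _ (continuous_quot_mk.comp e.symm.continuous)
  refine ⟨⟨F₀, hc, hc'⟩, fun B B' hB p => ⟨?_, ?_⟩⟩
  · rintro ⟨y, hy, hyp⟩
    refine ⟨e₁.symm y, ?_, ?_⟩
    · rw [← hB, ← he₁, e₁.apply_symm_apply]; exact hy
    · apply F₀.injective
      refine Eq.trans ?_ hyp
      change Quot.mk _ (Sum.inl (e₁ (e₁.symm y))) = _
      rw [e₁.apply_symm_apply]
  · rintro ⟨y, hy, rfl⟩
    exact ⟨e₁ y, (hB _).2 hy, rfl⟩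

/-- The heart of the matter: if, in the coordinates dual to a tube `k`, the core of `n` is the
graph of a section, then surgery along `k` turns the exterior of `n` into the exterior of `k`. In
these coordinates the complement of the core of `k`, together with the new solid torus, is again
`S¹ × ℂ`; straightening `n` there moves it to the new solid torus, whose complement is the
exterior of `k`. -/
theorem exists_surgery_homeomorph_of_graph {k n : Tube} {s : Circle → ℂ} (hs : Continuous s)
    (hs0 : ∀ w, s w ≠ 0) (hcore : ∀ w, k.toFun (dualCoord (w, s w)) ∈ n.core)
    (hcore' : n.core ⊆ range fun w => k.toFun (dualCoord (w, s w)))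
    (hT : ∀ w, CrossesFibre (k.toFun ∘ dualCoord) n w (s w))
    (hd : Disjoint k.closedSolid n.closedSolid) :
    ∃ F : k.Surgery n.exterior ≃ₜ k.exterior, ∀ p,
      (F p : S3) ∈ k.torus ↔ p ∈ k.surgeryImage n.exterior n.torus := by
  obtain ⟨η, hη, hη1, Φ, L, hΦ, h1, h2, h3⟩ := exists_straightening
    (E := k.toFun ∘ dualCoord) isOpen_snd_ne_zero
    (fun p hp => (locDiff_dualCoord hp).comp _ _ (k.isLocalDiffeomorph _))
    (k.injective.injOn.comp dualCoord_injOn (mapsTo_univ _ _)) hs hs0 hcore hcore' hT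
  obtain ⟨H, -, hHk, hH, hH'⟩ := n.exists_homeomorph_shrink hη hη1 k.isClosed_closedSolid hd
  -- after thinning, the region is the complement of `n (S¹ × ball η)`
  set A : Set S3 := (n.toFun '' (univ ×ˢ ball 0 η))ᶜ with hA
  set B : Set S3 := n.toFun '' (univ ×ˢ closedBall 0 η) \ n.toFun '' (univ ×ˢ ball 0 η) with hB
  obtain ⟨F₁, hF₁⟩ := exists_surgery_congr (k := k) (k' := k) (A := n.exterior) (A' := A) H
    (fun p hp => hHk _ ⟨p, ⟨mem_univ _, by simpa using hp⟩, rfl⟩)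
    (fun y => not_congr (hH y))
  have hBt : ∀ y, H y ∈ B ↔ y ∈ n.torus := fun y => by
    rw [torus_eq, hB, mem_sdiff, mem_sdiff, hH, hH']
  have hnk : ∀ y ∈ k.closedSolid, y ∉ n.toFun '' (univ ×ˢ closedBall 0 η) := fun y hy hy' => by
    have h4 := (hH' (H.symm y)).1 (by rwa [H.apply_symm_apply])
    have h5 : H.symm y = y := by
      apply H.injective; rw [H.apply_symm_apply, hHk y hy]
    rw [h5] at h4
    exact hd.le_bot ⟨hy, h4⟩
  have hballs : n.toFun '' (univ ×ˢ ball 0 η) ⊆ n.toFun '' (univ ×ˢ closedBall 0 η) :=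
    image_mono (prod_mono_right ball_subset_closedBall)
  have hrange : n.toFun '' (univ ×ˢ closedBall 0 η) ⊆ range k.toFun := fun y hy => by
    obtain ⟨p, -, hp⟩ := h3 hy
    exact ⟨_, hp⟩
  -- `Ψ` is the straightening followed by the passage from dual coordinates to the tube `k`
  set Ψ : Circle × ℂ → S3 := fun p => k.toFun (dualCoord (Φ p)) with hΨ
  have hΦne : ∀ {p}, 1 ≤ ‖(Φ p).2‖ → (Φ p).2 ≠ 0 := fun {p} hp h => by
    rw [h, norm_zero] at hp; linarith
  have hΨc : ∀ p, 1 ≤ ‖(Φ p).2‖ → ContinuousAt Ψ p := fun p hp =>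
    k.continuous.continuousAt.comp
      (ContinuousAt.comp (g := dualCoord) (continuousAt_dualCoord (hΦne hp))
        hΦ.continuous.continuousAt)
  have hΨinj : ∀ p q, 1 ≤ ‖(Φ p).2‖ → 1 ≤ ‖(Φ q).2‖ → Ψ p = Ψ q → p = q := fun p q hp hq h =>
    hΦ.bijective.1 (dualCoord_injOn (hΦne hp) (hΦne hq) (k.injective h))
  have hΨext : ∀ p, 1 ≤ ‖(Φ p).2‖ → Ψ p ∈ k.exterior := fun p hp h => by
    rw [openSolid, mem_image_iff, mem_ball_zero_iff, norm_dualCoord] at h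
    linarith
  have hΨtor : ∀ p, Ψ p ∈ k.torus ↔ ‖(Φ p).2‖ = 1 := fun p => by
    rw [torus, mem_image_iff, mem_sphere_zero_iff_norm, norm_dualCoord]
  have hext : ∀ y, y ∉ k.openSolid → ∀ q, k.toFun q = y → 1 ≤ ‖q.2‖ := fun y hy q hq => by
    by_contra! h
    exact hy ⟨q, ⟨mem_univ _, by simpa using h⟩, hq⟩
  have hne : ∀ {q : Circle × ℂ}, 1 ≤ ‖q.2‖ → q.2 ≠ 0 := fun {q} hq h => by
    rw [h, norm_zero] at hq; linarith
  have hΦout : ∀ q : Circle × ℂ, 1 ≤ ‖q.2‖ → k.toFun q ∈ A → 1 ≤ ‖(Φ (dualCoord q)).2‖ := by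
    intro q hq hqA
    by_contra! h
    have := ((h1 _).1 h).2
    rw [Function.comp_apply, dualCoord_dualCoord (hne hq)] at this
    exact hqA this
  have hΦin : ∀ v : D2 × Circle, 1 ≤ ‖(Φ (v.2, (v.1 : ℂ))).2‖ ∧
      ‖(Φ (v.2, (v.1 : ℂ))).2‖ ≠ 1 := by
    intro v
    have hlt : ¬ ‖(Φ (v.2, (v.1 : ℂ))).2‖ ≤ 1 := by
      intro h
      obtain ⟨-, h6⟩ := (h2 _).1 h
      refine hnk _ ?_ h6
      rw [Function.comp_apply, closedSolid, mem_image_iff, mem_closedBall_zero_iff, norm_dualCoord]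
      exact mem_closedBall_zero_iff.1 v.1.2
    exact ⟨(not_le.1 hlt).le, (not_le.1 hlt).ne'⟩
  classical
  -- on the old piece: `Ψ` in dual coordinates on the tube `k`, and the identity off it
  set G : S3 → S3 := fun y => if y ∈ range k.toFun then Ψ (dualCoord (k.inv y)) else y with hG
  have hGk : ∀ q, G (k.toFun q) = Ψ (dualCoord q) := fun q => by
    simp only [hG]; rw [if_pos ⟨q, rfl⟩, k.inv_apply]
  have hGn : ∀ y, y ∉ range k.toFun → G y = y := fun y hy => if_neg hy
  have hGext : ∀ y ∈ A \ k.openSolid, G y ∈ k.exterior := by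
    rintro y ⟨hyA, hyk⟩
    by_cases hy : y ∈ range k.toFun
    · obtain ⟨q, rfl⟩ := hy
      rw [hGk]
      exact hΨext _ (hΦout q (hext _ hyk q rfl) hyA)
    · rw [hGn y hy]; exact hyk
  have hGc : ∀ y ∈ A \ k.openSolid, ContinuousAt G y := by
    rintro y ⟨hyA, hyk⟩
    by_cases hy : y ∈ range k.toFun
    · obtain ⟨q, rfl⟩ := hy
      have hq := hext _ hyk q rfl
      have c1 : ContinuousAt k.inv (k.toFun q) :=
        (k.isLocalDiffeomorphAt_inv q).contMDiffAt.continuousAt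
      have c2 : ContinuousAt (fun y => dualCoord (k.inv y)) (k.toFun q) :=
        ContinuousAt.comp (g := dualCoord)
          (by rw [k.inv_apply]; exact continuousAt_dualCoord (hne hq)) c1
      have c3 : ContinuousAt (fun y => Ψ (dualCoord (k.inv y))) (k.toFun q) :=
        ContinuousAt.comp (g := Ψ) (by rw [k.inv_apply]; exact hΨc _ (hΦout q hq hyA)) c2
      refine c3.congr ?_
      filter_upwards [k.isLocalDiffeomorph.isOpen_range.mem_nhds ⟨q, rfl⟩] with z hz
      exact (if_pos hz).symm
    · refine continuousAt_id.congr ?_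
      have hy' : y ∈ (k.toFun '' (univ ×ˢ closedBall 0 (max L 1)))ᶜ := fun ⟨p, _, hp⟩ => hy ⟨p, hp⟩
      filter_upwards [(k.isCompact_image_closedBall (max L 1)).isClosed.isOpen_compl.mem_nhds
        hy'] with z hz
      by_cases hzr : z ∈ range k.toFun
      · obtain ⟨q, rfl⟩ := hzr
        have hq : max L 1 < ‖q.2‖ := by
          by_contra! h
          exact hz ⟨q, ⟨mem_univ _, by simpa using h⟩, rfl⟩
        rw [hGk, hΨ]
        simp only
        rw [hΦ.eq_self _ (by rw [norm_dualCoord]; exact (le_max_left _ _).trans hq.le),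
          dualCoord_dualCoord (hne ((le_max_right _ _).trans hq.le))]
        rfl
      · exact (hGn z hzr).symm
  -- the map on the disjoint union of the two pieces
  set f : ↥(A \ k.openSolid) ⊕ (D2 × Circle) → k.exterior :=
    Sum.elim (fun y => ⟨G y, hGext y y.2⟩)
      (fun v => ⟨Ψ (v.2, (v.1 : ℂ)), hΨext _ (hΦin v).1⟩) with hf
  have hfc : Continuous f := by
    refine Continuous.sumElim (Continuous.subtype_mk ?_ _) (Continuous.subtype_mk ?_ _)
    · rw [continuous_iff_continuousAt]
      intro y
      exact ContinuousAt.comp (g := G) (hGc y y.2) continuousAt_subtype_val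
    · rw [continuous_iff_continuousAt]
      intro v
      exact ContinuousAt.comp (g := Ψ) (f := fun v : D2 × Circle => (v.2, (v.1 : ℂ)))
        (hΨc _ (hΦin v).1) (by fun_prop)
  have hfrel : ∀ a b, k.SurgeryRel A a b → f a = f b := by
    rintro _ _ ⟨z, w, e, v, he, hz, hw⟩
    apply Subtype.ext
    change G e = Ψ (v.2, (v.1 : ℂ))
    rw [he, hGk, dualCoord_coe, hz, hw]
  let F : k.Surgery A → k.exterior := Quot.lift f hfrel
  have hFc : Continuous F := continuous_quot_lift _ hfc
  -- gluing recovers exactly the coincidences of `f` between the two pieces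
  have hglue : ∀ (e : ↥(A \ k.openSolid)) (v : D2 × Circle), f (Sum.inl e) = f (Sum.inr v) →
      k.SurgeryRel A (Sum.inl e) (Sum.inr v) := by
    intro e v h
    have h' : G e = Ψ (v.2, (v.1 : ℂ)) := congrArg Subtype.val h
    by_cases he : (e : S3) ∈ range k.toFun
    · obtain ⟨q, hq⟩ := he
      have hq1 := hext _ e.2.2 q hq
      rw [← hq, hGk] at h'
      have h7 := hΨinj _ _ (hΦout q hq1 (by rw [hq]; exact e.2.1)) (hΦin v).1 h'
      have h8 : q = dualCoord (v.2, (v.1 : ℂ)) := by rw [← h7, dualCoord_dualCoord (hne hq1)]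
      have h9 : ‖(v.1 : ℂ)‖ = 1 := by
        have : ‖q.2‖ = ‖(v.1 : ℂ)‖ := by rw [h8, norm_dualCoord]
        exact le_antisymm (mem_closedBall_zero_iff.1 v.1.2) (by rwa [← this])
      refine surgeryRel_inl_inr.2 ⟨unitDir v.1, v.2, ?_, ?_, rfl⟩
      · rw [← hq, h8, dualCoord, h9, one_smul]
      · have := norm_smul_unitDir (v.1 : ℂ)
        rw [h9, one_smul] at this
        exact this.symm
    · rw [hGn _ he] at h'
      exact absurd ⟨_, h'.symm⟩ he
  have hFb : Function.Bijective F := by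
    constructor
    · rintro ⟨a | v⟩ ⟨b | v'⟩ hab
      · have hab' : G a = G b := congrArg Subtype.val hab
        congr 2
        apply Subtype.ext
        by_cases ha : (a : S3) ∈ range k.toFun <;> by_cases hb : (b : S3) ∈ range k.toFun
        · obtain ⟨q, hq⟩ := ha
          obtain ⟨r, hr⟩ := hb
          have hq1 := hext _ a.2.2 q hq
          have hr1 := hext _ b.2.2 r hr
          rw [← hq, ← hr, hGk, hGk] at hab'
          have := hΨinj _ _ (hΦout q hq1 (by rw [hq]; exact a.2.1))
            (hΦout r hr1 (by rw [hr]; exact b.2.1)) hab'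
          rw [← hq, ← hr, dualCoord_injOn (hne hq1) (hne hr1) this]
        · obtain ⟨q, hq⟩ := ha
          rw [← hq, hGk, hGn _ hb] at hab'
          exact absurd ⟨_, hab'⟩ hb
        · obtain ⟨r, hr⟩ := hb
          rw [← hr, hGk, hGn _ ha] at hab'
          exact absurd ⟨_, hab'.symm⟩ ha
        · rwa [hGn _ ha, hGn _ hb] at hab'
      · exact Quot.sound (hglue a v' hab)
      · exact (Quot.sound (hglue b v hab.symm)).symm
      · have h7 := hΨinj _ _ (hΦin v).1 (hΦin v').1 (congrArg Subtype.val hab)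
        congr 2
        exact Prod.ext (Subtype.ext (congrArg Prod.snd h7)) (congrArg Prod.fst h7)
    · rintro ⟨y, hy⟩
      by_cases hyr : y ∈ range k.toFun
      · obtain ⟨q, rfl⟩ := hyr
        have hq := hext _ hy q rfl
        obtain ⟨p, hp⟩ := hΦ.bijective.2 (dualCoord q)
        have hpΨ : Ψ p = k.toFun q := by
          simp only [hΨ]; rw [hp, dualCoord_dualCoord (hne hq)]
        rcases le_total ‖p.2‖ 1 with hp1 | hp1
        · exact ⟨Quot.mk _ (Sum.inr (⟨p.2, by simpa using hp1⟩, p.1)), Subtype.ext hpΨ⟩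
        · refine ⟨Quot.mk _ (Sum.inl ⟨k.toFun (dualCoord p), ?_, ?_⟩), Subtype.ext ?_⟩
          · intro h
            have := (h1 p).2 ⟨hne hp1, h⟩
            rw [hp, norm_dualCoord] at this
            linarith
          · intro h
            rw [openSolid, mem_image_iff, mem_ball_zero_iff, norm_dualCoord] at h
            linarith
          · change G (k.toFun (dualCoord p)) = k.toFun q
            rw [hGk, dualCoord_dualCoord (hne hp1), hpΨ]
      · exact ⟨Quot.mk _ (Sum.inl ⟨y, fun h => hyr (hrange (hballs h)), hy⟩),
          Subtype.ext (hGn y hyr)⟩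
  have hcomp : IsCompact (A \ k.openSolid) :=
    ((n.isOpen_image_ball η).isClosed_compl.sdiff k.isOpen_openSolid).isCompact
  have : CompactSpace ↥(A \ k.openSolid) := isCompact_iff_compactSpace.1 hcomp
  have : CompactSpace (k.Surgery A) :=
    inferInstanceAs (CompactSpace (Quot (k.SurgeryRel A)))
  let Fh : k.Surgery A ≃ₜ k.exterior :=
    Continuous.homeoOfEquivCompactToT2 (f := Equiv.ofBijective F hFb) hFc
  -- the boundary torus of `n` goes to the boundary torus of `k`
  have hFh : ∀ p, (Fh p : S3) ∈ k.torus ↔ p ∈ k.surgeryImage A B := by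
    have htor : ∀ e : ↥(A \ k.openSolid), G e ∈ k.torus ↔ (e : S3) ∈ B := by
      intro e
      by_cases he : (e : S3) ∈ range k.toFun
      · obtain ⟨q, hq⟩ := he
        have hq1 := hext _ e.2.2 q hq
        rw [← hq, hGk, hΨtor, hB, mem_sdiff]
        have e1 := h1 (dualCoord q)
        have e2 := h2 (dualCoord q)
        rw [Function.comp_apply, dualCoord_dualCoord (hne hq1)] at e1 e2
        have e3 : dualCoord q ∈ {p : Circle × ℂ | p.2 ≠ 0} := dualCoord_ne_zero (hne hq1)
        simp only [e3, true_and] at e1 e2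
        rw [← e1, ← e2, not_lt]
        exact ⟨fun h => ⟨h.le, h.ge⟩, fun h => le_antisymm h.1 h.2⟩
      · rw [hGn _ he]
        exact ⟨fun ⟨p, _, hp⟩ => absurd ⟨p, hp⟩ he, fun h => absurd (hrange h.1) he⟩
    intro p
    constructor
    · obtain ⟨e | v⟩ := p
      · intro h
        exact ⟨e, (htor e).1 h, rfl⟩
      · intro h
        exact absurd ((hΨtor _).1 h) (hΦin v).2
    · rintro ⟨e, he, rfl⟩
      exact (htor e).2 he
  refine ⟨F₁.trans Fh, fun p => ?_⟩
  rw [Homeomorph.trans_apply, hFh, hF₁ _ _ hBt]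

/-- Surgery along a tube `κ`, in the exterior of a meridian of its core, gives the exterior of `κ`:
after contraction, the meridian is a graph in the coordinates dual to a thinner tube. -/
theorem exists_surgery_homeomorph {κ T m : Tube} {x : Circle} (hκ : T.core = κ.core)
    (hm : m.core = T.toFun '' ({x} ×ˢ sphere 0 1))
    (hd : Disjoint κ.closedSolid m.closedSolid) :
    ∃ F : κ.Surgery m.exterior ≃ₜ κ.exterior, ∀ p,
      (F p : S3) ∈ κ.torus ↔ p ∈ κ.surgeryImage m.exterior m.torus := by
  -- the fibre disc of `T` in the coordinates of `κ`
  set g : ℂ → Circle × ℂ := fun w => κ.inv (T.toFun (x, w)) with hg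
  set b : ℂ → ℂ := fun w => (g w).2 with hb
  have hgs : ∀ w, T.toFun (x, w) ∈ range κ.toFun →
      ContMDiffAt 𝓘(ℝ, ℂ) ((𝓡 1).prod 𝓘(ℝ, ℂ)) ∞ g w := by
    rintro w ⟨q, hq⟩
    have l1 := (κ.isLocalDiffeomorphAt_inv q).contMDiffAt
    rw [hq] at l1
    have l2 : ContMDiffAt 𝓘(ℝ, ℂ) ((𝓡 1).prod 𝓘(ℝ, ℂ)) ∞ (fun w : ℂ => (x, w)) w :=
      contMDiffAt_const.prodMk contMDiffAt_id
    have l3 : ContMDiffAt 𝓘(ℝ, ℂ) (𝓡 3) ∞ (fun w : ℂ => T.toFun (x, w)) w :=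
      ((T.isLocalDiffeomorph (x, w)).contMDiffAt).comp w l2
    exact ContMDiffAt.comp (g := κ.inv) (f := fun w : ℂ => T.toFun (x, w)) w l1 l3
  have hTcore : ∀ z, T.toFun (z, 0) ∈ κ.core := fun z => by
    rw [← hκ]; exact ⟨(z, 0), ⟨mem_univ _, rfl⟩, rfl⟩
  have hx0 : T.toFun (x, 0) ∈ range κ.toFun := by
    obtain ⟨q, -, hq⟩ := hTcore x
    exact ⟨q, hq⟩
  have hb0 : b 0 = 0 := by
    obtain ⟨q, ⟨-, hq⟩, hqx⟩ := hTcore x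
    simp only [hb, hg, ← hqx, κ.inv_apply]
    exact hq
  have hbs : ∀ w, T.toFun (x, w) ∈ range κ.toFun → ContDiffAt ℝ ∞ b w := fun w hw =>
    contMDiffAt_iff_contDiffAt.1 (contMDiffAt_snd.comp w (hgs w hw))
  have hcross : CrossesFibre T.toFun κ x 0 :=
    ⟨fun t => Complex.arg x + t, fun _ => 0, 1, 0,
      by simpa using (hasDerivAt_id (0 : ℝ)).const_add (Complex.arg x), hasDerivAt_const _ _,
      one_ne_zero, by simp, rfl, Filter.Eventually.of_forall fun t => hTcore _⟩
  obtain ⟨D, hD, hD'⟩ := hcross.exists_hasStrictFibreDerivAt (T.isLocalDiffeomorph _)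
  have hbD : HasFDerivAt b D 0 := by
    rw [hasFDerivAt_iff_isLittleO_nhds_zero, Asymptotics.isLittleO_iff]
    intro c hc
    have l1 : Filter.Tendsto (fun w : ℂ => ((x, w), (0 : ℂ))) (𝓝 0) (𝓝 ((x, 0), 0)) :=
      (by fun_prop : Continuous fun w : ℂ => ((x, w), (0 : ℂ))).tendsto 0
    filter_upwards [l1.eventually (hD' c hc)] with w hw
    simpa [hb, hg] using hw
  obtain ⟨R₀, hR₀, hstar⟩ := exists_isStarCurve hb0 (hbs 0 hx0) (by rwa [hbD.fderiv])
  obtain ⟨R₁, hR₁, hrange⟩ : ∃ R₁ > 0, ∀ w : ℂ, ‖w‖ < R₁ → T.toFun (x, w) ∈ range κ.toFun := by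
    have hc : Continuous fun w : ℂ => T.toFun (x, w) := T.continuous.comp (by fun_prop)
    obtain ⟨r, hr, hball⟩ := Metric.isOpen_iff.1
      (κ.isLocalDiffeomorph.isOpen_range.preimage hc) 0 hx0
    exact ⟨r, hr, fun w hw => hball (by simpa using hw)⟩
  set R := min (min R₀ R₁) 1 / 2 with hRdef
  have hR : 0 < R := by positivity
  have hRm : R < min (min R₀ R₁) 1 := half_lt_self (by positivity)
  have hRR₀ : R < R₀ := hRm.trans_le ((min_le_left _ _).trans (min_le_left _ _))
  have hRR₁ : R < R₁ := hRm.trans_le ((min_le_left _ _).trans (min_le_right _ _))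
  have hR1 : R < 1 := hRm.trans_le (min_le_right _ _)
  have hbR := hstar R hR hRR₀
  -- make `κ` so thin that it lies well inside the contracted meridian
  obtain ⟨r, hr, hκT⟩ := exists_ball_of_isOpen ((T.isOpen_image_ball (R / 4)).preimage κ.continuous)
    (fun z => by
      have : κ.toFun (z, 0) ∈ T.core := by rw [hκ]; exact ⟨(z, 0), ⟨mem_univ _, rfl⟩, rfl⟩
      obtain ⟨q, ⟨-, hq⟩, hqz⟩ := this
      obtain hq : q.2 = 0 := hq
      exact ⟨q, ⟨mem_univ _, by rw [hq]; exact mem_ball_self (by positivity)⟩, hqz⟩)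
  set ε := min r 1 / 2 with hε
  have hε0 : 0 < ε := by positivity
  have hεm : ε < min r 1 := half_lt_self (by positivity)
  obtain ⟨H₁, hH₁κ, hH₁m, hH₁, hH₁'⟩ := κ.exists_homeomorph_shrink hε0
    (hεm.trans_le (min_le_right _ _)) m.isClosed_closedSolid hd.symm
  set k := κ.shrink ε hε0 with hk
  rw [← openSolid_shrink hε0, ← hk] at hH₁
  rw [← closedSolid_shrink hε0, ← hk] at hH₁'
  obtain ⟨F₁, hF₁⟩ := exists_surgery_congr (A := m.exterior) (A' := m.exterior) H₁ hH₁κ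
    fun y => not_congr (homeomorph_mem_iff_of_fixes hH₁m openSolid_subset_closedSolid y)
  have hkm : Disjoint k.closedSolid m.closedSolid := by
    refine hd.mono_left ?_
    rw [hk, closedSolid_shrink]
    exact image_mono (prod_mono_right
      (closedBall_subset_closedBall (hεm.trans_le (min_le_right _ _)).le))
  have hkT : k.closedSolid ⊆ T.toFun '' (univ ×ˢ closedBall 0 (R / 4)) := by
    rw [hk, closedSolid_shrink]
    rintro _ ⟨p, ⟨-, hp⟩, rfl⟩
    rw [mem_closedBall_zero_iff] at hp
    exact image_mono (prod_mono_right ball_subset_closedBall)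
      (hκT p (hp.trans_lt (hεm.trans_le (min_le_left _ _))))
  obtain ⟨n, hn, H₂, hH₂, hH₂', hH₂k⟩ := exists_contract_meridian hm hR hR1
    k.isClosed_closedSolid hkT hkm
  obtain ⟨F₂, hF₂⟩ := exists_surgery_congr (k := k) (k' := k) (A := m.exterior) (A' := n.exterior)
    H₂ (fun p hp => hH₂k _ ⟨p, ⟨mem_univ _, by simpa using hp⟩, rfl⟩) fun y => not_congr (hH₂ y)
  have hkn : Disjoint k.closedSolid n.closedSolid := by
    rw [disjoint_left] at hkm ⊢
    intro y hy hyn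
    rw [← hH₂k y hy, hH₂'] at hyn
    exact hkm hy hyn
  have hgR : ∀ w, ‖w‖ = R → T.toFun (x, w) ∈ range κ.toFun := fun w hw =>
    hrange w (by rwa [hw])
  -- `(b / ‖b‖, β)` are the dual coordinates of the fibre disc in the thin tube `k`
  set β : ℂ → ℂ := fun w => (ε⁻¹ * ‖b w‖) • ((g w).1 : ℂ) with hβ
  have hβd : ∀ w, ‖w‖ = R → DifferentiableAt ℝ β w := fun w hw => by
    have l1 : ContDiffAt ℝ ∞ (fun w => ((g w).1 : ℂ)) w :=
      contMDiffAt_iff_contDiffAt.1 (ContMDiffAt.comp (I' := 𝓡 1) (g := fun z : Circle => (z : ℂ))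
        (f := fun w => (g w).1) w contMDiff_coe_circle.contMDiffAt
        (contMDiffAt_fst.comp w (hgs w (hgR w hw))))
    exact (((hbR.differentiableAt w hw).norm ℝ (hbR.ne_zero w hw)).const_mul ε⁻¹).smul
      (l1.differentiableAt (by simp))
  have hβpos : ∀ w, ‖w‖ = R → 0 < ε⁻¹ * ‖b w‖ := fun w hw =>
    mul_pos (inv_pos.2 hε0) (norm_pos_iff.2 (hbR.ne_zero w hw))
  obtain ⟨s, hs, hsw, hsn, hsn', hsT⟩ := hbR.exists_graph hR hβd (E := k.toFun ∘ dualCoord) hn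
    (fun w hw => by
      have l1 : dualCoord (unitDir (b w), β w) = ((g w).1, ε⁻¹ • b w) := by
        ext1
        · simp only [dualCoord, hβ]
          rw [unitDir_smul (hβpos w hw), unitDir_coe]
        · simp only [dualCoord, hβ]
          rw [norm_smul, Circle.norm_coe, mul_one, Real.norm_of_nonneg (hβpos w hw).le, mul_smul,
            norm_smul_unitDir]
      rw [Function.comp_apply, l1]
      change κ.toFun ((g w).1, ε • ε⁻¹ • b w) = _
      rw [smul_inv_smul₀ hε0.ne']
      exact κ.apply_inv (hgR w hw))
  obtain ⟨F₃, hF₃⟩ := exists_surgery_homeomorph_of_graph hs (fun e => by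
      obtain ⟨w, hw, -, hse⟩ := hsw e
      rw [hse, ← norm_ne_zero_iff, hβ]
      simp only
      rw [norm_smul, Circle.norm_coe, mul_one, Real.norm_of_nonneg (hβpos w hw).le]
      exact (hβpos w hw).ne') hsn hsn' hsT hkn
  have hsymm : ∀ y, H₁.symm y ∈ κ.openSolid ↔ y ∈ k.openSolid := fun y => by
    rw [← hH₁, H₁.apply_symm_apply]
  refine ⟨F₁.trans (F₂.trans (F₃.trans (exteriorHomeomorph H₁.symm hsymm))), fun p => ?_⟩
  have h4 : ∀ q : k.exterior, (exteriorHomeomorph H₁.symm hsymm q : S3) ∈ κ.torus ↔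
      (q : S3) ∈ k.torus := fun q =>
    mem_torus_iff_of_solids hsymm (fun y => by rw [← hH₁', H₁.apply_symm_apply]) q
  rw [Homeomorph.trans_apply, Homeomorph.trans_apply, Homeomorph.trans_apply, h4, hF₃,
    hF₂ _ _ (mem_torus_iff_of_solids hH₂ hH₂'),
    hF₁ _ _ (homeomorph_mem_iff_of_fixes hH₁m (by rw [torus_eq]; exact sdiff_subset))]

end Tube

/-! ### Knot exteriors are manifolds with boundary -/

/-- A chart of an ambient space that carries a subset `X` to the half space `0 ≤ x 0` restricts to
a half-space chart of `X`. -/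
def halfSpaceChart {M : Type*} [TopologicalSpace M]
    (c : OpenPartialHomeomorph M (EuclideanSpace ℝ (Fin 3))) (X : Set M) (x₀ : X)
    (hX : ∀ y ∈ c.source, y ∈ X ↔ 0 ≤ c y 0) : OpenPartialHomeomorph X (EuclideanHalfSpace 3) where
  toFun p := (𝓡∂ 3).symm (c p)
  invFun u := by
    classical
    exact if h : c.symm u.1 ∈ X then ⟨c.symm u.1, h⟩ else x₀
  source := Subtype.val ⁻¹' c.source
  target := Subtype.val ⁻¹' c.target
  map_source' p hp := by
    have h := (𝓡∂ 3).right_inv (x := c p)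
      (by rw [range_modelWithCornersEuclideanHalfSpace]; exact (hX p hp).1 p.2)
    change (𝓡∂ 3) ((𝓡∂ 3).symm (c p)) ∈ c.target
    rw [h]
    exact c.map_source hp
  map_target' u hu := by
    have h : c.symm u.1 ∈ X :=
      (hX _ (c.map_target hu)).2 (by rw [c.right_inv hu]; exact u.2)
    simp only [dif_pos h]
    exact c.map_target hu
  left_inv' p hp := by
    have h := (𝓡∂ 3).right_inv (x := c p)
      (by rw [range_modelWithCornersEuclideanHalfSpace]; exact (hX p hp).1 p.2)
    have h' : c.symm ((𝓡∂ 3).symm (c p)).1 = p := by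
      change c.symm ((𝓡∂ 3) ((𝓡∂ 3).symm (c p))) = _
      rw [h, c.left_inv hp]
    have h'' : c.symm ((𝓡∂ 3).symm (c p)).1 ∈ X := by rw [h']; exact p.2
    simp only [dif_pos h'']
    exact Subtype.ext h'
  right_inv' u hu := by
    have h : c.symm u.1 ∈ X :=
      (hX _ (c.map_target hu)).2 (by rw [c.right_inv hu]; exact u.2)
    simp only [dif_pos h, c.right_inv hu]
    exact (𝓡∂ 3).left_inv u
  open_source := c.open_source.preimage continuous_subtype_val
  open_target := c.open_target.preimage continuous_subtype_val
  continuousOn_toFun := (𝓡∂ 3).continuous_symm.comp_continuousOn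
    (c.continuousOn.comp continuous_subtype_val.continuousOn fun _ h => h)
  continuousOn_invFun := by
    rw [IsInducing.subtypeVal.continuousOn_iff]
    refine (c.continuousOn_symm.comp continuous_subtype_val.continuousOn fun _ h => h).congr ?_
    intro u hu
    have h : c.symm u.1 ∈ X :=
      (hX _ (c.map_target hu)).2 (by rw [c.right_inv hu]; exact u.2)
    simp only [Function.comp_apply, dif_pos h]

theorem halfSpaceChart_apply {M : Type*} [TopologicalSpace M]
    {c : OpenPartialHomeomorph M (EuclideanSpace ℝ (Fin 3))} {X : Set M} {x₀ : X}
    {hX : ∀ y ∈ c.source, y ∈ X ↔ 0 ≤ c y 0} {p : X} (hp : (p : M) ∈ c.source) :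
    (halfSpaceChart c X x₀ hX p).1 = c p :=
  (𝓡∂ 3).right_inv (x := c p)
    (by rw [range_modelWithCornersEuclideanHalfSpace]; exact (hX p hp).1 p.2)

/-- Being a 3-manifold with boundary `B` is a pointwise condition: around each point there is one
half-space chart, which detects whether that point lies in `B`. -/
theorem isThreeManifoldWithBoundary_iff {X : Type} [TopologicalSpace X] {B : Set X} :
    IsThreeManifoldWithBoundary X B ↔ T2Space X ∧ SecondCountableTopology X ∧
      ∀ p : X, ∃ c : OpenPartialHomeomorph X (EuclideanHalfSpace 3),
        p ∈ c.source ∧ ((c p).1 0 = 0 ↔ p ∈ B) := by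
  refine and_congr_right fun _ => and_congr_right fun _ => ⟨?_, fun h => ?_⟩
  · rintro ⟨_, rfl⟩ p
    refine ⟨chartAt _ p, mem_chart_source _ p, ?_⟩
    change _ ↔ _ ∈ frontier _
    rw [frontier_range_modelWithCornersEuclideanHalfSpace]
    exact eq_comm
  · choose c hc hcB using h
    refine ⟨⟨range c, c, hc, fun x => ⟨x, rfl⟩⟩, ?_⟩
    ext p
    rw [← hcB p]
    change _ ∈ frontier _ ↔ _
    rw [frontier_range_modelWithCornersEuclideanHalfSpace]
    exact eq_comm

theorem IsThreeManifoldWithBoundary.of_homeomorph {X Y : Type} [TopologicalSpace X]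
    [TopologicalSpace Y] {A : Set X} {B : Set Y} (h : IsThreeManifoldWithBoundary Y B)
    (F : X ≃ₜ Y) (hF : ∀ p, F p ∈ B ↔ p ∈ A) : IsThreeManifoldWithBoundary X A := by
  rw [isThreeManifoldWithBoundary_iff] at h ⊢
  obtain ⟨_, _, h⟩ := h
  refine ⟨F.isEmbedding.t2Space, F.isEmbedding.secondCountableTopology, fun p => ?_⟩
  obtain ⟨c, hc, hcB⟩ := h (F p)
  exact ⟨F.toOpenPartialHomeomorph.trans c, by simpa using hc, hcB.trans (hF p)⟩

/-- Coordinates on the product of a line and a plane, the real part of the plane first. -/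
def lineProdPlane : EuclideanSpace ℝ (Fin 1) × ℂ ≃ₜ EuclideanSpace ℝ (Fin 3) where
  toFun v := !₂[v.2.re, v.2.im, v.1 0]
  invFun x := (!₂[x 2], ⟨x 0, x 1⟩)
  left_inv v := by
    refine Prod.ext ?_ rfl
    ext i
    fin_cases i
    rfl
  right_inv x := by
    ext i
    fin_cases i <;> rfl
  continuous_toFun := by
    refine (PiLp.continuous_toLp 2 _).comp (continuous_pi fun i => ?_)
    fin_cases i
    · exact Complex.continuous_re.comp continuous_snd
    · exact Complex.continuous_im.comp continuous_snd
    · change Continuous fun v : EuclideanSpace ℝ (Fin 1) × ℂ => v.1 0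
      fun_prop
  continuous_invFun := by
    refine Continuous.prodMk ((PiLp.continuous_toLp 2 _).comp (continuous_pi fun i => ?_)) ?_
    · fin_cases i
      change Continuous fun x : EuclideanSpace ℝ (Fin 3) => x 2
      fun_prop
    · have : (fun x : EuclideanSpace ℝ (Fin 3) => (⟨x 0, x 1⟩ : ℂ)) =
          fun x => (x 0 : ℂ) + x 1 * Complex.I := by
        funext x
        exact Complex.mk_eq_add_mul_I _ _
      rw [this]
      fun_prop

/-- Near a point of the boundary torus, `log ‖w‖` is the first coordinate of a chart of the
ambient sphere. -/
theorem Tube.exists_chart_of_mem_torus (ν : Tube) {p : S3} (hp : p ∈ ν.torus) :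
    ∃ c : OpenPartialHomeomorph S3 (EuclideanSpace ℝ (Fin 3)), p ∈ c.source ∧ c p 0 = 0 ∧
      ∀ y ∈ c.source, y ∈ ν.exterior ↔ 0 ≤ c y 0 := by
  obtain ⟨⟨z, w⟩, ⟨-, hw⟩, rfl⟩ := hp
  have hw1 : ‖w‖ = 1 := mem_sphere_zero_iff_norm.1 hw
  have hw0 : w ≠ 0 := by rintro rfl; simp at hw1
  let cν := (ν.isOpenEmbedding.toOpenPartialHomeomorph ν.toFun).symm
  let l : OpenPartialHomeomorph ℂ ℂ :=
    (Homeomorph.mulLeft₀ w⁻¹ (inv_ne_zero hw0)).toOpenPartialHomeomorph.trans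
      Complex.expOpenPartialHomeomorph.symm
  let c := (cν.trans ((chartAt (EuclideanSpace ℝ (Fin 1)) z).prod l)).trans
    lineProdPlane.toOpenPartialHomeomorph
  have hc0 : ∀ q : Circle × ℂ, c (ν.toFun q) 0 = Real.log ‖q.2‖ := by
    intro q
    have h1 : cν (ν.toFun q) = q :=
      (ν.isOpenEmbedding.toOpenPartialHomeomorph ν.toFun).left_inv (mem_univ q)
    change (Complex.log (w⁻¹ * (cν (ν.toFun q)).2)).re = _
    rw [h1, Complex.log_re, norm_mul, norm_inv, hw1, inv_one, one_mul]
  have hcs : ∀ q : Circle × ℂ, ν.toFun q ∈ c.source ↔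
      q.1 ∈ (chartAt (EuclideanSpace ℝ (Fin 1)) z).source ∧ w⁻¹ * q.2 ∈ Complex.slitPlane := by
    intro q
    have h1 : cν (ν.toFun q) = q :=
      (ν.isOpenEmbedding.toOpenPartialHomeomorph ν.toFun).left_inv (mem_univ q)
    have h2 : ν.toFun q ∈ cν.source := by
      change ν.toFun q ∈ ν.toFun '' univ
      exact ⟨q, mem_univ q, rfl⟩
    simp [c, l, h1, h2, Complex.expOpenPartialHomeomorph]
  refine ⟨c, (hcs _).2 ⟨mem_chart_source _ z, by simp [hw0]⟩, by rw [hc0, hw1, Real.log_one],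
    fun y hy => ?_⟩
  have hyr : y ∈ ν.toFun '' univ := hy.1.1
  obtain ⟨q, -, rfl⟩ := hyr
  have hq0 : q.2 ≠ 0 := by
    rintro h
    have := ((hcs q).1 hy).2
    simp [h] at this
  rw [hc0, Real.log_nonneg_iff (norm_pos_iff.2 hq0), ← not_lt, exterior, mem_compl_iff, openSolid,
    Tube.mem_image_iff, mem_ball_zero_iff]

theorem Tube.isThreeManifoldWithBoundary_exterior (ν : Tube) :
    IsThreeManifoldWithBoundary ν.exterior {p | (p : S3) ∈ ν.torus} := by
  rw [isThreeManifoldWithBoundary_iff]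
  refine ⟨inferInstance, inferInstance, fun p => ?_⟩
  suffices h : ∃ c : OpenPartialHomeomorph S3 (EuclideanSpace ℝ (Fin 3)),
      (p : S3) ∈ c.source ∧ (c p 0 = 0 ↔ (p : S3) ∈ ν.torus) ∧
      ∀ y ∈ c.source, y ∈ ν.exterior ↔ 0 ≤ c y 0 by
    obtain ⟨c, hpc, hc0, hc⟩ := h
    exact ⟨halfSpaceChart c _ p hc, hpc, by rw [halfSpaceChart_apply hpc]; exact hc0⟩
  by_cases hp : (p : S3) ∈ ν.torus
  · obtain ⟨c, h1, h2, h3⟩ := ν.exists_chart_of_mem_torus hp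
    exact ⟨c, h1, by simp [h2, hp], h3⟩
  · have hpc : (p : S3) ∉ ν.closedSolid := fun h => hp (by rw [ν.torus_eq]; exact ⟨h, p.2⟩)
    let c₀ := chartAt (EuclideanSpace ℝ (Fin 3)) (p : S3)
    let t : EuclideanSpace ℝ (Fin 3) := EuclideanSpace.single 0 1 - c₀ p
    have hopen : IsOpen {v : EuclideanSpace ℝ (Fin 3) | 0 < v 0} :=
      isOpen_lt continuous_const (by fun_prop)
    let c := ((c₀.restrOpen _ ν.isClosed_closedSolid.isOpen_compl).trans
      (Homeomorph.addRight t).toOpenPartialHomeomorph).trans (OpenPartialHomeomorph.ofSet _ hopen)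
    have hcp : c p 0 = 1 := by
      change (c₀ p + t) 0 = 1
      simp [t]
    have hpos : ∀ y ∈ c.source, 0 < c y 0 := fun y hy => hy.2
    have hout : ∀ y ∈ c.source, y ∉ ν.closedSolid := fun y hy => hy.1.1.2
    refine ⟨c, ⟨⟨⟨mem_chart_source _ _, hpc⟩, mem_univ _⟩, ?_⟩, ?_, fun y hy => ?_⟩
    · change 0 < (c₀ p + t) 0
      simp [t]
    · simp [hcp, hp]
    · exact iff_of_true (fun h => hout y hy (ν.openSolid_subset_closedSolid h)) (hpos y hy).le

theorem Tube.nonempty_torus_homeomorph (ν : Tube) :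
    Nonempty ({p : ν.exterior | (p : S3) ∈ ν.torus} ≃ₜ Circle × Circle) := by
  have hmem : ∀ q : Circle × Circle, ν.toFun (q.1, (q.2 : ℂ)) ∈ ν.torus := fun q =>
    ⟨_, ⟨mem_univ _, mem_sphere_zero_iff_norm.2 (Circle.norm_coe _)⟩, rfl⟩
  have hext : ∀ y ∈ ν.torus, y ∈ ν.exterior := fun y hy => by
    rw [ν.torus_eq] at hy
    exact hy.2
  let f : Circle × Circle → {p : ν.exterior | (p : S3) ∈ ν.torus} :=
    fun q => ⟨⟨ν.toFun (q.1, (q.2 : ℂ)), hext _ (hmem q)⟩, hmem q⟩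
  have hf : Continuous f := by
    refine Continuous.subtype_mk (Continuous.subtype_mk (ν.continuous.comp ?_) _) _
    fun_prop
  have hb : Function.Bijective f := by
    constructor
    · intro q q' h
      have h1 : ν.toFun (q.1, (q.2 : ℂ)) = ν.toFun (q'.1, (q'.2 : ℂ)) :=
        congrArg (fun r : {p : ν.exterior | (p : S3) ∈ ν.torus} => (r.1 : S3)) h
      have h2 := ν.injective h1
      exact Prod.ext (Prod.mk.inj h2).1 (Circle.ext (Prod.mk.inj h2).2)
    · rintro ⟨⟨y, hy⟩, ⟨z, w⟩, ⟨-, hw⟩, h⟩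
      exact ⟨(z, ⟨w, hw⟩), Subtype.ext (Subtype.ext h)⟩
  exact ⟨(Continuous.homeoOfEquivCompactToT2 (f := Equiv.ofBijective f hb) hf).symm⟩

/-! ### The exterior of a meridian is a solid torus -/

/-- An orthogonal splitting `ℝ⁴ = ℂ ⊕ ℂ`: the two coordinate projections and the inverse
isomorphism. -/
structure ComplexSplitting where
  fst : EuclideanSpace ℝ (Fin 4) →L[ℝ] ℂ
  snd : EuclideanSpace ℝ (Fin 4) →L[ℝ] ℂ
  pair : ℂ × ℂ →L[ℝ] EuclideanSpace ℝ (Fin 4)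
  fst_pair : ∀ p, fst (pair p) = p.1
  snd_pair : ∀ p, snd (pair p) = p.2
  pair_fst_snd : ∀ y, pair (fst y, snd y) = y
  norm_sq : ∀ y, ‖y‖ ^ 2 = ‖fst y‖ ^ 2 + ‖snd y‖ ^ 2

/-- Every 2-plane of `ℝ⁴` is the first factor of an orthogonal splitting. -/
theorem exists_complexSplitting {U : Submodule ℝ (EuclideanSpace ℝ (Fin 4))}
    (hU : Module.finrank ℝ U = 2) :
    ∃ Q : ComplexSplitting, (∀ y ∈ U, Q.snd y = 0) ∧ ∀ y ∈ Uᗮ, Q.fst y = 0 := by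
  have hU' : Module.finrank ℝ Uᗮ = 2 := by
    have := U.finrank_add_finrank_orthogonal
    rw [hU, finrank_euclideanSpace_fin] at this
    omega
  let i : U ≃ₗᵢ[ℝ] ℂ :=
    (stdOrthonormalBasis ℝ U).equiv Complex.orthonormalBasisOneI (finCongr hU)
  let i' : Uᗮ ≃ₗᵢ[ℝ] ℂ :=
    (stdOrthonormalBasis ℝ Uᗮ).equiv Complex.orthonormalBasisOneI (finCongr hU')
  have h0 : ∀ y ∈ U, Uᗮ.orthogonalProjectionOnto y = 0 := fun y hy =>
    Submodule.orthogonalProjectionOnto_eq_zero_iff.2 (U.le_orthogonal_orthogonal hy)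
  have h0' : ∀ y ∈ Uᗮ, U.orthogonalProjectionOnto y = 0 := fun y hy =>
    Submodule.orthogonalProjectionOnto_eq_zero_iff.2 hy
  refine ⟨{
    fst := (i : U ≃L[ℝ] ℂ).toContinuousLinearMap ∘L U.orthogonalProjectionOnto
    snd := (i' : Uᗮ ≃L[ℝ] ℂ).toContinuousLinearMap ∘L Uᗮ.orthogonalProjectionOnto
    pair := (U.subtypeL ∘L (i.symm : ℂ ≃L[ℝ] U).toContinuousLinearMap).coprod
      (Uᗮ.subtypeL ∘L (i'.symm : ℂ ≃L[ℝ] Uᗮ).toContinuousLinearMap)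
    fst_pair := ?_
    snd_pair := ?_
    pair_fst_snd := ?_
    norm_sq := ?_ }, ?_, ?_⟩
  · rintro ⟨a, b⟩
    simp [h0' _ (i'.symm b).2]
  · rintro ⟨a, b⟩
    simp [h0 _ (i.symm a).2]
  · intro y
    simp
  · intro y
    simp [Submodule.norm_sq_eq_add_norm_sq_projection y U]
  · intro y hy
    simp [h0 y hy]
  · intro y hy
    simp [h0' y hy]

namespace ComplexSplitting

variable (Q : ComplexSplitting)

theorem norm_pair_sq (p : ℂ × ℂ) : ‖Q.pair p‖ ^ 2 = ‖p.1‖ ^ 2 + ‖p.2‖ ^ 2 := by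
  rw [Q.norm_sq, Q.fst_pair, Q.snd_pair]

/-- The vector of `ℝ⁴` that the standard tube assigns to `(z, v)`. -/
def tubeVec (p : Circle × ℂ) : EuclideanSpace ℝ (Fin 4) :=
  (Real.sqrt (1 + ‖p.2‖ ^ 2))⁻¹ • Q.pair ((p.1 : ℂ), p.2)

theorem norm_tubeVec (p : Circle × ℂ) : ‖Q.tubeVec p‖ = 1 := by
  have h : ‖Q.pair ((p.1 : ℂ), p.2)‖ = Real.sqrt (1 + ‖p.2‖ ^ 2) := by
    rw [← Real.sqrt_sq (norm_nonneg (Q.pair ((p.1 : ℂ), p.2))), norm_pair_sq, Circle.norm_coe, one_pow]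
  have h' : 0 < Real.sqrt (1 + ‖p.2‖ ^ 2) := by positivity
  rw [tubeVec, norm_smul, h, norm_inv, Real.norm_of_nonneg h'.le, inv_mul_cancel₀ h'.ne']

theorem contMDiff_tubeVec :
    ContMDiff ((𝓡 1).prod 𝓘(ℝ, ℂ)) 𝓘(ℝ, EuclideanSpace ℝ (Fin 4)) ∞ Q.tubeVec := by
  have h0 : ContMDiff ((𝓡 1).prod 𝓘(ℝ, ℂ)) 𝓘(ℝ, ℂ) ∞ (fun p : Circle × ℂ => (p.1 : ℂ)) :=
    contMDiff_coe_circle.comp contMDiff_fst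
  have h1 : ContMDiff ((𝓡 1).prod 𝓘(ℝ, ℂ)) 𝓘(ℝ, ℂ × ℂ) ∞
      (fun p : Circle × ℂ => ((p.1 : ℂ), p.2)) :=
    h0.prodMk_space contMDiff_snd
  have h2 : ContDiff ℝ ∞ fun v : ℂ => (Real.sqrt (1 + ‖v‖ ^ 2))⁻¹ :=
    ((contDiff_const.add (contDiff_norm_sq ℝ)).sqrt fun v => by positivity).inv fun v => by
      positivity
  have h3 : ContDiff ℝ ∞ fun q : ℂ × ℂ => (Real.sqrt (1 + ‖q.2‖ ^ 2))⁻¹ • Q.pair q :=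
    (h2.comp contDiff_snd).smul Q.pair.contDiff
  exact ContMDiff.comp (g := fun q : ℂ × ℂ => (Real.sqrt (1 + ‖q.2‖ ^ 2))⁻¹ • Q.pair q)
    (f := fun p : Circle × ℂ => ((p.1 : ℂ), p.2)) h3.contMDiff h1

/-- Inverse of the standard tube, on the set where the first coordinate does not vanish. -/
def tubeInv (y : S3) : Circle × ℂ := (unitDir (Q.fst y), ‖Q.fst y‖⁻¹ • Q.snd y)

theorem fst_tubeVec (p : Circle × ℂ) :
    Q.fst (Q.tubeVec p) = (Real.sqrt (1 + ‖p.2‖ ^ 2))⁻¹ • (p.1 : ℂ) := by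
  rw [tubeVec, map_smul, Q.fst_pair]

theorem snd_tubeVec (p : Circle × ℂ) :
    Q.snd (Q.tubeVec p) = (Real.sqrt (1 + ‖p.2‖ ^ 2))⁻¹ • p.2 := by
  rw [tubeVec, map_smul, Q.snd_pair]

theorem fst_tubeVec_ne_zero (p : Circle × ℂ) : Q.fst (Q.tubeVec p) ≠ 0 := by
  rw [fst_tubeVec]
  exact smul_ne_zero (by positivity) (Circle.coe_ne_zero _)

theorem tubeVec_tubeInv {y : S3} (hy : Q.fst y ≠ 0) : Q.tubeVec (Q.tubeInv y) = y := by
  have hpos : 0 < ‖Q.fst y‖ := norm_pos_iff.2 hy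
  have h1 : ‖Q.fst y‖ ^ 2 + ‖Q.snd y‖ ^ 2 = 1 := by
    rw [← Q.norm_sq, norm_eq_of_mem_sphere, one_pow]
  have h2 : Real.sqrt (1 + ‖‖Q.fst y‖⁻¹ • Q.snd y‖ ^ 2) = ‖Q.fst y‖⁻¹ := by
    rw [Real.sqrt_eq_iff_eq_sq (by positivity) (by positivity), norm_smul, norm_inv, norm_norm]
    field_simp
    linarith
  rw [tubeVec, tubeInv]
  dsimp only
  rw [h2, inv_inv, ← map_smul, Prod.smul_mk, norm_smul_unitDir, smul_inv_smul₀ hpos.ne',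
    Q.pair_fst_snd]

theorem contMDiffAt_tubeInv {y : S3} (hy : Q.fst y ≠ 0) :
    ContMDiffAt (𝓡 3) ((𝓡 1).prod 𝓘(ℝ, ℂ)) ∞ Q.tubeInv y := by
  have h1 : ContMDiffAt (𝓡 3) 𝓘(ℝ, EuclideanSpace ℝ (Fin 4)) ∞ (Subtype.val : S3 → _) y :=
    contMDiff_coe_sphere.contMDiffAt
  have h2 : ContMDiffAt (𝓡 3) 𝓘(ℝ, ℂ) ∞ (fun y : S3 => Q.fst y) y :=
    Q.fst.contDiff.contMDiff.contMDiffAt.comp y h1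
  have h3 : ContDiffAt ℝ ∞ (fun v : EuclideanSpace ℝ (Fin 4) => ‖Q.fst v‖⁻¹ • Q.snd v) y :=
    ((Q.fst.contDiff.contDiffAt.norm ℝ hy).inv (norm_ne_zero_iff.2 hy)).smul
      Q.snd.contDiff.contDiffAt
  refine ContMDiffAt.prodMk ?_ ?_
  · exact ContMDiffAt.comp (I' := 𝓘(ℝ, ℂ)) (g := unitDir) (f := fun y : S3 => Q.fst y) y
      (contMDiffAt_unitDir hy) h2
  · exact h3.contMDiffAt.comp y h1

/-- The map `(z, v) ↦ (z, v) / √(1 + ‖v‖²)` into the sphere. -/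
def tubeMap (p : Circle × ℂ) : S3 :=
  ⟨Q.tubeVec p, mem_sphere_zero_iff_norm.2 (Q.norm_tubeVec p)⟩

theorem tubeInv_tubeMap (p : Circle × ℂ) : Q.tubeInv (Q.tubeMap p) = p := by
  have hs : 0 < (Real.sqrt (1 + ‖p.2‖ ^ 2))⁻¹ := by positivity
  refine Prod.ext ?_ ?_
  · change unitDir (Q.fst (Q.tubeVec p)) = p.1
    rw [fst_tubeVec, unitDir_smul hs, unitDir_coe]
  · change ‖Q.fst (Q.tubeVec p)‖⁻¹ • Q.snd (Q.tubeVec p) = p.2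
    rw [fst_tubeVec, snd_tubeVec, norm_smul, Circle.norm_coe, mul_one, Real.norm_of_nonneg hs.le,
      inv_smul_smul₀ hs.ne']

theorem tubeMap_tubeInv {y : S3} (hy : Q.fst y ≠ 0) : Q.tubeMap (Q.tubeInv y) = y :=
  Subtype.ext (Q.tubeVec_tubeInv hy)

/-- The standard tube around the unit circle of the first factor. Its closed unit tube is the half
`‖snd‖ ≤ ‖fst‖` of the sphere. -/
def tube : Tube where
  toFun := Q.tubeMap
  injective := Function.LeftInverse.injective Q.tubeInv_tubeMap
  isLocalDiffeomorph p := by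
    refine ⟨⟨⟨Q.tubeMap, Q.tubeInv,
      univ, {y | Q.fst y ≠ 0}, fun p _ => Q.fst_tubeVec_ne_zero p, fun _ _ => mem_univ _,
      fun p _ => Q.tubeInv_tubeMap p, fun y hy => Q.tubeMap_tubeInv hy⟩, isOpen_univ, ?_, ?_,
      fun y hy => (Q.contMDiffAt_tubeInv hy).contMDiffWithinAt⟩, mem_univ _, fun _ _ => rfl⟩
    · exact isOpen_ne_fun (by fun_prop) continuous_const
    · exact (Q.contMDiff_tubeVec.codRestrict_sphere
        (fun p => mem_sphere_zero_iff_norm.2 (Q.norm_tubeVec p))).contMDiffOn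

end ComplexSplitting

theorem Tube.contDiff_fibre (T : Tube) (x : Circle) :
    ContDiff ℝ ∞ fun w : ℂ => (T.toFun (x, w) : EuclideanSpace ℝ (Fin 4)) := by
  rw [← contMDiff_iff_contDiff]
  exact contMDiff_coe_sphere.comp (T.isLocalDiffeomorph.contMDiff.comp
    (contMDiff_const.prodMk contMDiff_id))

theorem Tube.injective_fderiv_fibre (T : Tube) (x : Circle) (w : ℂ) :
    Function.Injective
      (fderiv ℝ (fun w : ℂ => (T.toFun (x, w) : EuclideanSpace ℝ (Fin 4))) w) := by
  have h1 : HasMFDerivAt 𝓘(ℝ, ℂ) ((𝓡 1).prod 𝓘(ℝ, ℂ)) (fun w : ℂ => (x, w)) w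
      (ContinuousLinearMap.prod 0 (ContinuousLinearMap.id ℝ ℂ)) :=
    (hasMFDerivAt_const x w).prodMk (hasMFDerivAt_id w)
  have hT := T.isLocalDiffeomorph (x, w)
  have h2 := (hT.mdifferentiableAt (by simp)).hasMFDerivAt
  have h3 := ((contMDiff_coe_sphere (n := 3) (m := ∞) (E := EuclideanSpace ℝ (Fin 4))).contMDiffAt
    (x := T.toFun (x, w))).mdifferentiableAt (by simp) |>.hasMFDerivAt
  have h4 := (h3.comp w (h2.comp w h1)).mfderiv
  have hcoe : Function.Injective (mfderiv (𝓡 3) 𝓘(ℝ, EuclideanSpace ℝ (Fin 4))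
      (Subtype.val : S3 → _) (T.toFun (x, w))) :=
    .of_comp (f := NormedSpace.fromTangentSpace _)
      (injective_mvfderiv_subtypeVal_sphere (T.toFun (x, w)))
  have h5 : Function.Injective (mfderiv ((𝓡 1).prod 𝓘(ℝ, ℂ)) (𝓡 3) T.toFun (x, w)) :=
    (hT.mfderivToContinuousLinearEquiv (by simp)).injective
  intro u v huv
  rw [← mfderiv_eq_fderiv] at huv
  have h6 : ((0, u) : EuclideanSpace ℝ (Fin 1) × ℂ) = (0, v) := by
    refine h5 (hcoe ?_)
    exact (DFunLike.congr_fun h4 u).symm.trans (huv.trans (DFunLike.congr_fun h4 v))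
  exact congrArg Prod.snd h6

theorem Tube.nonempty_closedSolid_homeomorph (T : Tube) :
    Nonempty (T.closedSolid ≃ₜ Circle × D2) := by
  let f : Circle × D2 → T.closedSolid :=
    fun q => ⟨T.toFun (q.1, (q.2 : ℂ)), _, ⟨mem_univ _, q.2.2⟩, rfl⟩
  have hf : Continuous f := Continuous.subtype_mk (T.continuous.comp (by fun_prop)) _
  have hb : Function.Bijective f := by
    constructor
    · intro q q' h
      have h1 := T.injective (congrArg Subtype.val h)
      exact Prod.ext (Prod.mk.inj h1).1 (Subtype.ext (Prod.mk.inj h1).2)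
    · rintro ⟨y, ⟨z, w⟩, ⟨-, hw⟩, h⟩
      exact ⟨(z, ⟨w, hw⟩), Subtype.ext h⟩
  exact ⟨(Continuous.homeoOfEquivCompactToT2 (f := Equiv.ofBijective f hb) hf).symm⟩

namespace ComplexSplitting

/-- The splitting with the two factors exchanged. -/
def swap (Q : ComplexSplitting) : ComplexSplitting where
  fst := Q.snd
  snd := Q.fst
  pair := Q.pair ∘L (ContinuousLinearEquiv.prodComm ℝ ℂ ℂ).toContinuousLinearMap
  fst_pair p := Q.snd_pair p.swap
  snd_pair p := Q.fst_pair p.swap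
  pair_fst_snd y := Q.pair_fst_snd y
  norm_sq y := (Q.norm_sq y).trans (add_comm _ _)

variable {Q : ComplexSplitting}

theorem mem_image_tube {A : Set ℂ} {y : S3} :
    y ∈ Q.tube.toFun '' (univ ×ˢ A) ↔
      Q.fst y ≠ 0 ∧ ‖Q.fst y‖⁻¹ • Q.snd y ∈ A := by
  constructor
  · rintro ⟨p, ⟨-, hp⟩, rfl⟩
    refine ⟨Q.fst_tubeVec_ne_zero p, ?_⟩
    have h : (Q.tubeInv (Q.tubeMap p)).2 ∈ A := by rw [tubeInv_tubeMap]; exact hp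
    exact h
  · rintro ⟨h0, h⟩
    exact ⟨Q.tubeInv y, ⟨mem_univ _, h⟩, Q.tubeMap_tubeInv h0⟩

theorem mem_openSolid_tube {y : S3} : y ∈ Q.tube.openSolid ↔ ‖Q.snd y‖ < ‖Q.fst y‖ := by
  rw [Tube.openSolid, mem_image_tube, mem_ball_zero_iff, norm_smul, norm_inv, norm_norm]
  constructor
  · rintro ⟨h0, h⟩
    rwa [inv_mul_lt_one₀ (norm_pos_iff.2 h0)] at h
  · intro h
    have h0 : 0 < ‖Q.fst y‖ := (norm_nonneg _).trans_lt h
    exact ⟨norm_pos_iff.1 h0, by rwa [inv_mul_lt_one₀ h0]⟩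

theorem mem_closedSolid_tube {y : S3} : y ∈ Q.tube.closedSolid ↔ ‖Q.snd y‖ ≤ ‖Q.fst y‖ := by
  rw [Tube.closedSolid, mem_image_tube, mem_closedBall_zero_iff, norm_smul, norm_inv, norm_norm]
  constructor
  · rintro ⟨h0, h⟩
    rwa [inv_mul_le_one₀ (norm_pos_iff.2 h0)] at h
  · intro h
    have h0 : 0 < ‖Q.fst y‖ := by
      by_contra h0
      have h1 := Q.norm_sq y
      rw [norm_eq_of_mem_sphere] at h1
      nlinarith [norm_nonneg (Q.fst (y : EuclideanSpace ℝ (Fin 4))),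
        norm_nonneg (Q.snd (y : EuclideanSpace ℝ (Fin 4)))]
    exact ⟨norm_pos_iff.1 h0, by rwa [inv_mul_le_one₀ h0]⟩

/-- The complementary solid tori of the genus one splitting of the sphere. -/
theorem exterior_tube : Q.tube.exterior = Q.swap.tube.closedSolid := by
  ext y
  rw [mem_closedSolid_tube, Tube.exterior, mem_compl_iff, mem_openSolid_tube, not_lt]
  rfl

end ComplexSplitting

/-- The exterior of a meridian is a solid torus: after a small contraction towards the centre of
its fibre disc, the meridian is a graph over a great circle in the standard tube. -/
theorem Tube.nonempty_exterior_homeomorph_of_meridian {T m : Tube} {x : Circle}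
    (hm : m.core = T.toFun '' ({x} ×ˢ sphere 0 1)) :
    Nonempty (m.exterior ≃ₜ Circle × D2) := by
  let f : ℂ → EuclideanSpace ℝ (Fin 4) := fun w => T.toFun (x, w)
  have hf : ContDiff ℝ ∞ f := T.contDiff_fibre x
  have hf1 : ∀ w, ‖f w‖ = 1 := fun w => norm_eq_of_mem_sphere _
  have hfd : ∀ w, DifferentiableAt ℝ f w := fun w => hf.differentiable (by simp) w
  have hA := T.injective_fderiv_fibre x 0
  change Function.Injective (fderiv ℝ f 0) at hA
  obtain ⟨Q, hQ, hQ'⟩ := exists_complexSplitting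
    (U := LinearMap.range (fderiv ℝ f 0).toLinearMap)
    (by rw [LinearMap.finrank_range_of_inj hA, Complex.finrank_real_complex])
  -- the tangent plane of the fibre disc is orthogonal to its centre
  have hperp : Q.fst (f 0) = 0 := by
    refine hQ' _ ((Submodule.mem_orthogonal _ _).2 ?_)
    rintro _ ⟨v, rfl⟩
    have h1 := ((hfd 0).hasFDerivAt.inner ℝ (hfd 0).hasFDerivAt)
    have h2 : (fun w => inner ℝ (f w) (f w)) = fun _ => (1 : ℝ) := by
      funext w
      rw [real_inner_self_eq_norm_sq, hf1, one_pow]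
    rw [h2] at h1
    have h3 := DFunLike.congr_fun (h1.unique (hasFDerivAt_const (1 : ℝ) (0 : ℂ))) v
    have h4 : inner ℝ (f 0) (fderiv ℝ f 0 v) + inner ℝ (fderiv ℝ f 0 v) (f 0) = 0 := by
      simpa using h3
    rw [real_inner_comm] at h4
    change inner ℝ (fderiv ℝ f 0 v) (f 0) = 0
    linarith
  have hQf : ∀ u, Q.snd (fderiv ℝ f 0 u) = 0 := fun u => hQ _ ⟨u, rfl⟩
  let b : ℂ → ℂ := fun w => Q.fst (f w)
  let β : ℂ → ℂ := fun w => ‖b w‖⁻¹ • Q.snd (f w)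
  have hb : ContDiff ℝ ∞ b := Q.fst.contDiff.comp hf
  have hbinj : Function.Injective (fderiv ℝ b 0) := by
    have h1 : fderiv ℝ b 0 = Q.fst ∘L fderiv ℝ f 0 :=
      (Q.fst.hasFDerivAt.comp 0 (hfd 0).hasFDerivAt).fderiv
    intro u v huv
    rw [h1] at huv
    refine hA ?_
    rw [← Q.pair_fst_snd (fderiv ℝ f 0 u), ← Q.pair_fst_snd (fderiv ℝ f 0 v), hQf, hQf]
    exact congrArg (fun a => Q.pair (a, 0)) huv
  obtain ⟨R₀, hR₀, hstar⟩ := exists_isStarCurve hperp hb.contDiffAt hbinj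
  obtain ⟨R, hR, hRR⟩ := exists_between (lt_min hR₀ one_pos)
  have hbR := hstar R hR (hRR.trans_le (min_le_left _ _))
  obtain ⟨n, hn, H, hH, -, -⟩ := exists_contract_meridian hm hR (hRR.trans_le (min_le_right _ _))
    isClosed_empty (empty_subset _) (empty_disjoint _)
  have hβ : ∀ w, ‖w‖ = R → DifferentiableAt ℝ β w := fun w hw =>
    (((hbR.differentiableAt w hw).norm ℝ (hbR.ne_zero w hw)).inv
      (norm_ne_zero_iff.2 (hbR.ne_zero w hw))).smul
      (Q.snd.differentiableAt.comp w (hfd w))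
  obtain ⟨s, hs, -, hs1, hs2, hs3⟩ := hbR.exists_graph hR hβ (E := Q.tubeMap) hn
    fun w hw => Q.tubeMap_tubeInv (hbR.ne_zero w hw)
  obtain ⟨H', hH', -⟩ := exists_homeomorph_of_graph (E := Q.tube) hs hs1 hs2 hs3
  obtain ⟨e⟩ := Q.swap.tube.nonempty_closedSolid_homeomorph
  exact ⟨((exteriorHomeomorph H hH).trans (exteriorHomeomorph H' hH')).trans
    ((Homeomorph.setCongr Q.exterior_tube).trans e)⟩

end

theorem lemma1 (K μ : Knot) (hμ : μ.IsMeridianOf K)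
    (νK νμ : Tube) (hνK : νK.IsTubeOf K) (hframe : νK.IsZeroFramed) (hνμ : νμ.IsTubeOf μ)
    (hdisj : Disjoint νK.closedSolid νμ.closedSolid) :
    Nonempty (νμ.exterior ≃ₜ Circle × D2) ∧
    IsThreeManifoldWithBoundary (νK.Surgery νμ.exterior)
      (νK.surgeryImage νμ.exterior νμ.torus) ∧
    Nonempty (νK.surgeryImage νμ.exterior νμ.torus ≃ₜ Circle × Circle) ∧
    ∀ ν : Tube, ν.IsTubeOf K → Nonempty (νK.Surgery νμ.exterior ≃ₜ ν.exterior) := by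
  obtain ⟨T, hT, x, hx⟩ := hμ
  have hm : νμ.core = T.toFun '' ({x} ×ˢ Metric.sphere 0 1) := hνμ.trans hx
  obtain ⟨F, hF⟩ := Tube.exists_surgery_homeomorph (hT.trans hνK.symm : T.core = νK.core) hm hdisj
  refine ⟨Tube.nonempty_exterior_homeomorph_of_meridian hm,
    νK.isThreeManifoldWithBoundary_exterior.of_homeomorph F hF, ?_, fun ν hν => ?_⟩
  · obtain ⟨e⟩ := νK.nonempty_torus_homeomorph
    exact ⟨(F.subtype fun p => (hF p).symm).trans e⟩
  · obtain ⟨H, hH, -⟩ := Tube.exists_homeomorph_of_core_eq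
      (hν.trans hνK.symm : ν.core = νK.core)
    exact ⟨F.trans (Tube.exteriorHomeomorph H hH)⟩
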